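/- **Network.** Let $S=\{1,\dots,N\}$ be a nonempty finite set of modes and let $\mathcal V$ be a finite set of nodes. Mode $i\in S$ has a directed graph on $\mathcal V$ with edge set $\mathcal E_i$, fixed weights $w^{(i)}_e>0$ ($e\in\mathcal E_i$), $s\ge1$ distinct origins $o_i(1),\dots,o_i(s)$ (nodes without incoming edges in mode $i$) and a set $\mathcal V_{d,i}$ of destinations (nodes without outgoing edges in mode $i$). Put $\mathcal E=\bigcup_i\mathcal E_i$, $\mathcal V_d=\bigcup_i\mathcal V_{d,i}$. For tuning parameters $\beta=(\beta_k)_{k\in\mathcal V_d}$, $\delta=(\delta_e)_{e\in\mathcal E}$ let $A_{\mathcal G_i}$ be the weighted adjacency matrix (entry $(k,l)$ is $w^{(i)}_{(l,k)}$ if $(l,k)\in\mathcal E_i$, else $0$), let $D$ have $(k,l)$ entry $\delta_{(l,k)}$ on edges $(l,k)\in\mathcal E$ and $0$ elsewhere, let $B_i$ be diagonal with entries $\beta_k$ for $k\in\mathcal V_{d,i}$ and $0$ otherwise, and $$A_i(\beta,\delta)=D\odot A_{\mathcal G_i}-\operatorname{diag}\bigl(\mathbf 1^\top(D\odot A_{\mathcal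 G_i})\bigr)-B_i .$$ Let $G_i^{\rm in}=[\mathbf e_{o_i(1)}\cdots \mathbf e_{o_i(s)}]$ and $G_i^{\rm out}(\delta)=\begin{bmatrix} I\\ \alpha H_i(\delta)\end{bmatrix}$, where $\alpha>0$ and $H_i(\delta)_{e,k}=\delta_e w^{(i)}_e$ if $e\in\mathcal E_i$ starts at $k$, and $0$ otherwise. The Markov switching buffer network is $$\Sigma_\sigma:\quad \dot x=A_{\sigma(t)}(\beta,\delta)x+G^{\rm in}_{\sigma(t)}f,\qquad y=G^{\rm out}_{\sigma(t)}(\delta)x,$$ where $\sigma$ is a time-homogeneous càdlàg Markov process on $S$ with transition rates $\pi_{ij}\ge0$ ($i\ne j$), $\pi_{ii}=-\sum_{j\neq i}\pi_{ij}$. It is exponentially mean stable if, for $f=0$, $E\|x(t)\|_1\le Ce^{-\lambda t}\|x(0)\|_1$ for some $C,\lambda>0$ and all $t\ge0$, $x(0)$, $\sigma(0)$. Its gain $\|\Sigma_\sigma\|_1$ is the supremum of $\|E[y]\|_{\mathscr L_1}/\|f\|_{\mathscr L_1}$ over $f\in\mathscr L_1$ and over the initial modes $\sigma(0)\in S$,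 with $x(0)=0$. **Tuning problem.** Let $L(\beta,\delta)=\sum_{k\in\mathcal V_d}g_k(\beta_k)+\sum_{e\in\mathcal E}h_e(\delta_e)$ and let $\bar L,\bar\beta_k,\bar\delta_e>0$. Minimize $\|\Sigma_\sigma\|_1$ over all $(\beta,\delta)$ with $0<\beta_k\le\bar\beta_k$, $0<\delta_e\le\bar\delta_e$, $L(\beta,\delta)\le\bar L$ for which $\Sigma_\sigma$ is exponentially mean stable. **Assumption.** A posynomial is a nonempty finite sum of monomials $c\prod_i z_i^{a_i}$ with $c>0$, $a_i\in\mathbb R$, in positive variables $z$. All $g_k,h_e$ are posynomials, and $A_i(\beta,\delta)=A_i^o(\delta)-A_i^d(\beta,\delta)$ for all $i$ and all positive $\beta,\delta$, where all entries of $A_i^o,A_i^d$ are posynomials or zero. **Theorem.** Put $\bar\phi=\log\bar\beta$, $\bar\eta=\log\bar\delta$ (logarithms, exponentials and inequalities of vectors are entrywise) and consider the program $$\begin{aligned}\min_{\gamma>0,\;v_i\in\mathbb R^{\mathcal V}_{++},\;\phi,\;\eta}\ &\gamma\\ \text{s.t. }&\log\Bigl[v_i^\top A_i^o(\exp\eta)+\sum_{j\ne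 i}\pi_{ij}v_j^\top+\mathbf 1^\top G_i^{\rm out}(\exp\eta)\Bigr]-\log\bigl[v_i^\top A_i^d(\exp\phi,\exp\eta)-\pi_{ii}v_i^\top\bigr]\le0\quad(i\in S),\\ &\log[v_i^\top G_i^{\rm in}]-\log[\gamma\mathbf 1^\top]\le0\quad(i\in S),\\ &\log L(\exp\phi,\exp\eta)-\log\bar L\le0,\\ &\log[\exp\phi]-\log[\exp\bar\phi]\le0,\qquad \log[\exp\eta]-\log[\exp\bar\eta]\le0,\end{aligned}$$ whose ground set consists of the points at which all these logarithms are logarithms of positive numbers. Then: 1. The ground set is convex, and the objective and all constraint functions are DC functions (differences of two convex functions) on it. In the variables $(\log\gamma,\log v,\phi,\eta)$ the program is a DC program on a closed convex set: the objective and both logarithms in every constraint are convex. 2. For all $\gamma>0$, $\phi$, $\eta$: there is a $v$ such that $(\gamma,v,\phi,\eta)$ is feasible for the program if and only if $(\exp\phi,\exp\eta)$ is feasible for the tuning problem and $\|\Sigma_\sigma\|_1\le\gamma$ at $(\beta,\delta)=(\exp\phi,\exp\eta)$. In particular the two problems have the same optimal value. 3. If $(\gamma,v,\phi,\eta)$ solves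 the program, then $\beta=\exp\phi$, $\delta=\exp\eta$ solve the tuning problem, with gain $\gamma$. Conversely, every solution $(\beta,\delta)$ of the tuning problem arises in this way from a solution of the program. -/

import Mathlib

open MeasureTheory Filter Topology Matrix
open scoped ENNReal

noncomputable section

/-! ### Posynomials, difference-of-convex functions and programs -/

/-- A posynomial in the positive variables `z i`: a nonempty finite sum of monomials
`c * ∏ i, z i ^ a i` with `c > 0` and real exponents. -/
def IsPosynomial {ι : Type*} [Fintype ι] (f : (ι → ℝ) → ℝ) : Prop :=
  ∃ (m : ℕ) (c : Fin (m + 1) → ℝ) (a : Fin (m + 1) → ι → ℝ), (∀ t, 0 < c t) ∧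
    ∀ z : ι → ℝ, (∀ i, 0 < z i) → f z = ∑ t, c t * ∏ i, z i ^ a t i

/-- A function of positive variables that is a posynomial or identically zero. -/
def IsPosynomialOrZero {ι : Type*} [Fintype ι] (f : (ι → ℝ) → ℝ) : Prop :=
  IsPosynomial f ∨ ∀ z : ι → ℝ, (∀ i, 0 < z i) → f z = 0

/-- `f` is a difference of two real convex functions on the convex set `C`. -/
def IsDCFunction {X : Type*} [AddCommGroup X] [Module ℝ X] (C : Set X) (f : X → ℝ) : Prop :=
  Convex ℝ C ∧ ∃ g h : X → ℝ, ConvexOn ℝ C g ∧ ConvexOn ℝ C h ∧ ∀ x ∈ C, f x = g x - h x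

/-- A program "minimize `obj₁ - obj₂` over `x ∈ ground` subject to `con₁ j - con₂ j ≤ 0`". -/
structure DiffProgram (X J : Type*) where
  ground : Set X
  obj₁ : X → ℝ
  obj₂ : X → ℝ
  con₁ : J → X → ℝ
  con₂ : J → X → ℝ

namespace DiffProgram

variable {X J : Type*}

def Feasible (p : DiffProgram X J) (x : X) : Prop :=
  x ∈ p.ground ∧ ∀ j, p.con₁ j x - p.con₂ j x ≤ 0

def IsSolution (p : DiffProgram X J) (x : X) : Prop :=
  p.Feasible x ∧ ∀ y, p.Feasible y → p.obj₁ x - p.obj₂ x ≤ p.obj₁ y - p.obj₂ y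

/-- The objective and all constraint functions are DC functions on the convex ground set. -/
def HasDCFunctions [AddCommGroup X] [Module ℝ X] (p : DiffProgram X J) : Prop :=
  IsDCFunction p.ground (fun x => p.obj₁ x - p.obj₂ x) ∧
    ∀ j, IsDCFunction p.ground (fun x => p.con₁ j x - p.con₂ j x)

/-- A DC program in its given decomposition: the ground set is closed and convex, and the objective
and each constraint function is displayed as a difference of two convex functions on it. -/
structure IsDCProgram [TopologicalSpace X] [AddCommGroup X] [Module ℝ X]
    (p : DiffProgram X J) : Prop where
  closed : IsClosed p.ground
  convex : Convex ℝ p.ground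
  obj₁_convex : ConvexOn ℝ p.ground p.obj₁
  obj₂_convex : ConvexOn ℝ p.ground p.obj₂
  con₁_convex : ∀ j, ConvexOn ℝ p.ground (p.con₁ j)
  con₂_convex : ∀ j, ConvexOn ℝ p.ground (p.con₂ j)

/-- The same program after the substitution `x = T y`. -/
def substitute {Y : Type*} (p : DiffProgram X J) (T : Y → X) : DiffProgram Y J where
  ground := T ⁻¹' p.ground
  obj₁ := p.obj₁ ∘ T
  obj₂ := p.obj₂ ∘ T
  con₁ j := p.con₁ j ∘ T
  con₂ j := p.con₂ j ∘ T

end DiffProgram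

/-! ### Time-homogeneous Markov processes on a finite set of modes -/

/-- The σ-algebra generated by the process on the time interval `[0, s]`. -/
abbrev pastSigma {Ω M : Type*} (σ : ℝ → Ω → M) (s : ℝ) : MeasurableSpace Ω :=
  ⨆ r ∈ Set.Icc (0 : ℝ) s, MeasurableSpace.comap (σ r) ⊤

/-- `σ` is a time-homogeneous càdlàg Markov process with transition rate matrix `Q`; `P i` is its law
when it is started in the mode `i`. Only times `t ≥ 0` matter. -/
structure IsMarkovFamily {Ω M : Type*} [MeasurableSpace Ω] [Fintype M]
    (Q : Matrix M M ℝ) (P : M → Measure Ω) (σ : ℝ → Ω → M) : Prop where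
  rate_nonneg : ∀ i j, i ≠ j → 0 ≤ Q i j
  rate_sum : ∀ i, ∑ j, Q i j = 0
  isProb : ∀ i, IsProbabilityMeasure (P i)
  measurableSet_mode : ∀ t j, 0 ≤ t → MeasurableSet {ω | σ t ω = j}
  right_cont : ∀ ω t, 0 ≤ t → ∀ᶠ s in 𝓝[>] t, σ s ω = σ t ω
  left_lim : ∀ ω t, 0 < t → ∃ j, ∀ᶠ s in 𝓝[<] t, σ s ω = j
  start : ∀ i, P i {ω | σ 0 ω = i} = 1
  markov : ∀ (i j k : M) (s t : ℝ), 0 ≤ s → 0 ≤ t → ∀ F : Set Ω, MeasurableSet[pastSigma σ s] F →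
    P i (F ∩ {ω | σ s ω = j} ∩ {ω | σ (s + t) ω = k}) =
      P i (F ∩ {ω | σ s ω = j}) * P j {ω | σ t ω = k}
  /-- `P i (σ h = j) = 𝟙(i = j) + Q i j * h + o(h)` as `h ↓ 0` -/
  rate : ∀ i j, HasDerivWithinAt (fun h : ℝ => (P i).real {ω | σ h ω = j}) (Q i j) (Set.Ici 0) 0

/-! ### Markov switching buffer networks -/

/-- The data of a switching buffer network with modes `M`, nodes `V` and input channels `S`: in each
mode a weighted directed graph with its origins (node `origin i c` receives the input `c`) and its
destinations. -/
structure BufferNetwork (M V S : Type*) where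
  edges : M → Finset (V × V)
  weight : M → V × V → ℝ
  weight_pos : ∀ i, ∀ e ∈ edges i, 0 < weight i e
  origin : M → S ↪ V
  origin_no_in : ∀ i c k, (k, origin i c) ∉ edges i
  dests : M → Finset V
  dest_no_out : ∀ i, ∀ k ∈ dests i, ∀ l, (k, l) ∉ edges i
  /-- the weight of the flows in the output -/
  alpha : ℝ
  alpha_pos : 0 < alpha

namespace BufferNetwork

variable {M V S : Type*} [Fintype M] [DecidableEq M] [Fintype V] [DecidableEq V]
  [Fintype S]

/-- All edges that occur in some mode: the index set of the parameters `δ`. -/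
abbrev Edge (N : BufferNetwork M V S) : Type _ := {e : V × V // ∃ i, e ∈ N.edges i}

/-- All nodes that are a destination in some mode: the index set of the parameters `β`. -/
abbrev Dest (N : BufferNetwork M V S) : Type _ := {k : V // ∃ i, k ∈ N.dests i}

/-- The weighted adjacency matrix of mode `i`: entry `(k, l)` is the weight of the edge `l → k`. -/
def adj (N : BufferNetwork M V S) (i : M) : Matrix V V ℝ :=
  Matrix.of fun k l => if (l, k) ∈ N.edges i then N.weight i (l, k) else 0

/-- The matrix `D`: entry `(k, l)` is the parameter of the edge `l → k`. -/
def Dmat (N : BufferNetwork M V S) (δ : N.Edge → ℝ) : Matrix V V ℝ :=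
  Matrix.of fun k l => if h : ∃ i, (l, k) ∈ N.edges i then δ ⟨(l, k), h⟩ else 0

/-- The diagonal matrix `B` of the outlet rates in mode `i`. -/
def Bmat (N : BufferNetwork M V S) (i : M) (β : N.Dest → ℝ) : Matrix V V ℝ :=
  Matrix.diagonal fun k => if h : k ∈ N.dests i then β ⟨k, i, h⟩ else 0

/-- `A = D ⊙ A_G - diag (1ᵀ (D ⊙ A_G)) - B` in mode `i`. -/
def Amat (N : BufferNetwork M V S) (i : M) (β : N.Dest → ℝ) (δ : N.Edge → ℝ) : Matrix V V ℝ :=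
  N.Dmat δ ⊙ N.adj i - Matrix.diagonal ((1 : V → ℝ) ᵥ* (N.Dmat δ ⊙ N.adj i)) - N.Bmat i β

/-- The input matrix of mode `i`. -/
def Gin (N : BufferNetwork M V S) (i : M) : Matrix V S ℝ :=
  Matrix.of fun k c => if k = N.origin i c then 1 else 0

/-- The flow matrix of mode `i`: `(H x)_e = δ_e w_e x_k` is the flow on the edge `e = (k, l)`. -/
def Hmat (N : BufferNetwork M V S) (i : M) (δ : N.Edge → ℝ) : Matrix N.Edge V ℝ :=
  Matrix.of fun e k => if k = e.1.1 ∧ e.1 ∈ N.edges i then δ e * N.weight i e.1 else 0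

/-- The output matrix of mode `i`: the output is `y = (x, α u)` with `u` the vector of flows. -/
def Gout (N : BufferNetwork M V S) (i : M) (δ : N.Edge → ℝ) : Matrix (V ⊕ N.Edge) V ℝ :=
  Matrix.fromRows 1 (N.alpha • N.Hmat i δ)

section Stochastic

variable {Ω : Type*}

/-- For every sample `ω`, the function `t ↦ x t ω` solves
`x' = A_σ(t) x + Gin_σ(t) f`, `x 0 = x₀` on `[0, ∞)` (in integrated form). -/
def IsTrajectory (N : BufferNetwork M V S) (σ : ℝ → Ω → M) (β : N.Dest → ℝ) (δ : N.Edge → ℝ)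
    (f : ℝ → S → ℝ) (x₀ : V → ℝ) (x : ℝ → Ω → V → ℝ) : Prop :=
  ∀ ω, ContinuousOn (fun t => x t ω) (Set.Ici 0) ∧
    ∀ t, 0 ≤ t → ∀ k, x t ω k = x₀ k +
      ∫ s in (0 : ℝ)..t, (N.Amat (σ s ω) β δ *ᵥ x s ω + N.Gin (σ s ω) *ᵥ f s) k

/-- Exponential mean stability: with zero input, `E ‖x(t)‖₁ ≤ C e^{-lam t} ‖x₀‖₁` for all initial
states and all initial modes. -/
def ExpMeanStable [MeasurableSpace Ω] (N : BufferNetwork M V S) (P : M → Measure Ω)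
    (σ : ℝ → Ω → M) (β : N.Dest → ℝ) (δ : N.Edge → ℝ) : Prop :=
  ∃ C lam : ℝ, 0 < C ∧ 0 < lam ∧ ∀ (i : M) (x₀ : V → ℝ) (x : ℝ → Ω → V → ℝ),
    N.IsTrajectory σ β δ (fun _ => 0) x₀ x → ∀ t, 0 ≤ t →
      ∫ ω, ∑ k, |x t ω k| ∂(P i) ≤ C * Real.exp (-lam * t) * ∑ k, |x₀ k|

/-- The `L¹`-gain: the supremum of `‖E[y]‖_{L¹} / ‖f‖_{L¹}` over all inputs `f ∈ L¹` and all initial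
modes, for the zero initial state (trajectories exist and are unique). -/
def l1Gain [MeasurableSpace Ω] (N : BufferNetwork M V S) (P : M → Measure Ω)
    (σ : ℝ → Ω → M) (β : N.Dest → ℝ) (δ : N.Edge → ℝ) : ℝ≥0∞ :=
  ⨆ (i : M) (f : ℝ → S → ℝ) (x : ℝ → Ω → V → ℝ) (_ : IntegrableOn f (Set.Ici 0))
    (_ : N.IsTrajectory σ β δ f 0 x),
    (∫⁻ t in Set.Ici (0 : ℝ),
        ENNReal.ofReal (∑ r, |∫ ω, (N.Gout (σ t ω) δ *ᵥ x t ω) r ∂(P i)|)) /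
      ∫⁻ t in Set.Ici (0 : ℝ), ENNReal.ofReal (∑ c, |f t c|)

end Stochastic

/-! ### The tuning problem -/

/-- Cost functions, cost budget and upper bounds of the parameters. -/
structure Tuning (N : BufferNetwork M V S) where
  g : N.Dest → ℝ → ℝ
  h : N.Edge → ℝ → ℝ
  budget : ℝ
  budget_pos : 0 < budget
  betaMax : N.Dest → ℝ
  betaMax_pos : ∀ k, 0 < betaMax k
  deltaMax : N.Edge → ℝ
  deltaMax_pos : ∀ e, 0 < deltaMax e

/-- The tuning cost `L(β, δ)`. -/
def Tuning.cost {N : BufferNetwork M V S} (T : N.Tuning) (β : N.Dest → ℝ) (δ : N.Edge → ℝ) : ℝ :=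
  ∑ k, T.g k (β k) + ∑ e, T.h e (δ e)

/-- The constraints of the tuning problem: the intervals, the budget, and stability (the gain is
considered for exponentially mean stable systems). -/
structure Tuning.Admissible {Ω : Type*} [MeasurableSpace Ω] {N : BufferNetwork M V S}
    (T : N.Tuning) (P : M → Measure Ω) (σ : ℝ → Ω → M)
    (β : N.Dest → ℝ) (δ : N.Edge → ℝ) : Prop where
  beta_pos : ∀ k, 0 < β k
  beta_le : ∀ k, β k ≤ T.betaMax k
  delta_pos : ∀ e, 0 < δ e
  delta_le : ∀ e, δ e ≤ T.deltaMax e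
  cost_le : T.cost β δ ≤ T.budget
  stable : N.ExpMeanStable P σ β δ

/-- `(β, δ)` minimizes the `L¹`-gain under the constraints. -/
def Tuning.IsOptimal {Ω : Type*} [MeasurableSpace Ω] {N : BufferNetwork M V S}
    (T : N.Tuning) (P : M → Measure Ω) (σ : ℝ → Ω → M)
    (β : N.Dest → ℝ) (δ : N.Edge → ℝ) : Prop :=
  T.Admissible P σ β δ ∧
    ∀ β' δ', T.Admissible P σ β' δ' → N.l1Gain P σ β δ ≤ N.l1Gain P σ β' δ'

/-- `A_i(β, δ) = Ao_i(δ) - Ad_i(β, δ)` with entries that are posynomials or zero, and the cost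
functions are posynomials. -/
structure PosynomialAssumption (N : BufferNetwork M V S) (T : N.Tuning)
    (Ao : M → (N.Edge → ℝ) → Matrix V V ℝ)
    (Ad : M → (N.Dest → ℝ) → (N.Edge → ℝ) → Matrix V V ℝ) : Prop where
  split : ∀ i (β : N.Dest → ℝ) (δ : N.Edge → ℝ), (∀ k, 0 < β k) → (∀ e, 0 < δ e) →
    N.Amat i β δ = Ao i δ - Ad i β δ
  posy_Ao : ∀ i l k, IsPosynomialOrZero fun δ : N.Edge → ℝ => Ao i δ l k
  posy_Ad : ∀ i l k, IsPosynomialOrZero fun z : N.Dest ⊕ N.Edge → ℝ =>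
    Ad i (fun d => z (Sum.inl d)) (fun e => z (Sum.inr e)) l k
  posy_g : ∀ k, IsPosynomial fun b : Unit → ℝ => T.g k (b ())
  posy_h : ∀ e, IsPosynomial fun d : Unit → ℝ => T.h e (d ())

/-! ### The explicit program -/

/-- The decision variables `(γ, v, φ, η)`. -/
abbrev Vars (N : BufferNetwork M V S) : Type _ :=
  ℝ × (M → V → ℝ) × (N.Dest → ℝ) × (N.Edge → ℝ)

/-- The index set of the scalar constraints. -/
inductive Con (N : BufferNetwork M V S) where
  | lyap (i : M) (k : V)
  | gain (i : M) (c : S)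
  | cost
  | beta (k : N.Dest)
  | delta (e : N.Edge)

/-- The arguments of the first logarithms in the constraints `log a - log b ≤ 0`. -/
def argL (N : BufferNetwork M V S) (T : N.Tuning) (Q : Matrix M M ℝ)
    (Ao : M → (N.Edge → ℝ) → Matrix V V ℝ) : N.Con → N.Vars → ℝ
  | .lyap i k, (_, v, _, η) =>
      (v i ᵥ* Ao i (fun e => Real.exp (η e))) k + ∑ j ∈ Finset.univ.erase i, Q i j * v j k +
        ((1 : V ⊕ N.Edge → ℝ) ᵥ* N.Gout i (fun e => Real.exp (η e))) k
  | .gain i c, (_, v, _, _) => (v i ᵥ* N.Gin i) c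
  | .cost, (_, _, φ, η) => T.cost (fun k => Real.exp (φ k)) (fun e => Real.exp (η e))
  | .beta k, (_, _, φ, _) => Real.exp (φ k)
  | .delta e, (_, _, _, η) => Real.exp (η e)

/-- The arguments of the second logarithms in the constraints `log a - log b ≤ 0`. -/
def argR (N : BufferNetwork M V S) (T : N.Tuning) (Q : Matrix M M ℝ)
    (Ad : M → (N.Dest → ℝ) → (N.Edge → ℝ) → Matrix V V ℝ) : N.Con → N.Vars → ℝ
  | .lyap i k, (_, v, φ, η) =>
      (v i ᵥ* Ad i (fun d => Real.exp (φ d)) (fun e => Real.exp (η e))) k - Q i i * v i k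
  | .gain _ _, (γ, _, _, _) => γ
  | .cost, _ => T.budget
  | .beta k, _ => Real.exp (Real.log (T.betaMax k))
  | .delta e, _ => Real.exp (Real.log (T.deltaMax e))

/-- The explicit program: minimize `γ` subject to `log (argL j) - log (argR j) ≤ 0` for all `j`, over
`γ > 0`, `v > 0` and real `φ`, `η`; all logarithms have to be logarithms of positive numbers. -/
def logProgram (N : BufferNetwork M V S) (T : N.Tuning) (Q : Matrix M M ℝ)
    (Ao : M → (N.Edge → ℝ) → Matrix V V ℝ)
    (Ad : M → (N.Dest → ℝ) → (N.Edge → ℝ) → Matrix V V ℝ) : DiffProgram N.Vars N.Con where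
  ground := {x | 0 < x.1 ∧ (∀ i k, 0 < x.2.1 i k) ∧
    ∀ j, 0 < N.argL T Q Ao j x ∧ 0 < N.argR T Q Ad j x}
  obj₁ x := x.1
  obj₂ _ := 0
  con₁ j x := Real.log (N.argL T Q Ao j x)
  con₂ j x := Real.log (N.argR T Q Ad j x)

/-- The logarithmic change of the variables `γ` and `v` (`φ` and `η` are logarithmic already). -/
def expVars (N : BufferNetwork M V S) : N.Vars → N.Vars :=
  fun x => (Real.exp x.1, fun i k => Real.exp (x.2.1 i k), x.2.2.1, x.2.2.2)

end BufferNetwork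

end

/-!
The joint moments `z (j, k) = E[𝟙(σ t = j) x_k]` of the switched network solve a *linear* equation
with constant coefficients, `z' = L z + b`, where `L = momentMatrix Q A` combines the rate matrix of
`σ` with the matrices `A j` (`IsMarkovFamily.moment_eq`). All `A j` are Metzler matrices, hence so
is `L`, and `exp (t L)` has nonnegative entries. With `c ≥ 1` the column sums of the output matrices
(`momentWeight`), two questions about the network become questions about `L`.

* Stability. If some `v > 0` satisfies `v L ≤ -c`, then `v exp (t L)` decays exponentially. A
  trajectory is dominated by the one that starts in the absolute values of its initial state, and
  the mean of the latter is a sum of moments, so the network is mean stable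
  (`expMeanStable_of_lyapunov`). Conversely, mean stability forces `exp (t L)` to decay, and
  `v = ∫ c exp (t L) dt` is positive with `v L = -c` (`ExpMeanStable.exists_lyapunov`).
* Gain. The total expected output is at most the integral of a convolution of `c exp (t L)` with the
  input of the moment equation, and at least it for nonnegative inputs. The integral of a
  convolution is the product of the integrals (`Matrix.IsMetzler.lintegral_output`). So `v L ≤ -c`
  bounds the gain by the largest value of `v` at an origin (`l1Gain_le_of_lyapunov`), and short
  pulses at the origins show that `v = ∫ c exp (t L) dt` attains this bound
  (`mul_one_sub_le_l1Gain`).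

With `A_i = Ao_i - Ad_i`, the inequality `v L ≤ -c` is the first constraint of the program without
its logarithms, and the other constraints transcribe similarly (`feasible_iff`). The three claims
about sublevel sets, optimal values and solutions follow.

For the convexity, posynomials of exponentials are log-convex, and log-convexity survives sums and
products. In logarithmic variables all arguments of the logarithms are therefore log-convex. In the
original variables the same arguments become log-convex after multiplication by
`W = 1 / (γ ∏ v_i k)`, a factor that cancels in the difference of the two logarithms
(`logConvexOn_arg`, `logProgram_hasDCFunctions`). The ground set is either `{γ > 0, v > 0}` or empty
(`ground_eq`).
-/

set_option linter.unusedSectionVars false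

noncomputable section

/-! ### Multiplicatively convex functions and posynomials -/

/-- `f` is nonnegative and `log f` is convex on `C`, written multiplicatively so that zeros of `f`
are allowed. -/
def LogConvexOn {X : Type*} [AddCommGroup X] [Module ℝ X] (C : Set X) (f : X → ℝ) : Prop :=
  (∀ x ∈ C, 0 ≤ f x) ∧ ∀ x ∈ C, ∀ y ∈ C, ∀ a b : ℝ, 0 < a → 0 < b → a + b = 1 →
    f (a • x + b • y) ≤ f x ^ a * f y ^ b

namespace LogConvexOn

variable {X : Type*} [AddCommGroup X] [Module ℝ X] {C : Set X} {f g : X → ℝ}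

/-- Hölder's inequality for two terms. -/
lemma rpow_mul_rpow_add_le {p q r s a b : ℝ} (hp : 0 ≤ p) (hq : 0 ≤ q) (hr : 0 ≤ r) (hs : 0 ≤ s)
    (ha : 0 < a) (hb : 0 < b) (hab : a + b = 1) :
    p ^ a * q ^ b + r ^ a * s ^ b ≤ (p + r) ^ a * (q + s) ^ b := by
  rcases (add_nonneg hp hr).eq_or_lt with h | h
  · have hp0 : p = 0 := by linarith
    have hr0 : r = 0 := by linarith
    simp [hp0, hr0, Real.zero_rpow ha.ne']
  rcases (add_nonneg hq hs).eq_or_lt with h' | h'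
  · have hq0 : q = 0 := by linarith
    have hs0 : s = 0 := by linarith
    simp [hq0, hs0, Real.zero_rpow hb.ne']
  have key : ∀ u w : ℝ, 0 ≤ u → 0 ≤ w → u ^ a * w ^ b =
      ((p + r) ^ a * (q + s) ^ b) * ((u / (p + r)) ^ a * (w / (q + s)) ^ b) := by
    intro u w hu hw
    rw [Real.div_rpow hu h.le, Real.div_rpow hw h'.le]
    have := (Real.rpow_pos_of_pos h a).ne'
    have := (Real.rpow_pos_of_pos h' b).ne'
    field_simp
  have h1 := Real.geom_mean_le_arith_mean2_weighted ha.le hb.le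
    (div_nonneg hp h.le) (div_nonneg hq h'.le) hab
  have h2 := Real.geom_mean_le_arith_mean2_weighted ha.le hb.le
    (div_nonneg hr h.le) (div_nonneg hs h'.le) hab
  have h3 : a * (p / (p + r)) + b * (q / (q + s)) +
      (a * (r / (p + r)) + b * (s / (q + s))) = 1 := by
    have e1 : p / (p + r) + r / (p + r) = 1 := by rw [← add_div, div_self h.ne']
    have e2 : q / (q + s) + s / (q + s) = 1 := by rw [← add_div, div_self h'.ne']
    linear_combination a * e1 + b * e2 + hab
  rw [key p q hp hq, key r s hr hs, ← mul_add]
  refine mul_le_of_le_one_right (by positivity) (by linarith)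

lemma add (hf : LogConvexOn C f) (hg : LogConvexOn C g) :
    LogConvexOn C (fun x => f x + g x) := by
  refine ⟨fun x hx => add_nonneg (hf.1 x hx) (hg.1 x hx), fun x hx y hy a b ha hb hab => ?_⟩
  exact (add_le_add (hf.2 x hx y hy a b ha hb hab) (hg.2 x hx y hy a b ha hb hab)).trans
    (rpow_mul_rpow_add_le (hf.1 x hx) (hf.1 y hy) (hg.1 x hx) (hg.1 y hy) ha hb hab)

lemma mul (hC : Convex ℝ C) (hf : LogConvexOn C f) (hg : LogConvexOn C g) :
    LogConvexOn C (fun x => f x * g x) := by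
  refine ⟨fun x hx => mul_nonneg (hf.1 x hx) (hg.1 x hx), fun x hx y hy a b ha hb hab => ?_⟩
  have hz := hC hx hy ha.le hb.le hab
  have hfx := hf.1 x hx
  have hfy := hf.1 y hy
  refine (mul_le_mul (hf.2 x hx y hy a b ha hb hab) (hg.2 x hx y hy a b ha hb hab)
    (hg.1 _ hz) (by positivity)).trans_eq ?_
  rw [Real.mul_rpow hfx (hg.1 x hx), Real.mul_rpow hfy (hg.1 y hy)]
  ring

lemma const {c : ℝ} (hc : 0 ≤ c) : LogConvexOn C (fun _ => c) := by
  refine ⟨fun _ _ => hc, fun x _ y _ a b ha hb hab => ?_⟩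
  rw [← Real.rpow_add_of_nonneg hc ha.le hb.le, hab, Real.rpow_one]

lemma congr (hC : Convex ℝ C) (hf : LogConvexOn C f) (h : ∀ x ∈ C, g x = f x) :
    LogConvexOn C g := by
  refine ⟨fun x hx => h x hx ▸ hf.1 x hx, fun x hx y hy a b ha hb hab => ?_⟩
  rw [h _ (hC hx hy ha.le hb.le hab), h x hx, h y hy]
  exact hf.2 x hx y hy a b ha hb hab

lemma sum (hC : Convex ℝ C) {ι : Type*} (s : Finset ι) {F : ι → X → ℝ}
    (h : ∀ i ∈ s, LogConvexOn C (F i)) : LogConvexOn C (fun x => ∑ i ∈ s, F i x) := by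
  classical
  induction s using Finset.induction_on with
  | empty => simpa using const (C := C) le_rfl
  | insert i s hi ih =>
    refine ((h i (Finset.mem_insert_self i s)).add
      (ih fun j hj => h j (Finset.mem_insert_of_mem hj))).congr hC fun x _ => ?_
    rw [Finset.sum_insert hi]

lemma exp (hf : ConvexOn ℝ C f) : LogConvexOn C (fun x => Real.exp (f x)) := by
  refine ⟨fun x _ => (Real.exp_pos _).le, fun x hx y hy a b ha hb hab => ?_⟩
  rw [← Real.exp_mul, ← Real.exp_mul, ← Real.exp_add]
  refine Real.exp_le_exp.2 ((hf.2 hx hy ha.le hb.le hab).trans_eq ?_)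
  simp only [smul_eq_mul]
  ring

lemma convexOn_log (hC : Convex ℝ C) (hf : LogConvexOn C f) (hpos : ∀ x ∈ C, 0 < f x) :
    ConvexOn ℝ C (fun x => Real.log (f x)) := by
  rw [convexOn_iff_forall_pos]
  refine ⟨hC, fun x hx y hy a b ha hb hab => ?_⟩
  have h1 := Real.log_le_log (hpos _ (hC hx hy ha.le hb.le hab)) (hf.2 x hx y hy a b ha hb hab)
  have hx' := hpos x hx
  have hy' := hpos y hy
  rwa [Real.log_mul (Real.rpow_pos_of_pos hx' a).ne' (Real.rpow_pos_of_pos hy' b).ne',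
    Real.log_rpow hx', Real.log_rpow hy'] at h1

end LogConvexOn

lemma IsPosynomial.pos {ι : Type*} [Fintype ι] {f : (ι → ℝ) → ℝ} (hf : IsPosynomial f)
    {z : ι → ℝ} (hz : ∀ i, 0 < z i) : 0 < f z := by
  obtain ⟨m, c, a, hc, h⟩ := hf
  rw [h z hz]
  exact Finset.sum_pos (fun t _ => mul_pos (hc t)
    (Finset.prod_pos fun i _ => Real.rpow_pos_of_pos (hz i) _)) Finset.univ_nonempty

lemma IsPosynomialOrZero.nonneg {ι : Type*} [Fintype ι] {f : (ι → ℝ) → ℝ}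
    (hf : IsPosynomialOrZero f) {z : ι → ℝ} (hz : ∀ i, 0 < z i) : 0 ≤ f z :=
  hf.elim (fun h => (h.pos hz).le) fun h => (h z hz).ge

/-- A posynomial is log-convex in the logarithms of its variables. -/
lemma IsPosynomialOrZero.logConvexOn {ι X : Type*} [Fintype ι] [AddCommGroup X] [Module ℝ X]
    {C : Set X} (hC : Convex ℝ C) {f : (ι → ℝ) → ℝ} (hf : IsPosynomialOrZero f)
    (L : ι → X →ₗ[ℝ] ℝ) : LogConvexOn C (fun x => f fun i => Real.exp (L i x)) := by
  rcases hf with ⟨m, c, a, hc, h⟩ | h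
  · have hmon : ∀ t, LogConvexOn C (fun x => c t * Real.exp ((∑ i, a t i • L i) x)) := fun t =>
      (LogConvexOn.const (hc t).le).mul hC (LogConvexOn.exp (LinearMap.convexOn _ hC))
    refine (LogConvexOn.sum hC Finset.univ fun t _ => hmon t).congr hC fun x _ => ?_
    rw [h _ fun i => Real.exp_pos _]
    refine Finset.sum_congr rfl fun t _ => ?_
    simp only [LinearMap.sum_apply, LinearMap.smul_apply, smul_eq_mul, Real.exp_sum]
    congr 1
    refine Finset.prod_congr rfl fun i _ => ?_
    rw [← Real.exp_mul, mul_comm]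
  · exact (LogConvexOn.const le_rfl).congr hC fun x _ => h _ fun i => Real.exp_pos _

/-! ### Convexity of the logarithmic program -/

namespace BufferNetwork

variable {M V S : Type*} [Fintype M] [DecidableEq M] [Fintype V] [DecidableEq V]
  [Fintype S] {N : BufferNetwork M V S} {T : N.Tuning} {Q : Matrix M M ℝ}
  {Ao : M → (N.Edge → ℝ) → Matrix V V ℝ} {Ad : M → (N.Dest → ℝ) → (N.Edge → ℝ) → Matrix V V ℝ}

/-- The points with positive `γ` and `v`. -/
def positiveVars (N : BufferNetwork M V S) : Set N.Vars :=
  {x | 0 < x.1 ∧ ∀ i k, 0 < x.2.1 i k}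

lemma convex_positiveVars : Convex ℝ N.positiveVars := by
  intro x hx y hy a b ha hb hab
  have key : ∀ p q : ℝ, 0 < p → 0 < q → 0 < a * p + b * q := fun p q hp hq => by
    have := (convex_Ioi (0 : ℝ)) hp hq ha hb hab
    simpa using this
  exact ⟨key _ _ hx.1 hy.1, fun i k => key _ _ (hx.2 i k) (hy.2 i k)⟩

/-- The total output produced per unit of storage in each node. -/
def outWeight (N : BufferNetwork M V S) (i : M) (δ : N.Edge → ℝ) (k : V) : ℝ :=
  ((1 : V ⊕ N.Edge → ℝ) ᵥ* N.Gout i δ) k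

lemma Gout_nonneg {δ : N.Edge → ℝ} (hδ : ∀ e, 0 < δ e) (i : M) (r : V ⊕ N.Edge) (k : V) :
    0 ≤ N.Gout i δ r k := by
  rcases r with l | e
  · simp only [Gout, Matrix.fromRows_apply_inl, Matrix.one_apply]
    split_ifs <;> norm_num
  · simp only [Gout, Matrix.fromRows_apply_inr, Matrix.smul_apply, Hmat, Matrix.of_apply,
      smul_eq_mul]
    refine mul_nonneg N.alpha_pos.le ?_
    split_ifs with h
    · exact mul_nonneg (hδ e).le (N.weight_pos i _ h.2).le
    · exact le_rfl

lemma outWeight_eq (i : M) (δ : N.Edge → ℝ) (k : V) :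
    N.outWeight i δ k = 1 + ∑ e : N.Edge, N.alpha *
      if k = e.1.1 ∧ e.1 ∈ N.edges i then δ e * N.weight i e.1 else 0 := by
  simp only [outWeight, Matrix.vecMul, dotProduct, Fintype.sum_sum_type, Gout,
    Matrix.fromRows_apply_inl, Matrix.fromRows_apply_inr, Pi.one_apply, one_mul, Matrix.smul_apply,
    Hmat, Matrix.of_apply, smul_eq_mul]
  congr 1
  simp [Matrix.one_apply]

lemma one_le_outWeight {δ : N.Edge → ℝ} (hδ : ∀ e, 0 < δ e) (i : M) (k : V) :
    1 ≤ N.outWeight i δ k := by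
  rw [outWeight_eq]
  refine le_add_of_nonneg_right (Finset.sum_nonneg fun e _ => mul_nonneg N.alpha_pos.le ?_)
  split_ifs with h
  · exact mul_nonneg (hδ e).le (N.weight_pos i _ h.2).le
  · exact le_rfl

lemma rate_diag_nonpos (hQ : ∀ i j, i ≠ j → 0 ≤ Q i j) (hQs : ∀ i, ∑ j, Q i j = 0) (i : M) :
    Q i i ≤ 0 := by
  have h := hQs i
  rw [← Finset.add_sum_erase _ _ (Finset.mem_univ i)] at h
  have : 0 ≤ ∑ j ∈ Finset.univ.erase i, Q i j :=
    Finset.sum_nonneg fun j hj => hQ i j (Finset.ne_of_mem_erase hj).symm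
  linarith

/-- Multiplied by a function `W` that makes `W`, `γ W` and `v W` log-convex, the arguments of all
logarithms in the program are log-convex. The map `R` is a reparametrization of `γ` and `v`. -/
lemma logConvexOn_arg {C : Set N.Vars} (hC : Convex ℝ C) (R : N.Vars → N.Vars)
    (hR : ∀ x, (R x).2.2 = x.2.2) {W : N.Vars → ℝ} (hW : LogConvexOn C W)
    (hγ : LogConvexOn C fun x => (R x).1 * W x)
    (hv : ∀ i k, LogConvexOn C fun x => (R x).2.1 i k * W x)
    (hQ : ∀ i j, i ≠ j → 0 ≤ Q i j) (hQs : ∀ i, ∑ j, Q i j = 0)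
    (hA : N.PosynomialAssumption T Ao Ad) (j : N.Con) :
    LogConvexOn C (fun x => N.argL T Q Ao j (R x) * W x) ∧
      LogConvexOn C (fun x => N.argR T Q Ad j (R x) * W x) := by
  let Lφ : N.Dest → N.Vars →ₗ[ℝ] ℝ := fun k => LinearMap.proj k ∘ₗ LinearMap.fst ℝ _ _ ∘ₗ
    LinearMap.snd ℝ _ _ ∘ₗ LinearMap.snd ℝ _ _
  let Lη : N.Edge → N.Vars →ₗ[ℝ] ℝ := fun e => LinearMap.proj e ∘ₗ LinearMap.snd ℝ _ _ ∘ₗ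
    LinearMap.snd ℝ _ _ ∘ₗ LinearMap.snd ℝ _ _
  have hφ : ∀ x k, (R x).2.2.1 k = Lφ k x := fun x k => by rw [hR]; rfl
  have hη : ∀ x e, (R x).2.2.2 e = Lη e x := fun x e => by rw [hR]; rfl
  have expφ : ∀ k, LogConvexOn C fun x => Real.exp ((R x).2.2.1 k) := fun k =>
    (LogConvexOn.exp ((Lφ k).convexOn hC)).congr hC fun x _ => by rw [hφ]
  have expη : ∀ e, LogConvexOn C fun x => Real.exp ((R x).2.2.2 e) := fun e =>
    (LogConvexOn.exp ((Lη e).convexOn hC)).congr hC fun x _ => by rw [hη]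
  rcases j with ⟨i, k⟩ | ⟨i, c⟩ | _ | k | e
  · have hAo : ∀ l, LogConvexOn C fun x => Ao i (fun e => Real.exp ((R x).2.2.2 e)) l k := fun l =>
      ((hA.posy_Ao i l k).logConvexOn hC Lη).congr hC fun x _ => by simp only [hη]
    have hAd : ∀ l, LogConvexOn C fun x => Ad i (fun d => Real.exp ((R x).2.2.1 d))
        (fun e => Real.exp ((R x).2.2.2 e)) l k := fun l =>
      ((hA.posy_Ad i l k).logConvexOn hC (Sum.elim Lφ Lη)).congr hC fun x _ => by
        simp only [hη, hφ, Sum.elim_inl, Sum.elim_inr]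
    have hG : LogConvexOn C fun x => N.outWeight i (fun e => Real.exp ((R x).2.2.2 e)) k := by
      refine ((LogConvexOn.const zero_le_one).add (LogConvexOn.sum hC Finset.univ
        (F := fun e x => N.alpha * if k = e.1.1 ∧ e.1 ∈ N.edges i then
          Real.exp ((R x).2.2.2 e) * N.weight i e.1 else 0)
        fun e _ => (LogConvexOn.const N.alpha_pos.le).mul hC ?_)).congr hC
          fun x _ => outWeight_eq _ _ _
      split_ifs with h
      · exact (expη e).mul hC (LogConvexOn.const (N.weight_pos i _ h.2).le)
      · exact LogConvexOn.const le_rfl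
    constructor
    · refine (((LogConvexOn.sum hC Finset.univ fun l _ => (hv i l).mul hC (hAo l)).add
        (LogConvexOn.sum hC (Finset.univ.erase i) fun j hj =>
          (LogConvexOn.const (hQ i j (Finset.ne_of_mem_erase hj).symm)).mul hC (hv j k))).add
          (hG.mul hC hW)).congr hC fun x _ => ?_
      simp only [argL, Matrix.vecMul, dotProduct, add_mul, Finset.sum_mul, outWeight]
      congr 2
      · exact Finset.sum_congr rfl fun l _ => by ring
      · exact Finset.sum_congr rfl fun l _ => by ring
    · refine ((LogConvexOn.sum hC Finset.univ fun l _ => (hv i l).mul hC (hAd l)).add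
        ((LogConvexOn.const (neg_nonneg.2 (rate_diag_nonpos hQ hQs i))).mul hC (hv i k))).congr hC
          fun x _ => ?_
      simp only [argR, Matrix.vecMul, dotProduct, sub_mul, Finset.sum_mul]
      rw [sub_eq_add_neg]
      congr 1
      · exact Finset.sum_congr rfl fun l _ => by ring
      · ring
  · refine ⟨?_, hγ⟩
    refine (LogConvexOn.sum hC Finset.univ (F := fun l x => ((R x).2.1 i l * W x) * N.Gin i l c)
      fun l _ => (hv i l).mul hC (LogConvexOn.const ?_)).congr hC fun x _ => ?_
    · simp only [Gin, Matrix.of_apply]; split_ifs <;> norm_num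
    · simp only [argL, Matrix.vecMul, dotProduct, Finset.sum_mul]
      exact Finset.sum_congr rfl fun l _ => by ring
  · refine ⟨LogConvexOn.mul hC ?_ hW, (LogConvexOn.const T.budget_pos.le).mul hC hW⟩
    refine (LogConvexOn.sum hC Finset.univ fun k _ => ?_).add
      (LogConvexOn.sum hC Finset.univ fun e _ => ?_)
    · exact (IsPosynomialOrZero.logConvexOn hC (Or.inl (hA.posy_g k)) fun _ => Lφ k).congr hC
        fun x _ => by simp only [hφ]
    · exact (IsPosynomialOrZero.logConvexOn hC (Or.inl (hA.posy_h e)) fun _ => Lη e).congr hC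
        fun x _ => by simp only [hη]
  · exact ⟨(expφ k).mul hC hW, (LogConvexOn.const (Real.exp_pos _).le).mul hC hW⟩
  · exact ⟨(expη e).mul hC hW, (LogConvexOn.const (Real.exp_pos _).le).mul hC hW⟩

lemma argL_lyap_pos (hQ : ∀ i j, i ≠ j → 0 ≤ Q i j)
    (hA : N.PosynomialAssumption T Ao Ad) {x : N.Vars} (hx : x ∈ N.positiveVars) (i : M) (k : V) :
    0 < N.argL T Q Ao (.lyap i k) x := by
  refine add_pos_of_nonneg_of_pos (add_nonneg (Finset.sum_nonneg fun l _ => ?_)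
    (Finset.sum_nonneg fun j hj => ?_)) ?_
  · exact mul_nonneg (hx.2 i l).le ((hA.posy_Ao i l k).nonneg fun e => Real.exp_pos _)
  · exact mul_nonneg (hQ i j (Finset.ne_of_mem_erase hj).symm) (hx.2 j k).le
  · exact zero_lt_one.trans_le (one_le_outWeight (fun e => Real.exp_pos _) i k)

lemma vecMul_Gin (v : V → ℝ) (i : M) (c : S) : (v ᵥ* N.Gin i) c = v (N.origin i c) := by
  simp [Matrix.vecMul, dotProduct, Gin]

lemma cost_pos (hA : N.PosynomialAssumption T Ao Ad) (hne : Nonempty (N.Dest ⊕ N.Edge))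
    {β : N.Dest → ℝ} {δ : N.Edge → ℝ} (hβ : ∀ k, 0 < β k) (hδ : ∀ e, 0 < δ e) :
    0 < T.cost β δ := by
  have h1 : ∀ k, 0 < T.g k (β k) := fun k => (hA.posy_g k).pos (z := fun _ => β k) fun _ => hβ k
  have h2 : ∀ e, 0 < T.h e (δ e) := fun e => (hA.posy_h e).pos (z := fun _ => δ e) fun _ => hδ e
  rcases hne with ⟨k | e⟩
  · exact add_pos_of_pos_of_nonneg (Finset.sum_pos (fun k _ => h1 k) ⟨k, Finset.mem_univ _⟩)
      (Finset.sum_nonneg fun e _ => (h2 e).le)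
  · exact add_pos_of_nonneg_of_pos (Finset.sum_nonneg fun e _ => (h1 e).le)
      (Finset.sum_pos (fun k _ => h2 k) ⟨e, Finset.mem_univ _⟩)

/-- The ground set is cut out by `γ > 0` and `v > 0` alone, unless it is empty: the signs of the
arguments of the logarithms depend only on which posynomials vanish identically. -/
lemma ground_eq (hQ : ∀ i j, i ≠ j → 0 ≤ Q i j) (hQs : ∀ i, ∑ j, Q i j = 0)
    (hA : N.PosynomialAssumption T Ao Ad) :
    (N.logProgram T Q Ao Ad).ground = N.positiveVars ∨ (N.logProgram T Q Ao Ad).ground = ∅ := by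
  have key : ∀ j : N.Con,
      (∀ x ∈ N.positiveVars, 0 < N.argL T Q Ao j x ∧ 0 < N.argR T Q Ad j x) ∨
      (∀ x ∈ N.positiveVars, ¬ (0 < N.argL T Q Ao j x ∧ 0 < N.argR T Q Ad j x)) := by
    rintro (⟨i, k⟩ | ⟨i, c⟩ | _ | k | e)
    · have hd := rate_diag_nonpos hQ hQs i
      have hnn : ∀ x ∈ N.positiveVars, ∀ l, 0 ≤ x.2.1 i l * Ad i (fun d => Real.exp (x.2.2.1 d))
          (fun e => Real.exp (x.2.2.2 e)) l k := fun x hx l =>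
        mul_nonneg (hx.2 i l).le ((hA.posy_Ad i l k).nonneg
          (z := Sum.elim (fun d => Real.exp (x.2.2.1 d)) (fun e => Real.exp (x.2.2.2 e)))
          (by rintro (d | e) <;> exact Real.exp_pos _))
      by_cases h : (∃ l, IsPosynomial fun z : N.Dest ⊕ N.Edge → ℝ =>
          Ad i (fun d => z (Sum.inl d)) (fun e => z (Sum.inr e)) l k) ∨ Q i i < 0
      · left
        intro x hx
        refine ⟨argL_lyap_pos hQ hA hx i k, ?_⟩
        rcases h with ⟨l, hl⟩ | h
        · have hp := hl.pos
            (z := Sum.elim (fun d => Real.exp (x.2.2.1 d)) (fun e => Real.exp (x.2.2.2 e)))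
            (by rintro (d | e) <;> exact Real.exp_pos _)
          have : 0 < (x.2.1 i ᵥ* Ad i (fun d => Real.exp (x.2.2.1 d))
              (fun e => Real.exp (x.2.2.2 e))) k :=
            Finset.sum_pos' (fun l _ => hnn x hx l)
              ⟨l, Finset.mem_univ _, mul_pos (hx.2 i l) hp⟩
          have := mul_nonpos_of_nonpos_of_nonneg hd (hx.2 i k).le
          simp only [argR]
          linarith
        · have h1 : 0 ≤ (x.2.1 i ᵥ* Ad i (fun d => Real.exp (x.2.2.1 d))
              (fun e => Real.exp (x.2.2.2 e))) k := Finset.sum_nonneg fun l _ => hnn x hx l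
          have := mul_neg_of_neg_of_pos h (hx.2 i k)
          simp only [argR]
          linarith
      · right
        rintro x hx ⟨-, hR⟩
        push Not at h
        have h0 : Q i i = 0 := le_antisymm hd h.2
        refine hR.ne' ?_
        simp only [argR, h0, zero_mul, sub_zero]
        refine Finset.sum_eq_zero fun l _ => ?_
        have := ((hA.posy_Ad i l k).resolve_left (h.1 l))
          (Sum.elim (fun d => Real.exp (x.2.2.1 d)) (fun e => Real.exp (x.2.2.2 e)))
          (by rintro (d | e) <;> exact Real.exp_pos _)
        exact mul_eq_zero_of_right _ this
    · left
      exact fun x hx => ⟨(hx.2 i _).trans_eq (vecMul_Gin (x.2.1 i) i c).symm, hx.1⟩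
    · by_cases hne : Nonempty (N.Dest ⊕ N.Edge)
      · left
        exact fun x hx => ⟨cost_pos hA hne (fun _ => Real.exp_pos _) fun _ => Real.exp_pos _,
          T.budget_pos⟩
      · right
        rintro x hx ⟨h, -⟩
        rw [not_nonempty_iff, isEmpty_sum] at hne
        obtain ⟨h1, h2⟩ := hne
        simp [argL, Tuning.cost] at h
    · left
      exact fun x hx => ⟨Real.exp_pos _, Real.exp_pos _⟩
    · left
      exact fun x hx => ⟨Real.exp_pos _, Real.exp_pos _⟩
  by_cases h : ∀ j : N.Con, ∀ x ∈ N.positiveVars, 0 < N.argL T Q Ao j x ∧ 0 < N.argR T Q Ad j x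
  · left
    ext x
    exact ⟨fun hx => ⟨hx.1, hx.2.1⟩, fun hx => ⟨hx.1, hx.2, fun j => h j x hx⟩⟩
  · right
    push Not at h
    obtain ⟨j, x, hx, hj⟩ := h
    have := (key j).resolve_left fun h' => (hj (h' x hx).1).not_gt (h' x hx).2
    exact Set.eq_empty_of_forall_notMem fun y hy => this y ⟨hy.1, hy.2.1⟩ (hy.2.2 j)

lemma logProgram_hasDCFunctions (hQ : ∀ i j, i ≠ j → 0 ≤ Q i j) (hQs : ∀ i, ∑ j, Q i j = 0)
    (hA : N.PosynomialAssumption T Ao Ad) : (N.logProgram T Q Ao Ad).HasDCFunctions := by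
  rcases ground_eq hQ hQs hA with hg | hg
  swap
  · have he : ∀ f : N.Vars → ℝ, ConvexOn ℝ (∅ : Set N.Vars) f := fun f =>
      ⟨convex_empty, fun x hx => hx.elim⟩
    refine ⟨?_, fun j => ?_⟩ <;> rw [hg] <;>
      exact ⟨convex_empty, 0, 0, he _, he _, fun x hx => hx.elim⟩
  have hC := N.convex_positiveVars
  have hcoord : ∀ p : N.Vars →ₗ[ℝ] ℝ, (∀ x ∈ N.positiveVars, 0 < p x) →
      ConvexOn ℝ N.positiveVars fun x => -Real.log (p x) := by
    intro p hp
    have h := (strictConcaveOn_log_Ioi.concaveOn.comp_linearMap p).neg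
    exact h.subset (fun x hx => hp x hx) hC
  let pγ : N.Vars →ₗ[ℝ] ℝ := LinearMap.fst ℝ _ _
  let pv : M × V → N.Vars →ₗ[ℝ] ℝ := fun y => LinearMap.proj y.2 ∘ₗ LinearMap.proj y.1 ∘ₗ
    LinearMap.fst ℝ _ _ ∘ₗ LinearMap.snd ℝ _ _
  have hγ : ConvexOn ℝ N.positiveVars fun x => -Real.log x.1 := hcoord pγ fun x hx => hx.1
  have hv : ∀ y : M × V, ConvexOn ℝ N.positiveVars fun x => -Real.log (x.2.1 y.1 y.2) := fun y =>
    hcoord (pv y) fun x hx => hx.2 _ _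
  have hsum : ∀ s : Finset (M × V),
      ConvexOn ℝ N.positiveVars fun x => ∑ y ∈ s, -Real.log (x.2.1 y.1 y.2) := by
    intro s
    classical
    induction s using Finset.induction_on with
    | empty => simpa using convexOn_const (0 : ℝ) hC
    | insert y s hy ih =>
      simp only [Finset.sum_insert hy]
      exact (hv y).add ih
  -- `w` compensates the concavity of the logarithms of `γ` and `v`
  let w : N.Vars → ℝ := fun x => -Real.log x.1 + ∑ y : M × V, -Real.log (x.2.1 y.1 y.2)
  have hw : ConvexOn ℝ N.positiveVars w := hγ.add (hsum Finset.univ)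
  have hlc := fun j => logConvexOn_arg (Q := Q) (T := T) (Ao := Ao) (Ad := Ad) hC id (fun _ => rfl)
    (LogConvexOn.exp hw)
    ((LogConvexOn.exp (hsum Finset.univ)).congr hC fun x hx => by
      simp only [w, id, Real.exp_add, Real.exp_neg, Real.exp_log hx.1]
      rw [← mul_assoc, mul_inv_cancel₀ hx.1.ne', one_mul])
    (fun i k => (LogConvexOn.exp (hγ.add (hsum (Finset.univ.erase (i, k))))).congr hC
      fun x hx => by
        simp only [w, id, Pi.add_apply]
        rw [← Finset.add_sum_erase _ _ (Finset.mem_univ (i, k))]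
        simp only [Real.exp_add, Real.exp_neg, Real.exp_log hx.1, Real.exp_log (hx.2 i k)]
        have := (hx.2 i k).ne'
        field_simp)
    hQ hQs hA j
  have hpos : ∀ x ∈ N.positiveVars, ∀ j, 0 < N.argL T Q Ao j x ∧ 0 < N.argR T Q Ad j x := by
    rw [← hg]
    exact fun x hx => hx.2.2
  refine ⟨?_, fun j => ?_⟩ <;> rw [hg]
  · exact ⟨hC, fun x => x.1, fun _ => 0, pγ.convexOn hC, convexOn_const 0 hC, fun x _ => rfl⟩
  · refine ⟨hC, _, _,
      (hlc j).1.convexOn_log hC fun x hx => mul_pos (hpos x hx j).1 (Real.exp_pos _),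
      (hlc j).2.convexOn_log hC fun x hx => mul_pos (hpos x hx j).2 (Real.exp_pos _),
      fun x hx => ?_⟩
    simp only [logProgram, id]
    rw [Real.log_mul (hpos x hx j).1.ne' (Real.exp_pos _).ne',
      Real.log_mul (hpos x hx j).2.ne' (Real.exp_pos _).ne']
    ring

lemma logProgram_substitute_isDCProgram (hQ : ∀ i j, i ≠ j → 0 ≤ Q i j)
    (hQs : ∀ i, ∑ j, Q i j = 0) (hA : N.PosynomialAssumption T Ao Ad) :
    ((N.logProgram T Q Ao Ad).substitute N.expVars).IsDCProgram := by
  have hmem : ∀ x, N.expVars x ∈ N.positiveVars := fun x =>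
    ⟨Real.exp_pos _, fun i k => Real.exp_pos _⟩
  have hground : ((N.logProgram T Q Ao Ad).substitute N.expVars).ground = Set.univ ∨
      ((N.logProgram T Q Ao Ad).substitute N.expVars).ground = ∅ := by
    rcases ground_eq hQ hQs hA with hg | hg <;> simp only [DiffProgram.substitute, hg]
    · left
      exact Set.eq_univ_of_forall hmem
    · right
      simp
  rcases hground with hg | hg
  swap
  · have he : ∀ f : N.Vars → ℝ, ConvexOn ℝ (∅ : Set N.Vars) f := fun f =>
      ⟨convex_empty, fun x hx => hx.elim⟩
    constructor <;> rw [hg]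
    exacts [isClosed_empty, convex_empty, he _, he _, fun j => he _, fun j => he _]
  have hC : Convex ℝ (Set.univ : Set N.Vars) := convex_univ
  have hpos : ∀ x j, 0 < N.argL T Q Ao j (N.expVars x) ∧ 0 < N.argR T Q Ad j (N.expVars x) := by
    intro x j
    have : x ∈ ((N.logProgram T Q Ao Ad).substitute N.expVars).ground := hg ▸ Set.mem_univ x
    exact this.2.2 j
  let pγ : N.Vars →ₗ[ℝ] ℝ := LinearMap.fst ℝ _ _
  let pv : M → V → N.Vars →ₗ[ℝ] ℝ := fun i k => LinearMap.proj k ∘ₗ LinearMap.proj i ∘ₗ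
    LinearMap.fst ℝ _ _ ∘ₗ LinearMap.snd ℝ _ _
  have hlc := fun j => logConvexOn_arg (Q := Q) (T := T) (Ao := Ao) (Ad := Ad) hC N.expVars
    (fun _ => rfl) (LogConvexOn.const zero_le_one)
    ((LogConvexOn.exp (pγ.convexOn hC)).congr hC fun x hx => mul_one _)
    (fun i k => (LogConvexOn.exp ((pv i k).convexOn hC)).congr hC fun x hx => mul_one _)
    hQ hQs hA j
  simp only [mul_one] at hlc
  constructor <;> rw [hg]
  · exact isClosed_univ
  · exact hC
  · exact convexOn_exp.comp_linearMap pγ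
  · exact convexOn_const 0 hC
  · exact fun j => (hlc j).1.convexOn_log hC fun x _ => (hpos x j).1
  · exact fun j => (hlc j).2.convexOn_log hC fun x _ => (hpos x j).2

end BufferNetwork

/-! ### Exponentials of Metzler matrices -/

section MatrixExp

open NormedSpace
open scoped Matrix.Norms.Operator

variable {X : Type*} [Fintype X] [DecidableEq X] {L : Matrix X X ℝ}

lemma Matrix.exp_smul_neg_mul (L : Matrix X X ℝ) (t : ℝ) : exp (-t • L) * exp (t • L) = 1 := by
  rw [← Matrix.exp_add_of_commute _ _ ((Commute.refl L).smul_left _ |>.smul_right _), ← add_smul]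
  simp

lemma Matrix.exp_add_smul (L : Matrix X X ℝ) (s t : ℝ) :
    exp ((s + t) • L) = exp (s • L) * exp (t • L) := by
  rw [add_smul, Matrix.exp_add_of_commute _ _ ((Commute.refl L).smul_left _ |>.smul_right _)]

lemma Matrix.continuous_entry (x y : X) : Continuous fun A : Matrix X X ℝ => A x y :=
  continuous_id.matrix_elem x y

lemma Matrix.continuous_exp_smul (L : Matrix X X ℝ) : Continuous fun t : ℝ => exp (t • L) :=
  (NormedSpace.exp_continuous).comp (continuous_id.smul continuous_const)

lemma Matrix.continuous_exp_smul_entry (L : Matrix X X ℝ) (x y : X) :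
    Continuous fun t : ℝ => exp (t • L) x y :=
  (Matrix.continuous_entry x y).comp (Matrix.continuous_exp_smul L)

lemma Matrix.hasDerivAt_exp_smul_entry (L : Matrix X X ℝ) (x y : X) (t : ℝ) :
    HasDerivAt (fun t : ℝ => exp (t • L) x y) ((exp (t • L) * L) x y) t := by
  have h := hasDerivAt_exp_smul_const L t
  exact ((Matrix.entryLinearMap ℝ ℝ x y).toContinuousLinearMap.hasFDerivAt.comp_hasDerivAt t h)

lemma Matrix.exp_smul_mul_comm (L : Matrix X X ℝ) (t : ℝ) : exp (t • L) * L = L * exp (t • L) :=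
  (((Commute.refl L).smul_left t).exp_left).eq

/-- A matrix with nonnegative entries has an exponential that dominates the identity. -/
lemma Matrix.one_le_exp_of_nonneg (hL : ∀ x y, 0 ≤ L x y) (x y : X) :
    (1 : Matrix X X ℝ) x y ≤ exp L x y := by
  have h := exp_series_hasSum_exp' (𝕂 := ℝ) L
  have h2 : HasSum (fun n : ℕ => ((n.factorial : ℝ)⁻¹ • L ^ n) x y) (exp L x y) :=
    h.mapL (Matrix.entryLinearMap ℝ ℝ x y).toContinuousLinearMap
  have hpow : ∀ n : ℕ, ∀ x y, 0 ≤ (L ^ n) x y := by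
    intro n
    induction n with
    | zero => intro x y; rw [pow_zero, Matrix.one_apply]; split_ifs <;> norm_num
    | succ n ih =>
      intro x y
      rw [pow_succ, Matrix.mul_apply]
      exact Finset.sum_nonneg fun z _ => mul_nonneg (ih _ _) (hL _ _)
  refine le_trans (by simp) (le_hasSum h2 0 fun n _ => ?_)
  exact mul_nonneg (by positivity) (hpow n x y)

lemma Matrix.exp_smul_one (a : ℝ) : exp (a • (1 : Matrix X X ℝ)) = Real.exp a • 1 := by
  rw [Matrix.smul_one_eq_diagonal, Matrix.exp_diagonal, Matrix.smul_one_eq_diagonal]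
  congr 1
  ext x
  rw [Real.exp_eq_exp_ℝ]
  exact NormedSpace.map_exp (Pi.evalRingHom _ x) (continuous_apply x) _

/-- Off-diagonal entries are nonnegative. -/
def Matrix.IsMetzler (L : Matrix X X ℝ) : Prop := ∀ x y, x ≠ y → 0 ≤ L x y

/-- A shift by a multiple of the identity makes a Metzler matrix nonnegative. -/
lemma Matrix.IsMetzler.exists_shift (hL : L.IsMetzler) :
    ∃ κ : ℝ, 0 ≤ κ ∧ ∀ x y, 0 ≤ (L + κ • (1 : Matrix X X ℝ)) x y := by
  refine ⟨∑ x, |L x x|, Finset.sum_nonneg fun _ _ => abs_nonneg _, fun x y => ?_⟩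
  rw [Matrix.add_apply, Matrix.smul_apply, Matrix.one_apply]
  split_ifs with h
  · subst h
    have := Finset.single_le_sum (f := fun x => |L x x|) (fun _ _ => abs_nonneg _)
      (Finset.mem_univ x)
    have := neg_abs_le (L x x)
    simp only [smul_eq_mul, mul_one]
    linarith
  · simpa using hL x y h

lemma Matrix.IsMetzler.exp_lower_bound (hL : L.IsMetzler) :
    ∃ κ : ℝ, ∀ t : ℝ, 0 ≤ t → ∀ x y,
      Real.exp (-(κ * t)) * (1 : Matrix X X ℝ) x y ≤ exp (t • L) x y := by
  obtain ⟨κ, -, h⟩ := hL.exists_shift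
  refine ⟨κ, fun t ht x y => ?_⟩
  have e : t • L = t • (L + κ • (1 : Matrix X X ℝ)) + (-(κ * t)) • 1 := by
    rw [smul_add, smul_smul, neg_smul, mul_comm κ t]
    abel
  rw [e, Matrix.exp_add_of_commute _ _ ((Commute.one_right _).smul_right _), Matrix.exp_smul_one,
    Matrix.mul_smul, mul_one, Matrix.smul_apply, smul_eq_mul]
  refine mul_le_mul_of_nonneg_left ?_ (Real.exp_pos _).le
  refine Matrix.one_le_exp_of_nonneg (fun x y => ?_) x y
  exact mul_nonneg ht (h x y)

lemma Matrix.IsMetzler.exp_nonneg (hL : L.IsMetzler) {t : ℝ} (ht : 0 ≤ t) (x y : X) :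
    0 ≤ exp (t • L) x y := by
  obtain ⟨κ, h⟩ := hL.exp_lower_bound
  refine le_trans (mul_nonneg (Real.exp_pos _).le ?_) (h t ht x y)
  rw [Matrix.one_apply]
  split_ifs <;> norm_num

lemma Matrix.IsMetzler.exp_diag_pos (hL : L.IsMetzler) {t : ℝ} (ht : 0 ≤ t) (x : X) :
    0 < exp (t • L) x x := by
  obtain ⟨κ, h⟩ := hL.exp_lower_bound
  refine lt_of_lt_of_le ?_ (h t ht x x)
  simpa using Real.exp_pos _

lemma Matrix.hasDerivAt_vecMul_exp (L : Matrix X X ℝ) (c : X → ℝ) (x : X) (t : ℝ) :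
    HasDerivAt (fun t : ℝ => (c ᵥ* exp (t • L)) x) ((c ᵥ* L ᵥ* exp (t • L)) x) t := by
  rw [Matrix.vecMul_vecMul, ← Matrix.exp_smul_mul_comm]
  simp only [Matrix.vecMul, dotProduct]
  exact HasDerivAt.fun_sum fun y _ => (Matrix.hasDerivAt_exp_smul_entry L y x t).const_mul (c y)

lemma Matrix.continuous_vecMul_exp (L : Matrix X X ℝ) (c : X → ℝ) (x : X) :
    Continuous fun t : ℝ => (c ᵥ* exp (t • L)) x :=
  continuous_iff_continuousAt.2 fun t => (Matrix.hasDerivAt_vecMul_exp L c x t).continuousAt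

lemma Matrix.vecMul_nonneg_of_nonneg {A : Matrix X X ℝ} {c : X → ℝ} (hc : ∀ x, 0 ≤ c x)
    (hA : ∀ x y, 0 ≤ A x y) (x : X) : 0 ≤ (c ᵥ* A) x :=
  Finset.sum_nonneg fun y _ => mul_nonneg (hc y) (hA y x)

lemma Matrix.vecMul_mono_left {A : Matrix X X ℝ} {c d : X → ℝ} (h : ∀ x, c x ≤ d x)
    (hA : ∀ x y, 0 ≤ A x y) (x : X) : (c ᵥ* A) x ≤ (d ᵥ* A) x :=
  Finset.sum_le_sum fun y _ => mul_le_mul_of_nonneg_right (h y) (hA y x)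

/-- A copositive linear Lyapunov function `v` with `v L ≤ -c` bounds the total cost
`∫₀^∞ c exp (t L) dt`. -/
lemma Matrix.IsMetzler.lintegral_vecMul_exp_le (hL : L.IsMetzler) {v c : X → ℝ}
    (hv : ∀ x, 0 ≤ v x) (hc : ∀ x, 0 ≤ c x) (h : ∀ x, (v ᵥ* L) x ≤ -c x) (x : X) :
    ∫⁻ t in Set.Ioi (0 : ℝ), ENNReal.ofReal ((c ᵥ* exp (t • L)) x) ≤ ENNReal.ofReal (v x) := by
  have hcn : ∀ t : ℝ, 0 ≤ t → 0 ≤ (c ᵥ* exp (t • L)) x := fun t ht =>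
    Matrix.vecMul_nonneg_of_nonneg hc (hL.exp_nonneg ht) x
  have hcont := Matrix.continuous_vecMul_exp L c x
  have hbound : ∀ n : ℕ, ∫⁻ t in Set.Ioc (0 : ℝ) n, ENNReal.ofReal ((c ᵥ* exp (t • L)) x) ≤
      ENNReal.ofReal (v x) := by
    intro n
    have hn : (0 : ℝ) ≤ n := Nat.cast_nonneg n
    rw [← ofReal_integral_eq_lintegral_ofReal
      ((hcont.intervalIntegrable 0 n).1)
      ((ae_restrict_iff' measurableSet_Ioc).2 (ae_of_all _ fun t ht => hcn t ht.1.le))]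
    refine ENNReal.ofReal_le_ofReal ?_
    rw [← intervalIntegral.integral_of_le hn]
    have h1 : ∫ t in (0 : ℝ)..n, -((v ᵥ* L ᵥ* exp (t • L)) x) =
        -((v ᵥ* exp ((n : ℝ) • L)) x) - -((v ᵥ* exp ((0 : ℝ) • L)) x) :=
      intervalIntegral.integral_eq_sub_of_hasDerivAt
        (fun t _ => (Matrix.hasDerivAt_vecMul_exp L v x t).neg)
        ((Matrix.continuous_vecMul_exp L (v ᵥ* L) x).neg.intervalIntegrable _ _)
    have h2 : ∫ t in (0 : ℝ)..n, (c ᵥ* exp (t • L)) x ≤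
        ∫ t in (0 : ℝ)..n, -((v ᵥ* L ᵥ* exp (t • L)) x) := by
      refine intervalIntegral.integral_mono_on hn (hcont.intervalIntegrable _ _)
        ((Matrix.continuous_vecMul_exp L (v ᵥ* L) x).neg.intervalIntegrable _ _) fun t ht => ?_
      have := Matrix.vecMul_mono_left h (hL.exp_nonneg ht.1) x
      rw [show (fun x => -c x) = -c from rfl, Matrix.neg_vecMul, Pi.neg_apply] at this
      linarith
    have h3 := Matrix.vecMul_nonneg_of_nonneg hv (hL.exp_nonneg hn) x
    simp only [zero_smul, exp_zero, Matrix.vecMul_one] at h1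
    linarith
  rw [show Set.Ioi (0 : ℝ) = ⋃ n : ℕ, Set.Ioc (0 : ℝ) n by
    ext t
    simp only [Set.mem_Ioi, Set.mem_iUnion, Set.mem_Ioc]
    exact ⟨fun ht => (exists_nat_ge t).imp fun n hn => ⟨ht, hn⟩, fun ⟨_, h, _⟩ => h⟩]
  rw [setLIntegral_iUnion_of_directed _
    (directed_of_isDirected_le fun m n hmn => Set.Ioc_subset_Ioc_right (Nat.cast_le.2 hmn))]
  exact iSup_le hbound

/-- A Lyapunov function with decay rate `ε` along the flow of `L`. -/
lemma Matrix.IsMetzler.vecMul_exp_le (hL : L.IsMetzler) {v : X → ℝ} {ε : ℝ}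
    (h : ∀ x, (v ᵥ* L) x ≤ -(ε * v x)) {t : ℝ} (ht : 0 ≤ t) (x : X) :
    (v ᵥ* exp (t • L)) x ≤ Real.exp (-ε * t) * v x := by
  have hd : ∀ s : ℝ, HasDerivAt (fun s : ℝ => Real.exp (ε * s) * (v ᵥ* exp (s • L)) x)
      (Real.exp (ε * s) * ε * (v ᵥ* exp (s • L)) x +
        Real.exp (ε * s) * (v ᵥ* L ᵥ* exp (s • L)) x) s := fun s =>
    (by simpa using ((hasDerivAt_id s).const_mul ε).exp :
      HasDerivAt (fun s => Real.exp (ε * s)) (Real.exp (ε * s) * ε) s).mul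
      (Matrix.hasDerivAt_vecMul_exp L v x s)
  have hanti : AntitoneOn (fun s : ℝ => Real.exp (ε * s) * (v ᵥ* exp (s • L)) x) (Set.Ici 0) := by
    refine antitoneOn_of_deriv_nonpos (convex_Ici 0)
      (fun s _ => (hd s).continuousAt.continuousWithinAt)
      (fun s _ => (hd s).differentiableAt.differentiableWithinAt) fun s hs => ?_
    rw [interior_Ici] at hs
    rw [(hd s).deriv, mul_assoc, ← mul_add]
    refine mul_nonpos_of_nonneg_of_nonpos (Real.exp_pos _).le ?_
    have := Matrix.vecMul_mono_left h (hL.exp_nonneg (le_of_lt hs)) x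
    rw [show (fun x => -(ε * v x)) = -(ε • v) from rfl, Matrix.neg_vecMul,
      Matrix.smul_vecMul] at this
    simp only [Pi.neg_apply, Pi.smul_apply, smul_eq_mul] at this
    linarith
  have h0 := hanti (Set.mem_Ici.2 le_rfl) (Set.mem_Ici.2 ht) ht
  simp only [mul_zero, Real.exp_zero, zero_smul, exp_zero, Matrix.vecMul_one, one_mul] at h0
  rw [neg_mul, Real.exp_neg, ← div_eq_inv_mul, le_div_iff₀ (Real.exp_pos _), mul_comm]
  exact h0

/-- If `exp (t L)` decays exponentially, then `v = ∫₀^∞ c exp (t L) dt` solves `v L = -c`. -/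
lemma Matrix.IsMetzler.exists_vecMul_eq_neg (hL : L.IsMetzler) {C lam : ℝ} (hlam : 0 < lam)
    (hdecay : ∀ t, 0 ≤ t → ∀ x y, exp (t • L) x y ≤ C * Real.exp (-lam * t))
    {c : X → ℝ} (hc : ∀ x, 0 < c x) :
    ∃ v : X → ℝ, (∀ x, 0 < v x) ∧ (∀ x, (v ᵥ* L) x = -c x) ∧
      ∀ x, ENNReal.ofReal (v x) =
        ∫⁻ t in Set.Ioi (0 : ℝ), ENNReal.ofReal ((c ᵥ* exp (t • L)) x) := by
  have hnn : ∀ (t : ℝ), 0 ≤ t → ∀ x, 0 ≤ (c ᵥ* exp (t • L)) x := fun t ht =>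
    Matrix.vecMul_nonneg_of_nonneg (fun x => (hc x).le) (hL.exp_nonneg ht)
  have hint : ∀ x y, IntegrableOn (fun t : ℝ => exp (t • L) x y) (Set.Ioi 0) := by
    intro x y
    refine Integrable.mono' ((exp_neg_integrableOn_Ioi 0 hlam).const_mul C)
      (Matrix.continuous_exp_smul_entry L x y).aestronglyMeasurable ?_
    refine (ae_restrict_iff' measurableSet_Ioi).2 (ae_of_all _ fun t ht => ?_)
    rw [Real.norm_of_nonneg (hL.exp_nonneg (le_of_lt ht) x y)]
    exact hdecay t (le_of_lt ht) x y
  have hintc : ∀ (d : X → ℝ) x, IntegrableOn (fun t : ℝ => (d ᵥ* exp (t • L)) x) (Set.Ioi 0) :=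
    fun d x => integrable_finsetSum _ fun y _ => (hint y x).const_mul (d y)
  have hlim : ∀ x y, Tendsto (fun t : ℝ => exp (t • L) x y) atTop (𝓝 0) := by
    intro x y
    have h0 : Tendsto (fun t : ℝ => C * Real.exp (-lam * t)) atTop (𝓝 0) := by
      have : Tendsto (fun t : ℝ => -lam * t) atTop atBot :=
        tendsto_id.const_mul_atTop_of_neg (by linarith)
      simpa using (Real.tendsto_exp_atBot.comp this).const_mul C
    refine tendsto_of_tendsto_of_tendsto_of_le_of_le' tendsto_const_nhds h0 ?_ ?_
    · filter_upwards [eventually_ge_atTop 0] with t ht using hL.exp_nonneg ht x y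
    · filter_upwards [eventually_ge_atTop 0] with t ht using hdecay t ht x y
  have hlimc : ∀ x, Tendsto (fun t : ℝ => (c ᵥ* exp (t • L)) x) atTop (𝓝 0) := by
    intro x
    have := tendsto_finsetSum (Finset.univ : Finset X)
      fun y _ => (hlim y x).const_mul (c y)
    simp only [mul_zero, Finset.sum_const_zero] at this
    exact this
  refine ⟨fun x => ∫ t in Set.Ioi (0 : ℝ), (c ᵥ* exp (t • L)) x, fun x => ?_, fun x => ?_,
    fun x => ?_⟩
  · rw [setIntegral_pos_iff_support_of_nonneg_ae
      ((ae_restrict_iff' measurableSet_Ioi).2 (ae_of_all _ fun t ht => hnn t (le_of_lt ht) x))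
      (hintc c x)]
    have : Set.Ioi (0 : ℝ) ⊆ Function.support (fun t : ℝ => (c ᵥ* exp (t • L)) x) := by
      intro t ht
      refine ne_of_gt (lt_of_lt_of_le (mul_pos (hc x) (hL.exp_diag_pos (le_of_lt ht) x)) ?_)
      exact Finset.single_le_sum (f := fun y => c y * exp (t • L) y x)
        (fun y _ => mul_nonneg (hc y).le (hL.exp_nonneg (le_of_lt ht) y x)) (Finset.mem_univ x)
    rw [Set.inter_eq_right.2 this, Real.volume_Ioi]
    exact ENNReal.zero_lt_top
  · have h1 : ∫ t in Set.Ioi (0 : ℝ), (c ᵥ* L ᵥ* exp (t • L)) x =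
        0 - (c ᵥ* exp ((0 : ℝ) • L)) x :=
      integral_Ioi_of_hasDerivAt_of_tendsto
        (Matrix.continuous_vecMul_exp L c x).continuousWithinAt
        (fun t _ => Matrix.hasDerivAt_vecMul_exp L c x t) (hintc _ x) (hlimc x)
    simp only [zero_smul, exp_zero, Matrix.vecMul_one, zero_sub] at h1
    rw [← h1]
    simp only [Matrix.vecMul_vecMul c L, ← Matrix.exp_smul_mul_comm]
    simp only [← Matrix.vecMul_vecMul]
    rw [Matrix.vecMul, dotProduct]
    simp_rw [← integral_mul_const]
    rw [← integral_finsetSum _ fun y _ => (hintc c y).mul_const _]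
    rfl
  · exact ofReal_integral_eq_lintegral_ofReal (hintc c x)
      ((ae_restrict_iff' measurableSet_Ioi).2 (ae_of_all _ fun t ht => hnn t (le_of_lt ht) x))

end MatrixExp

/-! ### Variation of constants with integrable forcing -/

section Duhamel

open NormedSpace
open scoped Matrix.Norms.Operator

/-- The product rule in integrated form, for a `C¹` function and a primitive of an integrable
function. -/
lemma mul_primitive_eq {w w' u y : ℝ → ℝ} {y0 t : ℝ} (hw : ∀ s, HasDerivAt w (w' s) s)
    (hw' : Continuous w') (ht : 0 ≤ t) (hu : IntervalIntegrable u volume 0 t)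
    (hy : ∀ s ∈ Set.Icc 0 t, y s = y0 + ∫ r in (0 : ℝ)..s, u r) :
    w t * y t = w 0 * y0 + ∫ s in (0 : ℝ)..t, (w' s * y s + w s * u s) := by
  set g : ℝ → ℝ := fun s => ∫ r in (0 : ℝ)..s, u r with hg
  have hwd : deriv w = w' := funext fun s => (hw s).deriv
  have hwc : Continuous w := continuous_iff_continuousAt.2 fun s => (hw s).continuousAt
  have h0 : (0 : ℝ) ∈ Set.uIcc 0 t := Set.left_mem_uIcc
  have hgac := hu.absolutelyContinuousOnInterval_intervalIntegral h0
  have hwac : AbsolutelyContinuousOnInterval w 0 t :=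
    ContDiffOn.absolutelyContinuousOnInterval
      (contDiff_one_iff_deriv.2 ⟨fun s => (hw s).differentiableAt, hwd ▸ hw'⟩).contDiffOn
  have key := hwac.integral_mul_deriv_eq_deriv_mul hgac
  have hgc : ContinuousOn g (Set.uIcc 0 t) := hgac.continuousOn
  -- the primitive has the derivative `u` almost everywhere
  have e1 : ∫ s in (0 : ℝ)..t, w s * deriv (fun x => ∫ v in (0 : ℝ)..x, u v) s =
      ∫ s in (0 : ℝ)..t, w s * u s := by
    refine intervalIntegral.integral_congr_ae ?_
    filter_upwards [hu.ae_hasDerivAt_integral] with s hs hst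
    rw [(hs (Set.uIoc_subset_uIcc hst) 0 h0).deriv]
  have e2 : ∫ s in (0 : ℝ)..t, (w' s * y s + w s * u s) =
      ∫ s in (0 : ℝ)..t, (w' s * y0 + w' s * g s + w s * u s) := by
    refine intervalIntegral.integral_congr fun s hs => ?_
    rw [Set.uIcc_of_le ht] at hs
    simp only [hy s hs, hg]
    ring
  have i1 : IntervalIntegrable (fun s => w' s * y0) volume 0 t :=
    (hw'.mul continuous_const).intervalIntegrable _ _
  have i2 : IntervalIntegrable (fun s => w' s * g s) volume 0 t :=
    (hw'.continuousOn.mul hgc).intervalIntegrable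
  have i3 : IntervalIntegrable (fun s => w s * u s) volume 0 t :=
    hu.continuousOn_mul hwc.continuousOn
  have e3 : ∫ s in (0 : ℝ)..t, w' s = w t - w 0 :=
    intervalIntegral.integral_eq_sub_of_hasDerivAt (fun s _ => hw s) (hw'.intervalIntegrable _ _)
  rw [e1, hwd] at key
  rw [e2, intervalIntegral.integral_add (i1.add i2) i3, intervalIntegral.integral_add i1 i2,
    intervalIntegral.integral_mul_const, e3, key, hy t ⟨ht, le_rfl⟩]
  simp only [hg, intervalIntegral.integral_same]
  ring

variable {X : Type*} [Fintype X] [DecidableEq X]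

lemma intervalIntegrable_mulVec {W : ℝ → Matrix X X ℝ} (hW : ∀ x z, Continuous fun s => W s x z)
    {g : ℝ → X → ℝ} {a b : ℝ} (hg : ∀ x, IntervalIntegrable (fun s => g s x) volume a b) (x : X) :
    IntervalIntegrable (fun s => (W s *ᵥ g s) x) volume a b := by
  have := IntervalIntegrable.sum (Finset.univ : Finset X)
    (f := fun z s => W s x z * g s z) fun z _ => (hg z).continuousOn_mul (hW x z).continuousOn
  have e : (fun s => (W s *ᵥ g s) x) = ∑ z, fun s => W s x z * g s z := by
    ext s
    simp [Matrix.mulVec, dotProduct]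
  rw [e]
  exact this

/-- The product rule for `exp (t L) y t`, where `y` is a primitive of an integrable function. -/
lemma exp_mulVec_eq_add_integral (L : Matrix X X ℝ) {y u : ℝ → X → ℝ} {y0 : X → ℝ} {t : ℝ}
    (ht : 0 ≤ t) (hu : ∀ x, IntervalIntegrable (fun s => u s x) volume 0 t)
    (hy : ∀ s ∈ Set.Icc 0 t, ∀ x, y s x = y0 x + ∫ r in (0 : ℝ)..s, u r x) (x : X) :
    (exp (t • L) *ᵥ y t) x =
      y0 x + ∫ s in (0 : ℝ)..t, (exp (s • L) *ᵥ (L *ᵥ y s + u s)) x := by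
  have hderiv : ∀ z, Continuous fun s : ℝ => (exp (s • L) * L) x z := fun z => by
    simp only [Matrix.mul_apply]
    exact continuous_finsetSum _ fun k _ =>
      (Matrix.continuous_exp_smul_entry L x k).mul continuous_const
  have h := fun z => mul_primitive_eq (fun s => Matrix.hasDerivAt_exp_smul_entry L x z s)
    (hderiv z) ht (hu z) (fun s hs => hy s hs z)
  have hyc : ∀ z, ContinuousOn (fun s => y s z) (Set.uIcc 0 t) := fun z => by
    have hc : ContinuousOn (fun s => y0 z + ∫ r in (0 : ℝ)..s, u r z) (Set.uIcc 0 t) :=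
      continuousOn_const.add (((hu z).absolutelyContinuousOnInterval_intervalIntegral
        Set.left_mem_uIcc).continuousOn)
    exact hc.congr fun s hs => hy s (by rwa [Set.uIcc_of_le ht] at hs) z
  have hi : ∀ z, IntervalIntegrable
      (fun s => (exp (s • L) * L) x z * y s z + exp (s • L) x z * u s z) volume 0 t := fun z =>
    (((hderiv z).continuousOn.mul (hyc z)).intervalIntegrable).add
      ((hu z).continuousOn_mul (Matrix.continuous_exp_smul_entry L x z).continuousOn)
  calc (exp (t • L) *ᵥ y t) x = ∑ z, exp (t • L) x z * y t z := rfl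
    _ = ∑ z, (exp ((0 : ℝ) • L) x z * y0 z + ∫ s in (0 : ℝ)..t,
          ((exp (s • L) * L) x z * y s z + exp (s • L) x z * u s z)) :=
        Finset.sum_congr rfl fun z _ => h z
    _ = y0 x + ∑ z, ∫ s in (0 : ℝ)..t,
          ((exp (s • L) * L) x z * y s z + exp (s • L) x z * u s z) := by
        rw [Finset.sum_add_distrib]
        congr 1
        simp [Matrix.one_apply]
    _ = _ := by
        rw [← intervalIntegral.integral_finsetSum fun z _ => hi z]
        congr 2
        ext s
        rw [Matrix.mulVec_add, Matrix.mulVec_mulVec, Pi.add_apply, Finset.sum_add_distrib]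
        rfl

lemma integral_exp_sub_mulVec (L : Matrix X X ℝ) {g : ℝ → X → ℝ} {t : ℝ}
    (hg : ∀ x, IntervalIntegrable (fun s => g s x) volume 0 t) (x : X) :
    ∫ s in (0 : ℝ)..t, (exp ((t - s) • L) *ᵥ g s) x =
      (exp (t • L) *ᵥ fun z => ∫ s in (0 : ℝ)..t, (exp (-s • L) *ᵥ g s) z) x := by
  have hi := fun z => intervalIntegrable_mulVec (W := fun s => exp (-s • L))
    (fun x z => (Matrix.continuous_exp_smul_entry L x z).comp continuous_neg) hg z
  simp only [Matrix.mulVec, dotProduct] at hi ⊢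
  simp_rw [← intervalIntegral.integral_const_mul]
  rw [← intervalIntegral.integral_finsetSum fun z _ => (hi z).const_mul _]
  refine intervalIntegral.integral_congr fun s _ => ?_
  have : (exp ((t - s) • L) *ᵥ g s) x = (exp (t • L) *ᵥ (exp (-s • L) *ᵥ g s)) x := by
    rw [Matrix.mulVec_mulVec, ← Matrix.exp_add_smul, sub_eq_add_neg]
  simpa only [Matrix.mulVec, dotProduct] using this

/-- A mild solution of `y' = L y + (D y + b)` is a mild solution of `y' = (L + D) y + b`. -/
lemma mild_solution_perturb (L D : Matrix X X ℝ) {y b : ℝ → X → ℝ} {y0 : X → ℝ} {t : ℝ}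
    (ht : 0 ≤ t) (hb : ∀ x, IntervalIntegrable (fun s => b s x) volume 0 t)
    (hyi : ∀ x, IntervalIntegrable (fun s => y s x) volume 0 t)
    (h : ∀ s ∈ Set.Icc 0 t, ∀ x, y s x = (exp (s • L) *ᵥ y0) x +
      ∫ r in (0 : ℝ)..s, (exp ((s - r) • L) *ᵥ (D *ᵥ y r + b r)) x) (x : X) :
    y t x = (exp (t • (L + D)) *ᵥ y0) x +
      ∫ s in (0 : ℝ)..t, (exp ((t - s) • (L + D)) *ᵥ b s) x := by
  have hsub : ∀ s ∈ Set.Icc 0 t, Set.uIcc 0 s ⊆ Set.uIcc 0 t := fun s hs => by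
    rw [Set.uIcc_of_le hs.1, Set.uIcc_of_le ht]
    exact Set.Icc_subset_Icc_right hs.2
  have hg : ∀ x, IntervalIntegrable (fun s => (D *ᵥ y s + b s) x) volume 0 t := fun x =>
    (intervalIntegrable_mulVec (W := fun _ => D) (fun _ _ => continuous_const) hyi x).add (hb x)
  -- `z t = exp (-t L) y t` is the primitive of `exp (-s L) (D y + b)`
  let z : ℝ → X → ℝ := fun s x => y0 x + ∫ r in (0 : ℝ)..s, (exp (-r • L) *ᵥ (D *ᵥ y r + b r)) x
  have hyz : ∀ s ∈ Set.Icc 0 t, y s = exp (s • L) *ᵥ z s := by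
    intro s hs
    ext x
    rw [h s hs, integral_exp_sub_mulVec L fun x => (hg x).mono_set (hsub s hs)]
    rw [← Pi.add_apply, ← Matrix.mulVec_add]
    rfl
  have hint : ∀ x, IntervalIntegrable
      (fun s => (exp (-s • L) *ᵥ (D *ᵥ y s + b s)) x) volume 0 t := fun x =>
    intervalIntegrable_mulVec (W := fun s => exp (-s • L))
      (fun x z => (Matrix.continuous_exp_smul_entry L x z).comp continuous_neg) hg x
  have hLDy : ∀ x, IntervalIntegrable (fun s => ((L + D) *ᵥ y s + b s) x) volume 0 t := fun x =>
    (intervalIntegrable_mulVec (W := fun _ => L + D) (fun _ _ => continuous_const) hyi x).add (hb x)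
  have hstrong : ∀ s ∈ Set.Icc 0 t, ∀ x,
      y s x = y0 x + ∫ r in (0 : ℝ)..s, ((L + D) *ᵥ y r + b r) x := by
    intro s hs x
    rw [hyz s hs, exp_mulVec_eq_add_integral L hs.1 (fun x => (hint x).mono_set (hsub s hs))
      (fun r hr x => rfl)]
    congr 1
    refine intervalIntegral.integral_congr fun r hr => ?_
    rw [Set.uIcc_of_le hs.1] at hr
    have hr' : r ∈ Set.Icc 0 t := ⟨hr.1, hr.2.trans hs.2⟩
    have e : exp (r • L) * exp (-r • L) = 1 := by
      simpa using Matrix.exp_smul_neg_mul L (-r)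
    rw [Matrix.mulVec_add, Matrix.mulVec_mulVec, Matrix.mulVec_mulVec, Matrix.exp_smul_mul_comm,
      e, Matrix.one_mulVec, ← Matrix.mulVec_mulVec, ← hyz r hr', Matrix.add_mulVec, add_assoc]
  -- `y' = (L + D) y + b` in integrated form, so `exp (-t (L + D)) y t` is a primitive of
  -- `exp (-t (L + D)) b`
  have hback := exp_mulVec_eq_add_integral (-(L + D)) ht hLDy hstrong
  have e : ∀ s : ℝ, s • -(L + D) = -s • (L + D) := fun s => by rw [smul_neg, neg_smul]
  have e2 : ∀ s, -(L + D) *ᵥ y s + ((L + D) *ᵥ y s + b s) = b s := fun s => by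
    rw [Matrix.neg_mulVec, neg_add_cancel_left]
  simp only [e, e2] at hback
  have hyt : y t = exp (t • (L + D)) *ᵥ (exp (-t • (L + D)) *ᵥ y t) := by
    rw [Matrix.mulVec_mulVec]
    have : exp (t • (L + D)) * exp (-t • (L + D)) = 1 := by
      simpa using Matrix.exp_smul_neg_mul (L + D) (-t)
    rw [this, Matrix.one_mulVec]
  rw [hyt, integral_exp_sub_mulVec _ hb, ← Pi.add_apply, ← Matrix.mulVec_add]
  congr 2
  ext x
  exact hback x

end Duhamel

/-! ### Right-continuous processes with values in a finite set -/

section Paths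

variable {Ω M V : Type*} [Fintype M] [Fintype V]

lemma measurable_comp_of_measurableSet_fiber {Y E : Type*} [MeasurableSpace Y] [MeasurableSpace E]
    {τ : Y → M} (h : ∀ j, MeasurableSet {y | τ y = j}) (g : M → E) :
    Measurable fun y => g (τ y) := by
  let _ : MeasurableSpace M := ⊤
  have : Measurable τ := measurable_to_countable' h
  exact measurable_from_top.comp this

/-- A right-continuous process is jointly measurable: it is the limit of its values at the next
points of finer and finer grids. -/
lemma measurableSet_prod_of_rightContinuous [MeasurableSpace Ω] {τ : ℝ → Ω → M}
    (hm : ∀ t j, MeasurableSet {ω | τ t ω = j})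
    (hr : ∀ ω t, ∀ᶠ s in 𝓝[>] t, τ s ω = τ t ω) (j : M) :
    MeasurableSet {p : ℝ × Ω | τ p.1 p.2 = j} := by
  let d : ℕ → ℝ → ℝ := fun n t => ((⌊((n : ℝ) + 1) * t⌋ : ℝ) + 1) / ((n : ℝ) + 1)
  have hd : ∀ t, Tendsto (fun n => d n t) atTop (𝓝[>] t) := by
    intro t
    have hpos : ∀ n : ℕ, (0 : ℝ) < (n : ℝ) + 1 := fun n => by positivity
    refine tendsto_nhdsWithin_iff.2 ⟨?_, Eventually.of_forall fun n => ?_⟩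
    · refine tendsto_of_tendsto_of_tendsto_of_le_of_le (g := fun _ => t)
        (h := fun n : ℕ => t + 1 / ((n : ℝ) + 1)) tendsto_const_nhds ?_ (fun n => ?_) (fun n => ?_)
      · simpa using (tendsto_const_nhds (x := t)).add tendsto_one_div_add_atTop_nhds_zero_nat
      · rw [le_div_iff₀ (hpos n)]
        linarith [Int.lt_floor_add_one (((n : ℝ) + 1) * t)]
      · simp only [d]
        rw [div_le_iff₀ (hpos n), add_mul t, one_div, inv_mul_cancel₀ (hpos n).ne']
        linarith [Int.floor_le (((n : ℝ) + 1) * t)]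
    · simp only [Set.mem_Ioi, d]
      rw [lt_div_iff₀ (hpos n)]
      linarith [Int.lt_floor_add_one (((n : ℝ) + 1) * t)]
  have hmeas : ∀ n, MeasurableSet {p : ℝ × Ω | τ (d n p.1) p.2 = j} := by
    intro n
    have : {p : ℝ × Ω | τ (d n p.1) p.2 = j} =
        ⋃ k : ℤ, {p : ℝ × Ω | ⌊((n : ℝ) + 1) * p.1⌋ = k} ∩
          {p | τ (((k : ℝ) + 1) / ((n : ℝ) + 1)) p.2 = j} := by
      ext p
      simp [d]
    rw [this]
    refine MeasurableSet.iUnion fun k => MeasurableSet.inter ?_ ?_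
    · have : Measurable fun p : ℝ × Ω => ⌊((n : ℝ) + 1) * p.1⌋ :=
        Int.measurable_floor.comp (measurable_const.mul measurable_fst)
      exact this (measurableSet_singleton k)
    · exact measurable_snd (hm _ j)
  have heq : {p : ℝ × Ω | τ p.1 p.2 = j} =
      ⋃ N : ℕ, ⋂ n ≥ N, {p : ℝ × Ω | τ (d n p.1) p.2 = j} := by
    ext p
    have hev : ∀ᶠ n in atTop, τ (d n p.1) p.2 = τ p.1 p.2 := (hd p.1).eventually (hr p.2 p.1)
    simp only [Set.mem_ofPred_eq, Set.mem_iUnion, Set.mem_iInter]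
    constructor
    · intro h
      exact eventually_atTop.1 (hev.mono fun n hn => hn.trans h)
    · intro h
      obtain ⟨n, h1, h2⟩ := ((eventually_atTop.2 h).and hev).exists
      exact h2.symm.trans h1
  rw [heq]
  exact MeasurableSet.iUnion fun N => MeasurableSet.iInter fun n => MeasurableSet.iInter fun _ =>
    hmeas n

/-! ### Switched linear integral equations -/

/-- The integrals that control the Picard iteration. -/
lemma integral_pow_div_factorial (C K t : ℝ) (n : ℕ) :
    ∫ s in (0 : ℝ)..t, K * (C * (K * s) ^ n / n.factorial) =
      C * (K * t) ^ (n + 1) / (n + 1).factorial := by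
  have : ∀ s : ℝ, K * (C * (K * s) ^ n / n.factorial) =
      (K * C * K ^ n / n.factorial) * s ^ n := fun s => by rw [mul_pow]; ring
  simp_rw [this]
  rw [intervalIntegral.integral_const_mul, integral_pow, Nat.factorial_succ]
  have : (n.factorial : ℝ) ≠ 0 := by positivity
  have : (n : ℝ) + 1 ≠ 0 := by positivity
  push_cast
  field_simp
  ring

lemma continuous_picardBound (C K : ℝ) (n : ℕ) :
    Continuous fun s : ℝ => K * (C * (K * s) ^ n / n.factorial) := by
  fun_prop

lemma abs_mulVec_le {B : Matrix V V ℝ} {K : ℝ} (hB : ∀ k, ∑ l, |B k l| ≤ K) {x : V → ℝ} {b : ℝ}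
    (hb : 0 ≤ b) (hx : ∀ l, |x l| ≤ b) (k : V) : |(B *ᵥ x) k| ≤ K * b := by
  refine (Finset.abs_sum_le_sum_abs _ _).trans ?_
  refine le_trans ?_ (mul_le_mul_of_nonneg_right (hB k) hb)
  rw [Finset.sum_mul]
  refine Finset.sum_le_sum fun l _ => ?_
  rw [abs_mul]
  exact mul_le_mul_of_nonneg_left (hx l) (abs_nonneg _)

/-- A common bound for the absolute row sums of finitely many matrices. -/
lemma exists_rowSum_bound (A : M → Matrix V V ℝ) :
    ∃ K, 0 ≤ K ∧ ∀ j k, ∑ l, |A j k l| ≤ K := by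
  refine ⟨∑ j, ∑ k, ∑ l, |A j k l|, by positivity, fun j k => ?_⟩
  have h0 : ∀ j k, 0 ≤ ∑ l, |A j k l| := fun j k => Finset.sum_nonneg fun _ _ => abs_nonneg _
  exact (Finset.single_le_sum (f := fun k => ∑ l, |A j k l|) (fun k _ => h0 j k)
    (Finset.mem_univ k)).trans (Finset.single_le_sum (f := fun j => ∑ k, ∑ l, |A j k l|)
      (fun j _ => Finset.sum_nonneg fun k _ => h0 j k) (Finset.mem_univ j))

/-- `x` is a continuous solution on `[0, T]` of `x = F + ∫ A_τ x` along the mode path `τ`. -/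
def IsPathSolution (A : M → Matrix V V ℝ) (τ : ℝ → M) (F : ℝ → V → ℝ) (T : ℝ)
    (x : ℝ → V → ℝ) : Prop :=
  ContinuousOn x (Set.Icc 0 T) ∧
    ∀ t ∈ Set.Icc 0 T, ∀ k, x t k = F t k + ∫ s in (0 : ℝ)..t, (A (τ s) *ᵥ x s) k

lemma intervalIntegrable_mode_mulVec {n : Type*} {A : M → Matrix n V ℝ} {τ : ℝ → M}
    (hτ : ∀ j, MeasurableSet {s | τ s = j}) {x : ℝ → V → ℝ} {a b : ℝ}
    (hx : ∀ l, IntervalIntegrable (fun s => x s l) volume a b) (k : n) :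
    IntervalIntegrable (fun s => (A (τ s) *ᵥ x s) k) volume a b := by
  have e : (fun s => (A (τ s) *ᵥ x s) k) = ∑ l, fun s => A (τ s) k l * x s l := by
    ext s
    simp [Matrix.mulVec, dotProduct]
  rw [e]
  refine IntervalIntegrable.sum (Finset.univ : Finset V) fun l _ => ?_
  obtain ⟨c, hc⟩ := (Set.finite_range fun j => ‖A j k l‖).bddAbove
  have hmeas := measurable_comp_of_measurableSet_fiber hτ fun j => A j k l
  have hb : ∀ s, ‖A (τ s) k l‖ ≤ c := fun s => hc ⟨τ s, rfl⟩
  exact ⟨(hx l).1.bdd_mul hmeas.aestronglyMeasurable (ae_of_all _ hb),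
    (hx l).2.bdd_mul hmeas.aestronglyMeasurable (ae_of_all _ hb)⟩

section PathSolution

variable {A : M → Matrix V V ℝ} {τ : ℝ → M} {F G x y : ℝ → V → ℝ} {T : ℝ}

lemma IsPathSolution.intervalIntegrable (h : IsPathSolution A τ F T x) {t : ℝ}
    (ht : t ∈ Set.Icc 0 T) (l : V) : IntervalIntegrable (fun s => x s l) volume 0 t := by
  refine ContinuousOn.intervalIntegrable ?_
  rw [Set.uIcc_of_le ht.1]
  exact ((continuousOn_pi.1 h.1 l).mono (Set.Icc_subset_Icc_right ht.2))

lemma IsPathSolution.add (hτ : ∀ j, MeasurableSet {s | τ s = j})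
    (hx : IsPathSolution A τ F T x) (hy : IsPathSolution A τ G T y) :
    IsPathSolution A τ (fun t => F t + G t) T (fun t => x t + y t) := by
  refine ⟨hx.1.add hy.1, fun t ht k => ?_⟩
  simp only [Pi.add_apply, Matrix.mulVec_add]
  rw [intervalIntegral.integral_add
    (intervalIntegrable_mode_mulVec hτ (hx.intervalIntegrable ht) k)
    (intervalIntegrable_mode_mulVec hτ (hy.intervalIntegrable ht) k), hx.2 t ht k, hy.2 t ht k]
  ring

lemma IsPathSolution.neg (hx : IsPathSolution A τ F T x) :
    IsPathSolution A τ (fun t => -F t) T (fun t => -x t) := by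
  refine ⟨hx.1.neg, fun t ht k => ?_⟩
  simp only [Pi.neg_apply, Matrix.mulVec_neg]
  rw [intervalIntegral.integral_neg, hx.2 t ht k]
  ring

lemma IsPathSolution.congr {τ' : ℝ → M} (hx : IsPathSolution A τ F T x)
    (hτ : ∀ s ∈ Set.Icc 0 T, τ s = τ' s) (hF : ∀ s ∈ Set.Icc 0 T, F s = G s) :
    IsPathSolution A τ' G T x := by
  refine ⟨hx.1, fun t ht k => ?_⟩
  rw [hx.2 t ht k, hF t ht]
  congr 1
  refine intervalIntegral.integral_congr fun s hs => ?_
  rw [Set.uIcc_of_le ht.1] at hs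
  simp only [hτ s ⟨hs.1, hs.2.trans ht.2⟩]

/-- The homogeneous equation has no nonzero solution: inserting a bound for `x` into the equation
`n` times bounds `x` by the `n`-th term of an exponential series. -/
lemma IsPathSolution.eq_zero (hx : IsPathSolution A τ (fun _ => 0) T x) {t : ℝ}
    (ht : t ∈ Set.Icc 0 T) : x t = 0 := by
  obtain ⟨K, hK, hA⟩ := exists_rowSum_bound A
  obtain ⟨C, hC⟩ := isCompact_Icc.exists_bound_of_continuousOn hx.1
  have hbound : ∀ n : ℕ, ∀ s ∈ Set.Icc 0 T, ∀ k, |x s k| ≤ C * (K * s) ^ n / n.factorial := by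
    intro n
    induction n with
    | zero =>
      intro s hs k
      simpa using (norm_le_pi_norm (x s) k).trans (hC s hs)
    | succ n ih =>
      intro s hs k
      have hC0 : 0 ≤ C := (norm_nonneg _).trans (hC s hs)
      rw [hx.2 s hs k, ← integral_pow_div_factorial]
      simp only [Pi.zero_apply, zero_add]
      rw [← Real.norm_eq_abs]
      refine intervalIntegral.norm_integral_le_of_norm_le (μ := volume)
        (g := fun r => K * (C * (K * r) ^ n / n.factorial)) hs.1 (ae_of_all _ fun r hr => ?_)
        ((continuous_picardBound C K n).intervalIntegrable (μ := volume) _ _)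
      have hr' : r ∈ Set.Icc 0 T := ⟨hr.1.le, hr.2.trans hs.2⟩
      have : 0 ≤ r := hr'.1
      exact abs_mulVec_le (hA _) (by positivity) (ih r hr') k
  ext k
  have hlim : Tendsto (fun n : ℕ => C * (K * t) ^ n / n.factorial) atTop (𝓝 0) := by
    simpa [mul_div_assoc] using (FloorSemiring.tendsto_pow_div_factorial_atTop (K * t)).const_mul C
  have := ge_of_tendsto' hlim fun n => hbound n t ht k
  simpa using abs_nonpos_iff.1 this

lemma IsPathSolution.unique (hτ : ∀ j, MeasurableSet {s | τ s = j})
    (hx : IsPathSolution A τ F T x) (hy : IsPathSolution A τ F T y) {t : ℝ}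
    (ht : t ∈ Set.Icc 0 T) : x t = y t := by
  have h := hx.add hτ hy.neg
  simp only [add_neg_cancel] at h
  exact add_neg_eq_zero.1 (h.eq_zero ht)

end PathSolution

/-- The terms of the Picard series of `x = F + ∫ A_τ x`. -/
def picardTerm (A : M → Matrix V V ℝ) (τ : ℝ → Ω → M) (F : ℝ → Ω → V → ℝ) :
    ℕ → ℝ → Ω → V → ℝ
  | 0 => F
  | n + 1 => fun t ω k => ∫ s in Set.Ioc 0 t, (A (τ s ω) *ᵥ picardTerm A τ F n s ω) k

section Picard

variable {A : M → Matrix V V ℝ} {τ : ℝ → Ω → M} {F : ℝ → Ω → V → ℝ} {C K : ℝ}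

lemma picardTerm_bound (hK : 0 ≤ K) (hA : ∀ j k, ∑ l, |A j k l| ≤ K) (hC0 : 0 ≤ C)
    (hC : ∀ t ω k, |F t ω k| ≤ C) (n : ℕ) (t : ℝ) (ω : Ω) (k : V) :
    |picardTerm A τ F n t ω k| ≤ C * (K * max t 0) ^ n / n.factorial := by
  induction n generalizing t k with
  | zero => simpa [picardTerm] using hC t ω k
  | succ n ih =>
    rcases le_or_gt t 0 with ht | ht
    · simp only [picardTerm, Set.Ioc_eq_empty (not_lt.2 ht), setIntegral_empty, abs_zero]
      positivity
    · rw [max_eq_left ht.le, ← integral_pow_div_factorial]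
      simp only [picardTerm]
      rw [← intervalIntegral.integral_of_le ht.le]
      rw [← Real.norm_eq_abs]
      refine intervalIntegral.norm_integral_le_of_norm_le (μ := volume)
        (g := fun s => K * (C * (K * s) ^ n / n.factorial)) ht.le (ae_of_all _ fun s hs => ?_)
        ((continuous_picardBound C K n).intervalIntegrable (μ := volume) _ _)
      have hs0 : 0 ≤ s := hs.1.le
      have ih' := fun l => ih s l
      rw [max_eq_left hs0] at ih'
      exact abs_mulVec_le (hA _) (by positivity) ih' k

lemma picardTerm_nonneg (hA : ∀ j k l, 0 ≤ A j k l) (hF : ∀ t ω k, 0 ≤ F t ω k) (n : ℕ) (t : ℝ)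
    (ω : Ω) (k : V) : 0 ≤ picardTerm A τ F n t ω k := by
  induction n generalizing t k with
  | zero => exact hF t ω k
  | succ n ih =>
    exact setIntegral_nonneg measurableSet_Ioc fun s _ =>
      Finset.sum_nonneg fun l _ => mul_nonneg (hA _ _ _) (ih s l)

lemma measurable_mode_mulVec [MeasurableSpace Ω] {n : Type*} {A : M → Matrix n V ℝ}
    (hτ : ∀ j, MeasurableSet {p : ℝ × Ω | τ p.1 p.2 = j}) {x : ℝ → Ω → V → ℝ}
    (hx : ∀ l, Measurable fun p : ℝ × Ω => x p.1 p.2 l) (k : n) :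
    Measurable fun p : ℝ × Ω => (A (τ p.1 p.2) *ᵥ x p.1 p.2) k := by
  simp only [Matrix.mulVec, dotProduct]
  exact Finset.measurable_sum _ fun l _ =>
    (measurable_comp_of_measurableSet_fiber hτ fun j => A j k l).mul (hx l)

lemma measurable_primitive [MeasurableSpace Ω] {g : ℝ × Ω → ℝ} (hg : Measurable g) :
    Measurable fun p : ℝ × Ω => ∫ s in Set.Ioc 0 p.1, g (s, p.2) := by
  have h1 : Measurable fun q : (ℝ × Ω) × ℝ =>
      Set.indicator {q : (ℝ × Ω) × ℝ | 0 < q.2 ∧ q.2 ≤ q.1.1} (fun q => g (q.2, q.1.2)) q := by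
    refine Measurable.indicator (hg.comp (measurable_snd.prodMk (measurable_snd.comp
      measurable_fst))) ?_
    exact (measurableSet_lt measurable_const measurable_snd).inter
      (measurableSet_le measurable_snd (measurable_fst.comp measurable_fst))
  have h2 := (h1.stronglyMeasurable.integral_prod_right' (ν := volume)).measurable
  convert h2 using 2 with p
  rw [← integral_indicator measurableSet_Ioc]
  rfl

lemma measurable_picardTerm [MeasurableSpace Ω]
    (hτ : ∀ j, MeasurableSet {p : ℝ × Ω | τ p.1 p.2 = j})
    (hF : ∀ k, Measurable fun p : ℝ × Ω => F p.1 p.2 k) (n : ℕ) (k : V) :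
    Measurable fun p : ℝ × Ω => picardTerm A τ F n p.1 p.2 k := by
  induction n generalizing k with
  | zero => exact hF k
  | succ n ih => exact measurable_primitive (measurable_mode_mulVec hτ ih k)

lemma measurableSet_path [MeasurableSpace Ω]
    (hτ : ∀ j, MeasurableSet {p : ℝ × Ω | τ p.1 p.2 = j}) (ω : Ω) (j : M) :
    MeasurableSet {s | τ s ω = j} :=
  measurable_prodMk_right (y := ω) (hτ j)

/-- The Picard series: `x = F + ∫ A_τ x` has a jointly measurable solution, which is nonnegative if
all matrices and `F` are. -/
lemma exists_isPathSolution [MeasurableSpace Ω]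
    (hτ : ∀ j, MeasurableSet {p : ℝ × Ω | τ p.1 p.2 = j}) (A : M → Matrix V V ℝ)
    (hF : ∀ k, Measurable fun p : ℝ × Ω => F p.1 p.2 k)
    (hFc : ∀ ω, ContinuousOn (fun t => F t ω) (Set.Ici 0))
    (hC : ∀ t ω k, |F t ω k| ≤ C) :
    ∃ x : ℝ → Ω → V → ℝ, (∀ k, Measurable fun p : ℝ × Ω => x p.1 p.2 k) ∧
      (∀ t, ∃ b, ∀ s ≤ t, ∀ ω k, |x s ω k| ≤ b) ∧
      (∀ ω T, IsPathSolution A (fun s => τ s ω) (fun t => F t ω) T (fun t => x t ω)) ∧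
      ((∀ j k l, 0 ≤ A j k l) → (∀ t ω k, 0 ≤ F t ω k) → ∀ t ω k, 0 ≤ x t ω k) := by
  obtain ⟨K, hK, hA⟩ := exists_rowSum_bound A
  have hC' : ∀ t ω k, |F t ω k| ≤ |C| := fun t ω k => (hC t ω k).trans (le_abs_self C)
  have hb := picardTerm_bound (τ := τ) hK hA (abs_nonneg C) hC'
  have hsum : ∀ t, Summable fun n : ℕ => |C| * (K * max t 0) ^ n / n.factorial := fun t => by
    simpa only [mul_div_assoc] using (Real.summable_pow_div_factorial (K * max t 0)).mul_left |C|
  have hs : ∀ t ω k, Summable fun n => picardTerm A τ F n t ω k := fun t ω k =>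
    Summable.of_norm_bounded (hsum t) fun n => hb n t ω k
  let x : ℝ → Ω → V → ℝ := fun t ω k => ∑' n, picardTerm A τ F n t ω k
  have hxm : ∀ k, Measurable fun p : ℝ × Ω => x p.1 p.2 k := fun k =>
    measurable_of_tendsto_metrizable
      (f := fun N (p : ℝ × Ω) => ∑ n ∈ Finset.range N, picardTerm A τ F n p.1 p.2 k)
      (fun N => Finset.measurable_sum _ fun n _ => measurable_picardTerm hτ hF n k)
      (tendsto_pi_nhds.2 fun p => (hs p.1 p.2 k).hasSum.tendsto_sum_nat)
  have hxb : ∀ t, ∃ b, ∀ s ≤ t, ∀ ω k, |x s ω k| ≤ b := fun t => by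
    refine ⟨∑' n : ℕ, |C| * (K * max t 0) ^ n / n.factorial, fun s hst ω k =>
      tsum_of_norm_bounded (f := fun n => picardTerm A τ F n s ω k) (hsum t).hasSum
        fun n => (hb n s ω k).trans ?_⟩
    gcongr
  have hint : ∀ ω k a b, IntervalIntegrable (fun s => x s ω k) volume a b := by
    intro ω k a b
    obtain ⟨c, hc⟩ := hxb (max a b)
    have hm : Measurable fun s => x s ω k := (hxm k).comp measurable_prodMk_right
    rw [intervalIntegrable_iff]
    refine Measure.integrableOn_of_bounded (M := c) (by simp) hm.aestronglyMeasurable ?_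
    refine (ae_restrict_iff' measurableSet_uIoc).2 (ae_of_all _ fun s hs' => ?_)
    exact hc s hs'.2 ω k
  refine ⟨x, hxm, hxb, fun ω T => ?_, fun hA0 hF0 t ω k =>
    tsum_nonneg fun n => picardTerm_nonneg hA0 hF0 n t ω k⟩
  have hpath := measurableSet_path hτ ω
  have heq : ∀ t, 0 ≤ t → ∀ k,
      x t ω k = F t ω k + ∫ s in (0 : ℝ)..t, (A (τ s ω) *ᵥ x s ω) k := by
    intro t ht k
    have h1 : x t ω k = F t ω k + ∑' n, picardTerm A τ F (n + 1) t ω k :=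
      (hs t ω k).tsum_eq_zero_add
    rw [h1]
    congr 1
    have h2 : HasSum (fun n => ∫ s in (0 : ℝ)..t, (A (τ s ω) *ᵥ picardTerm A τ F n s ω) k)
        (∫ s in (0 : ℝ)..t, (A (τ s ω) *ᵥ x s ω) k) := by
      refine intervalIntegral.hasSum_integral_of_dominated_convergence
        (fun n _ => K * (|C| * (K * max t 0) ^ n / n.factorial)) (fun n => ?_) (fun n => ?_)
        (ae_of_all _ fun s _ => (hsum t).mul_left K) intervalIntegrable_const
        (ae_of_all _ fun s _ => ?_)
      · exact ((measurable_mode_mulVec hτ (measurable_picardTerm hτ hF n) k).comp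
          measurable_prodMk_right).aestronglyMeasurable
      · refine ae_of_all _ fun s hst => ?_
        rw [Set.uIoc_of_le ht] at hst
        refine abs_mulVec_le (hA _) (by positivity) (fun l => (hb n s ω l).trans ?_) k
        have := hst.2
        gcongr
      · simp only [Matrix.mulVec, dotProduct]
        exact hasSum_sum fun l _ => (hs s ω l).hasSum.mul_left _
    rw [← h2.tsum_eq]
    exact tsum_congr fun n => (intervalIntegral.integral_of_le ht).symm
  refine ⟨(continuousOn_pi.2 fun k => ?_ : ContinuousOn (fun t => x t ω) (Set.Ici 0)).mono
    Set.Icc_subset_Ici_self, fun t ht => heq t ht.1⟩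
  have hprim : Continuous fun t => ∫ s in (0 : ℝ)..t, (A (τ s ω) *ᵥ x s ω) k :=
    intervalIntegral.continuous_primitive
      (fun a b => intervalIntegrable_mode_mulVec hpath (fun l => hint ω l a b) k) 0
  exact ((continuousOn_pi.1 (hFc ω) k).add hprim.continuousOn).congr fun t ht => heq t ht k

end Picard

/-- Solutions of a switched Metzler system with a nonnegative initial state stay nonnegative: after
multiplication by `exp (κ t)` they solve a system with nonnegative matrices. -/
lemma IsPathSolution.nonneg [DecidableEq V] {A : M → Matrix V V ℝ} (hA : ∀ j, (A j).IsMetzler)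
    {τ : ℝ → M} (hτ : ∀ j, MeasurableSet {s | τ s = j}) {x0 : V → ℝ} (hx0 : ∀ k, 0 ≤ x0 k)
    {T : ℝ} {x : ℝ → V → ℝ} (hx : IsPathSolution A τ (fun _ => x0) T x) {t : ℝ}
    (ht : t ∈ Set.Icc 0 T) (k : V) :
    0 ≤ x t k := by
  choose κ' hκ' hκ using fun j => (hA j).exists_shift
  let κ : ℝ := ∑ j, κ' j
  have hB : ∀ j k l, 0 ≤ (A j + κ • (1 : Matrix V V ℝ)) k l := fun j k l => by
    refine (hκ j k l).trans ?_
    simp only [Matrix.add_apply, Matrix.smul_apply, smul_eq_mul]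
    have h1 : κ' j ≤ κ := Finset.single_le_sum (fun i _ => hκ' i) (Finset.mem_univ j)
    have h2 : (0 : ℝ) ≤ (1 : Matrix V V ℝ) k l := by rw [Matrix.one_apply]; split_ifs <;> norm_num
    have := mul_le_mul_of_nonneg_right h1 h2
    linarith
  have hτ' : ∀ j, MeasurableSet {p : ℝ × Unit | τ p.1 = j} := fun j => measurable_fst (hτ j)
  obtain ⟨y, -, -, hy, hynn⟩ := exists_isPathSolution (C := ∑ l, |x0 l|) (F := fun _ _ => x0)
    (τ := fun s _ => τ s) hτ'
    (fun j => A j + κ • (1 : Matrix V V ℝ)) (fun k => measurable_const)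
    (fun _ => continuousOn_const)
    (fun _ _ k => Finset.single_le_sum (f := fun l => |x0 l|) (fun _ _ => abs_nonneg _)
      (Finset.mem_univ k))
  have hy0 := hy () T
  have hz : IsPathSolution A τ (fun _ => x0) T (fun t => Real.exp (-κ * t) • y t ()) := by
    refine ⟨ContinuousOn.smul (f := fun t : ℝ => Real.exp (-κ * t))
      (Continuous.continuousOn (by fun_prop)) hy0.1, fun t ht k => ?_⟩
    have hw : ∀ s, HasDerivAt (fun s => Real.exp (-κ * s)) (Real.exp (-κ * s) * -κ) s := fun s => by
      simpa using ((hasDerivAt_id s).const_mul (-κ)).exp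
    have h := mul_primitive_eq (y := fun s => y s () k) hw (by fun_prop) ht.1
      (intervalIntegrable_mode_mulVec (A := fun j => A j + κ • (1 : Matrix V V ℝ)) hτ
        (hy0.intervalIntegrable ht) k) (fun s hs => hy0.2 s ⟨hs.1, hs.2.trans ht.2⟩ k)
    simp only [Pi.smul_apply, smul_eq_mul]
    rw [h]
    simp only [mul_zero, Real.exp_zero, one_mul]
    congr 1
    refine intervalIntegral.integral_congr fun s _ => ?_
    simp only [Matrix.add_mulVec, Matrix.smul_mulVec, Matrix.one_mulVec, Pi.add_apply,
      Pi.smul_apply, smul_eq_mul, Matrix.mulVec_smul]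
    ring
  rw [hx.unique hτ hz ht]
  exact mul_nonneg (Real.exp_pos _).le (hynn hB (fun _ _ k => hx0 k) t () k)

end Paths

/-! ### Finite-state Markov processes -/

lemma setIntegral_eq_sum_fiber {Ω M : Type*} [MeasurableSpace Ω] [Fintype M] {μ : Measure Ω}
    {τ : Ω → M} (hτ : ∀ l, MeasurableSet {ω | τ ω = l}) {E : Set Ω} (hE : MeasurableSet E)
    {f : Ω → ℝ} (hf : IntegrableOn f E μ) :
    ∫ ω in E, f ω ∂μ = ∑ l, ∫ ω in {ω | τ ω = l} ∩ E, f ω ∂μ := by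
  rw [← integral_biUnion_finset Finset.univ (fun l _ => (hτ l).inter hE)]
  · congr 2
    ext ω
    simp
  · intro l _ l' _ hll
    exact Set.disjoint_left.2 fun ω h h' => hll (h.1.symm.trans h'.1)
  · exact fun l _ => hf.mono_set Set.inter_subset_right

namespace IsMarkovFamily

variable {Ω M : Type*} [MeasurableSpace Ω] [Fintype M] [DecidableEq M] {Q : Matrix M M ℝ}
  {P : M → Measure Ω} {σ : ℝ → Ω → M}

lemma pastSigma_le (hσ : IsMarkovFamily Q P σ) (s : ℝ) :
    pastSigma σ s ≤ (inferInstance : MeasurableSpace Ω) := by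
  refine iSup₂_le fun r hr => ?_
  let _ : MeasurableSpace M := ⊤
  exact (measurable_to_countable' fun j => hσ.measurableSet_mode r j hr.1 :
    Measurable (σ r)).comap_le

lemma measurableSet_pastSigma {r s : ℝ} (hr : r ∈ Set.Icc 0 s) (j : M) :
    MeasurableSet[pastSigma σ s] {ω | σ r ω = j} := by
  have : MeasurableSpace.comap (σ r) ⊤ ≤ pastSigma σ s :=
    le_iSup₂_of_le (f := fun r (_ : r ∈ Set.Icc (0 : ℝ) s) => MeasurableSpace.comap (σ r) ⊤) r hr
      le_rfl
  exact this _ ⟨{j}, trivial, rfl⟩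

/-- The probability of being in mode `j` at time `t` after a start in mode `i`. -/
def trans (P : M → Measure Ω) (σ : ℝ → Ω → M) (t : ℝ) (i j : M) : ℝ :=
  (P i).real {ω | σ t ω = j}

lemma trans_nonneg (t : ℝ) (i j : M) : 0 ≤ trans P σ t i j := measureReal_nonneg

/-- The Markov property for functions of the past. -/
lemma setIntegral_markov (hσ : IsMarkovFamily Q P σ) (i j k : M) {s t : ℝ} (hs : 0 ≤ s)
    (ht : 0 ≤ t) {Z : Ω → ℝ} (hZ : StronglyMeasurable[pastSigma σ s] Z) :
    ∫ ω in {ω | σ s ω = j} ∩ {ω | σ (s + t) ω = k}, Z ω ∂(P i) =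
      trans P σ t j k * ∫ ω in {ω | σ s ω = j}, Z ω ∂(P i) := by
  have hm := hσ.pastSigma_le s
  have key : ((P i).restrict ({ω | σ s ω = j} ∩ {ω | σ (s + t) ω = k})).trim hm =
      (P j {ω | σ t ω = k}) • ((P i).restrict {ω | σ s ω = j}).trim hm := by
    refine @Measure.ext _ (pastSigma σ s) _ _ fun F hF => ?_
    rw [Measure.smul_apply, trim_measurableSet_eq hm hF, trim_measurableSet_eq hm hF,
      Measure.restrict_apply (hm F hF), Measure.restrict_apply (hm F hF), ← Set.inter_assoc,
      hσ.markov i j k s t hs ht F hF, smul_eq_mul, mul_comm]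
  rw [integral_trim hm hZ, key, integral_smul_measure, ← integral_trim hm hZ]
  rfl

lemma trans_add (hσ : IsMarkovFamily Q P σ) {s t : ℝ} (hs : 0 ≤ s) (ht : 0 ≤ t) (i k : M) :
    trans P σ (s + t) i k = ∑ j, trans P σ s i j * trans P σ t j k := by
  have := hσ.isProb i
  have h := setIntegral_eq_sum_fiber (μ := P i) (fun l => hσ.measurableSet_mode s l hs)
    (hσ.measurableSet_mode (s + t) k (by positivity)) (f := fun _ => (1 : ℝ))
    (integrable_const _)
  have h1 : ∀ E : Set Ω, ∫ _ in E, (1 : ℝ) ∂(P i) = (P i).real E := fun E => by simp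
  rw [h1] at h
  rw [trans, h]
  refine Finset.sum_congr rfl fun j _ => ?_
  rw [hσ.setIntegral_markov i j k hs ht stronglyMeasurable_const, h1, mul_comm]
  rfl

lemma trans_zero (hσ : IsMarkovFamily Q P σ) (i j : M) :
    trans P σ 0 i j = if i = j then 1 else 0 := by
  have := hσ.isProb i
  have hstart : (P i).real {ω | σ 0 ω = i} = 1 := by simp [Measure.real, hσ.start i]
  split_ifs with h
  · rw [← h]
    exact hstart
  · have hsub : {ω | σ 0 ω = j} ⊆ {ω | σ 0 ω = i}ᶜ := fun ω hω hω' => h (hω'.symm.trans hω)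
    have := measureReal_mono (μ := P i) hsub
    rw [probReal_compl_eq_one_sub (hσ.measurableSet_mode 0 i le_rfl), hstart, sub_self] at this
    exact le_antisymm this measureReal_nonneg

lemma trans_le_one (hσ : IsMarkovFamily Q P σ) (t : ℝ) (i j : M) : trans P σ t i j ≤ 1 := by
  have := hσ.isProb i
  exact measureReal_le_one

lemma sum_trans (hσ : IsMarkovFamily Q P σ) {t : ℝ} (ht : 0 ≤ t) (i : M) :
    ∑ j, trans P σ t i j = 1 := by
  have := hσ.isProb i
  have h := setIntegral_eq_sum_fiber (μ := P i) (fun l => hσ.measurableSet_mode t l ht)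
    MeasurableSet.univ (f := fun _ => (1 : ℝ)) (integrable_const _)
  simpa [trans] using h.symm

lemma hasDerivWithinAt_trans (hσ : IsMarkovFamily Q P σ) {t : ℝ} (ht : 0 ≤ t) (i k : M) :
    HasDerivWithinAt (fun s => trans P σ s i k) (∑ j, trans P σ t i j * Q j k) (Set.Ici t) t := by
  have h1 : HasDerivWithinAt (fun h : ℝ => ∑ j, trans P σ t i j * trans P σ h j k)
      (∑ j, trans P σ t i j * Q j k) (Set.Ici 0) (t - t) := by
    rw [sub_self]
    exact HasDerivWithinAt.fun_sum fun j _ => (hσ.rate j k).const_mul _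
  have h2 := HasDerivWithinAt.scomp (h := fun s => s - t) t h1
    ((hasDerivAt_id t).sub_const t).hasDerivWithinAt (s := Set.Ici t)
    (fun s hs => by simpa using hs)
  rw [one_smul] at h2
  refine h2.congr (fun s hs => ?_) ?_
  · have := hσ.trans_add ht (sub_nonneg.2 hs) i k
    rw [add_sub_cancel] at this
    exact this
  · have := hσ.trans_add ht le_rfl i k
    rw [add_zero] at this
    simpa using this

lemma continuousOn_trans (hσ : IsMarkovFamily Q P σ) (i k : M) :
    ContinuousOn (fun t => trans P σ t i k) (Set.Ici 0) := by
  -- the semigroup property transports the modulus of continuity at `0` to all times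
  let w : ℝ → ℝ := fun h => ∑ j, |trans P σ h j k - trans P σ 0 j k|
  have hw : ∀ s t, 0 ≤ s → s ≤ t → |trans P σ t i k - trans P σ s i k| ≤ w (t - s) := by
    intro s t hs hst
    have e1 := hσ.trans_add hs (sub_nonneg.2 hst) i k
    have e2 := hσ.trans_add hs le_rfl i k
    rw [add_sub_cancel] at e1
    rw [add_zero] at e2
    rw [e1, e2, ← Finset.sum_sub_distrib]
    refine (Finset.abs_sum_le_sum_abs _ _).trans (Finset.sum_le_sum fun j _ => ?_)
    rw [← mul_sub, abs_mul, abs_of_nonneg (trans_nonneg s i j)]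
    exact mul_le_of_le_one_left (abs_nonneg _) (hσ.trans_le_one s i j)
  have hwc : Tendsto w (𝓝[Set.Ici 0] 0) (𝓝 0) := by
    have : ContinuousWithinAt w (Set.Ici 0) 0 := by
      refine tendsto_finsetSum _ fun j _ => ?_
      exact ((hσ.rate j k).continuousWithinAt.sub continuousWithinAt_const).abs
    simpa [w] using this.tendsto
  intro t ht
  have hd : Tendsto (fun s => |t - s|) (𝓝[Set.Ici 0] t) (𝓝[Set.Ici 0] 0) := by
    refine tendsto_nhdsWithin_iff.2 ⟨?_, Eventually.of_forall fun s => Set.mem_Ici.2 (abs_nonneg _)⟩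
    have : Continuous fun s : ℝ => |t - s| := by fun_prop
    simpa using (this.tendsto t).mono_left nhdsWithin_le_nhds
  refine tendsto_iff_norm_sub_tendsto_zero.2 (squeeze_zero' (Eventually.of_forall fun s =>
    norm_nonneg _) ?_ (hwc.comp hd))
  filter_upwards [self_mem_nhdsWithin] with s hs
  rcases le_total s t with hst | hst
  · rw [Real.norm_eq_abs, abs_sub_comm]
    simpa [abs_of_nonneg (sub_nonneg.2 hst)] using hw s t hs hst
  · simpa [abs_of_nonpos (sub_nonpos.2 hst)] using hw t s ht hst

lemma trans_eq_add_integral (hσ : IsMarkovFamily Q P σ) {t : ℝ} (ht : 0 ≤ t) (i k : M) :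
    trans P σ t i k = trans P σ 0 i k +
      ∫ s in (0 : ℝ)..t, ∑ j, trans P σ s i j * Q j k := by
  have hsub : Set.uIcc 0 t ⊆ Set.Ici 0 := by
    rw [Set.uIcc_of_le ht]
    exact Set.Icc_subset_Ici_self
  rw [intervalIntegral.integral_eq_sub_of_hasDeriv_right
    ((hσ.continuousOn_trans i k).mono hsub)
    (fun s hs => (hσ.hasDerivWithinAt_trans
      (by rw [min_eq_left ht] at hs; exact hs.1.le) i k).mono Set.Ioi_subset_Ici_self)]
  · ring
  · refine ContinuousOn.intervalIntegrable ?_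
    exact continuousOn_finsetSum _ fun j _ =>
      ((hσ.continuousOn_trans i j).mono hsub).mul continuousOn_const

section Generator

open NormedSpace
open scoped Matrix.Norms.Operator

variable {V : Type*} [Fintype V] [DecidableEq V]

/-- The forward generator acting on families of vectors in `ℝ^V` indexed by the modes. -/
def forwardMatrix (V : Type*) [DecidableEq V] (Q : Matrix M M ℝ) : Matrix (M × V) (M × V) ℝ :=
  Matrix.of fun x y => if x.2 = y.2 then Q y.1 x.1 else 0

lemma forwardMatrix_mulVec (Q : Matrix M M ℝ) (g : M × V → ℝ) (j : M) (k : V) :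
    (forwardMatrix V Q *ᵥ g) (j, k) = ∑ i, Q i j * g (i, k) := by
  simp [Matrix.mulVec, dotProduct, forwardMatrix, Fintype.sum_prod_type]

/-- The transition probabilities solve the forward equation, and so does the exponential. -/
lemma exp_forwardMatrix_mulVec (hσ : IsMarkovFamily Q P σ) {t : ℝ} (ht : 0 ≤ t)
    (g : M × V → ℝ) (j : M) (k : V) :
    (exp (t • forwardMatrix V Q) *ᵥ g) (j, k) = ∑ i, trans P σ t i j * g (i, k) := by
  let y : ℝ → M × V → ℝ := fun s x => ∑ i, trans P σ s i x.1 * g (i, x.2)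
  have hyi : ∀ s ∈ Set.Icc 0 t, ∀ x, IntervalIntegrable (fun s => y s x) volume 0 s := by
    intro s hs x
    refine ContinuousOn.intervalIntegrable (continuousOn_finsetSum _ fun i _ =>
      ((hσ.continuousOn_trans i x.1).mono ?_).mul continuousOn_const)
    rw [Set.uIcc_of_le hs.1]
    exact Set.Icc_subset_Ici_self
  have hQy : ∀ s (x : M × V), (forwardMatrix V Q *ᵥ y s) x =
      ∑ i, (∑ l, trans P σ s i l * Q l x.1) * g (i, x.2) := by
    rintro s ⟨j, k⟩
    rw [forwardMatrix_mulVec]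
    simp only [y, Finset.mul_sum, Finset.sum_mul]
    rw [Finset.sum_comm]
    exact Finset.sum_congr rfl fun i _ => Finset.sum_congr rfl fun l _ => by ring
  have hint : ∀ s ∈ Set.Icc 0 t, ∀ i l, IntervalIntegrable
      (fun s => ∑ j, trans P σ s i j * Q j l) volume 0 s := by
    intro s hs i l
    refine ContinuousOn.intervalIntegrable (continuousOn_finsetSum _ fun j _ =>
      ((hσ.continuousOn_trans i j).mono ?_).mul continuousOn_const)
    rw [Set.uIcc_of_le hs.1]
    exact Set.Icc_subset_Ici_self
  have hy : ∀ s ∈ Set.Icc 0 t, ∀ x,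
      y s x = g x + ∫ r in (0 : ℝ)..s, (forwardMatrix V Q *ᵥ y r) x := by
    intro s hs x
    simp_rw [hQy]
    rw [intervalIntegral.integral_finsetSum fun i _ => (hint s hs i x.1).mul_const _]
    simp only [y, intervalIntegral.integral_mul_const]
    have : g x = ∑ i, trans P σ 0 i x.1 * g (i, x.2) := by simp [hσ.trans_zero]
    rw [this, ← Finset.sum_add_distrib]
    refine Finset.sum_congr rfl fun i _ => ?_
    rw [hσ.trans_eq_add_integral hs.1 i x.1]
    ring
  have h := exp_mulVec_eq_add_integral (-forwardMatrix V Q) ht (fun x =>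
    intervalIntegrable_mulVec (W := fun _ => forwardMatrix V Q) (fun _ _ => continuous_const)
      (hyi t ⟨ht, le_rfl⟩) x) hy
  have e : ∀ s, -forwardMatrix V Q *ᵥ y s + forwardMatrix V Q *ᵥ y s = 0 := fun s => by
    rw [Matrix.neg_mulVec, neg_add_cancel]
  simp only [e, Matrix.mulVec_zero, Pi.zero_apply, intervalIntegral.integral_zero, add_zero,
    smul_neg, ← neg_smul] at h
  have hg : exp (-t • forwardMatrix V Q) *ᵥ y t = g := funext h
  have e2 : exp (t • forwardMatrix V Q) * exp (-t • forwardMatrix V Q) = 1 := by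
    simpa using Matrix.exp_smul_neg_mul (forwardMatrix V Q) (-t)
  have hyt : exp (t • forwardMatrix V Q) *ᵥ g = y t := by
    rw [← hg, Matrix.mulVec_mulVec, e2, Matrix.one_mulVec]
  rw [hyt]

end Generator

/-! ### Clamped and stopped mode processes -/

/-- The process on `[0, T]`, extended by constants to all times. -/
def stopped (σ : ℝ → Ω → M) (T : ℝ) : ℝ → Ω → M := fun t => σ (min (max t 0) T)

lemma stopped_eq {T t : ℝ} (ht : t ∈ Set.Icc 0 T) : stopped σ T t = σ t := by
  simp [stopped, ht.1, ht.2]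

/-- The stopped process is jointly measurable with respect to the past of the stopping time. -/
lemma measurableSet_stopped (hσ : IsMarkovFamily Q P σ) {T : ℝ} (hT : 0 ≤ T) (j : M) :
    MeasurableSet[MeasurableSpace.prod inferInstance (pastSigma σ T)]
      {p : ℝ × Ω | stopped σ T p.1 p.2 = j} := by
  refine @measurableSet_prod_of_rightContinuous Ω M _ (pastSigma σ T) (stopped σ T)
    (fun t j => ?_) (fun ω t => ?_) j
  · exact measurableSet_pastSigma ⟨le_min (le_max_right _ _) hT, min_le_right _ _⟩ j
  · rcases lt_or_ge t 0 with h | h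
    · filter_upwards [mem_nhdsWithin_of_mem_nhds (Iio_mem_nhds h)] with s hs
      have hs' : s < 0 := hs
      simp [stopped, max_eq_right hs'.le, max_eq_right h.le]
    rcases lt_or_ge t T with h' | h'
    · filter_upwards [hσ.right_cont ω t h, mem_nhdsWithin_of_mem_nhds (Iio_mem_nhds h'),
        self_mem_nhdsWithin] with s hs hsT hst
      rw [stopped_eq ⟨h, h'.le⟩, stopped_eq ⟨h.trans (le_of_lt hst), le_of_lt hsT⟩]
      exact hs
    · filter_upwards [self_mem_nhdsWithin] with s hs
      have hts : t < s := hs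
      simp [stopped, max_eq_left h, max_eq_left (h.trans hts.le), min_eq_right h',
        min_eq_right (h'.trans hts.le)]

/-- The process with negative times moved to `0`; it is right-continuous and measurable at all
times, which is assumed of `σ` for `t ≥ 0` only. -/
def clamped (σ : ℝ → Ω → M) : ℝ → Ω → M := fun t => σ (max t 0)

lemma clamped_eq {t : ℝ} (ht : 0 ≤ t) : clamped σ t = σ t := by
  simp [clamped, ht]

lemma measurableSet_clamped (hσ : IsMarkovFamily Q P σ) (j : M) :
    MeasurableSet {p : ℝ × Ω | clamped σ p.1 p.2 = j} := by
  refine measurableSet_prod_of_rightContinuous (τ := clamped σ)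
    (fun t j => hσ.measurableSet_mode _ j (le_max_right _ _)) (fun ω t => ?_) j
  rcases lt_or_ge t 0 with h | h
  · filter_upwards [mem_nhdsWithin_of_mem_nhds (Iio_mem_nhds h)] with s hs
    have hs' : s < 0 := hs
    simp [clamped, max_eq_right hs'.le, max_eq_right h.le]
  · filter_upwards [hσ.right_cont ω t h, self_mem_nhdsWithin] with s hs hst
    rw [clamped_eq h, clamped_eq (h.trans (le_of_lt hst))]
    exact hs

end IsMarkovFamily

/-! ### Trajectories with an integrable input -/

/-- The inhomogeneity of the integral equation with initial state `x0` and input `g τ` along the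
mode path `τ`. -/
def forcing {M V : Type*} (g : M → ℝ → V → ℝ) (τ : ℝ → M) (x0 : V → ℝ) : ℝ → V → ℝ :=
  fun t k => x0 k + ∫ s in Set.Ioc 0 t, g (τ s) s k

section Forcing

variable {Ω M V : Type*} [Fintype M] [Fintype V] {g : M → ℝ → V → ℝ}

lemma measurable_mode_input {Y : Type*} [MeasurableSpace Y]
    (hgm : ∀ j k, Measurable fun s => g j s k)
    {τ : Y → M} (hτ : ∀ j, MeasurableSet {p | τ p = j}) {h : Y → ℝ} (hh : Measurable h) (k : V) :
    Measurable fun p => g (τ p) (h p) k := by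
  classical
  have : (fun p => g (τ p) (h p) k) = fun p => ∑ j, if τ p = j then g j (h p) k else 0 := by
    ext p
    simp
  rw [this]
  exact Finset.measurable_sum _ fun j _ =>
    Measurable.ite (hτ j) ((hgm j k).comp hh) measurable_const

lemma abs_mode_input_le (g : M → ℝ → V → ℝ) (j : M) (s : ℝ) (k : V) :
    |g j s k| ≤ ∑ j, |g j s k| :=
  Finset.single_le_sum (f := fun j => |g j s k|) (fun _ _ => abs_nonneg _) (Finset.mem_univ j)

lemma integrable_mode_input (hgm : ∀ j k, Measurable fun s => g j s k)
    (hgi : ∀ j k, Integrable fun s => g j s k) {τ : ℝ → M} (hτ : ∀ j, MeasurableSet {s | τ s = j})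
    (k : V) : Integrable fun s => g (τ s) s k :=
  Integrable.mono' (integrable_finsetSum _ fun j _ => (hgi j k).abs)
    (measurable_mode_input hgm hτ measurable_id k).aestronglyMeasurable
    (ae_of_all _ fun s => abs_mode_input_le g (τ s) s k)

lemma forcing_bound (hgi : ∀ j k, Integrable fun s => g j s k) (τ : ℝ → M) (x0 : V → ℝ) (t : ℝ)
    (k : V) :
    |forcing g τ x0 t k| ≤ ∑ k, (|x0 k| + ∫ s, ∑ j, |g j s k|) := by
  have hnn : ∀ s k, 0 ≤ ∑ j, |g j s k| := fun s k => Finset.sum_nonneg fun j _ => abs_nonneg _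
  have hint : ∀ k, Integrable fun s => ∑ j, |g j s k| := fun k =>
    integrable_finsetSum _ fun j _ => (hgi j k).abs
  have h1 : |∫ s in Set.Ioc 0 t, g (τ s) s k| ≤ ∫ s, ∑ j, |g j s k| := by
    refine (norm_integral_le_of_norm_le (f := fun s => g (τ s) s k) (hint k).integrableOn
      (ae_of_all _ fun s => abs_mode_input_le g (τ s) s k)).trans ?_
    exact setIntegral_le_integral (hint k) (ae_of_all _ fun s => hnn s k)
  refine ((abs_add_le _ _).trans (add_le_add_right h1 _)).trans ?_
  exact Finset.single_le_sum (f := fun k => |x0 k| + ∫ s, ∑ j, |g j s k|)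
    (fun k _ => add_nonneg (abs_nonneg _) (integral_nonneg fun s => hnn s k)) (Finset.mem_univ k)

lemma continuousOn_forcing (hgm : ∀ j k, Measurable fun s => g j s k)
    (hgi : ∀ j k, Integrable fun s => g j s k) {τ : ℝ → M} (hτ : ∀ j, MeasurableSet {s | τ s = j})
    (x0 : V → ℝ) : ContinuousOn (forcing g τ x0) (Set.Ici 0) := by
  refine continuousOn_pi.2 fun k => ?_
  have h : Continuous fun t => ∫ s in (0 : ℝ)..t, g (τ s) s k :=
    intervalIntegral.continuous_primitive
      (fun a b => (integrable_mode_input hgm hgi hτ k).intervalIntegrable) 0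
  refine ((continuousOn_const (c := x0 k)).add h.continuousOn).congr fun t ht => ?_
  simp only [forcing, Pi.add_apply, intervalIntegral.integral_of_le (Set.mem_Ici.1 ht)]

lemma forcing_congr {τ τ' : ℝ → M} {T : ℝ} (h : ∀ s ∈ Set.Icc 0 T, τ s = τ' s) (x0 : V → ℝ) :
    ∀ t ∈ Set.Icc 0 T, forcing g τ x0 t = forcing g τ' x0 t := by
  intro t ht
  ext k
  simp only [forcing]
  congr 1
  refine setIntegral_congr_fun measurableSet_Ioc fun s hs => ?_
  simp only [h s ⟨hs.1.le, hs.2.trans ht.2⟩]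

end Forcing

namespace IsMarkovFamily

open NormedSpace
open scoped Matrix.Norms.Operator

variable {Ω M V : Type*} [MeasurableSpace Ω] [Fintype M] [DecidableEq M] [Fintype V]
  [DecidableEq V] {Q : Matrix M M ℝ} {P : M → Measure Ω} {σ : ℝ → Ω → M} {g : M → ℝ → V → ℝ}

/-- `X` consists of the solutions, for all samples, of the switched linear system with input `g` and
initial state `x0`; it is jointly measurable, locally bounded and adapted. -/
structure IsAdaptedSolution (σ : ℝ → Ω → M) (A : M → Matrix V V ℝ) (g : M → ℝ → V → ℝ)
    (x0 : V → ℝ) (X : ℝ → Ω → V → ℝ) : Prop where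
  measurable : ∀ k, Measurable fun p : ℝ × Ω => X p.1 p.2 k
  bounded : ∀ t, ∃ b, ∀ s ≤ t, ∀ ω k, |X s ω k| ≤ b
  path : ∀ ω T, IsPathSolution A (fun s => clamped σ s ω)
    (forcing g (fun s => clamped σ s ω) x0) T fun t => X t ω
  adapted : ∀ t, 0 ≤ t → ∀ k, StronglyMeasurable[pastSigma σ t] fun ω => X t ω k

/-- The trajectories for all samples form a jointly measurable adapted process. -/
lemma exists_solution (hσ : IsMarkovFamily Q P σ) (A : M → Matrix V V ℝ)
    (hgm : ∀ j k, Measurable fun s => g j s k) (hgi : ∀ j k, Integrable fun s => g j s k)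
    (x0 : V → ℝ) :
    ∃ X, IsAdaptedSolution σ A g x0 X := by
  have hF : ∀ (m : MeasurableSpace Ω) (τ : ℝ → Ω → M)
      (_ : ∀ j, MeasurableSet[MeasurableSpace.prod inferInstance m] {p : ℝ × Ω | τ p.1 p.2 = j}),
      ∃ X : ℝ → Ω → V → ℝ,
        (∀ k, Measurable[MeasurableSpace.prod inferInstance m] fun p : ℝ × Ω => X p.1 p.2 k) ∧
        (∀ t, ∃ b, ∀ s ≤ t, ∀ ω k, |X s ω k| ≤ b) ∧
        (∀ ω T, IsPathSolution A (fun s => τ s ω) (forcing g (fun s => τ s ω) x0) T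
          fun t => X t ω) := by
    intro m τ hτ
    obtain ⟨X, h1, h2, h3, -⟩ := exists_isPathSolution
      (F := fun t ω => forcing g (fun s => τ s ω) x0 t) hτ A
      (fun k => measurable_const.add (measurable_primitive
        (g := fun p => g (τ p.1 p.2) p.1 k) (measurable_mode_input hgm hτ measurable_fst k)))
      (fun ω => continuousOn_forcing hgm hgi (measurableSet_path hτ ω) x0)
      (fun t ω k => forcing_bound hgi _ x0 t k)
    exact ⟨X, h1, h2, h3⟩
  obtain ⟨X, hXm, hXb, hX⟩ := hF _ (clamped σ) hσ.measurableSet_clamped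
  refine ⟨X, hXm, hXb, hX, fun t ht k => ?_⟩
  obtain ⟨Y, hYm, -, hY⟩ := hF (pastSigma σ t) (stopped σ t) (hσ.measurableSet_stopped ht)
  have heq : ∀ ω, X t ω = Y t ω := by
    intro ω
    have hagree : ∀ s ∈ Set.Icc 0 t, stopped σ t s ω = clamped σ s ω := fun s hs => by
      rw [stopped_eq hs, clamped_eq hs.1]
    exact (hX ω t).unique (measurableSet_path hσ.measurableSet_clamped ω)
      ((hY ω t).congr hagree (forcing_congr hagree x0)) ⟨ht, le_rfl⟩
  simp_rw [heq]
  have : Measurable[pastSigma σ t] fun ω => Y t ω k :=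
    (hYm k).comp (@measurable_prodMk_left _ _ _ (pastSigma σ t) t)
  exact this.stronglyMeasurable

lemma IsAdaptedSolution.integrable {A : M → Matrix V V ℝ} {x0 : V → ℝ} {X : ℝ → Ω → V → ℝ}
    (hX : IsAdaptedSolution σ A g x0 X) (μ : Measure Ω) [IsFiniteMeasure μ] (t : ℝ) (k : V) :
    Integrable (fun ω => X t ω k) μ := by
  obtain ⟨b, hb⟩ := hX.bounded t
  exact Integrable.of_bound ((hX.measurable k).comp measurable_prodMk_left).aestronglyMeasurable b
    (ae_of_all _ fun ω => hb t le_rfl ω k)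

/-! ### The moment equation -/

/-- The block diagonal matrix of the mode dynamics. -/
def blockMatrix (A : M → Matrix V V ℝ) : Matrix (M × V) (M × V) ℝ :=
  Matrix.of fun x y => if x.1 = y.1 then A y.1 x.2 y.2 else 0

lemma blockMatrix_mulVec (A : M → Matrix V V ℝ) (y : M × V → ℝ) (j : M) (k : V) :
    (blockMatrix A *ᵥ y) (j, k) = (A j *ᵥ fun l => y (j, l)) k := by
  simp only [Matrix.mulVec, dotProduct, blockMatrix, Matrix.of_apply, Fintype.sum_prod_type]
  rw [Finset.sum_eq_single j]
  · simp
  · intro i _ hi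
    simp [hi.symm]
  · simp

/-- The expectation of the state restricted to each mode, `E[𝟙(σ t = j) x t]`. -/
def moment (μ : Measure Ω) (σ : ℝ → Ω → M) (X : ℝ → Ω → V → ℝ) (t : ℝ) (y : M × V) : ℝ :=
  ∫ ω in {ω | clamped σ t ω = y.1}, X t ω y.2 ∂μ

variable {A : M → Matrix V V ℝ} {X : ℝ → Ω → V → ℝ} {x0 : V → ℝ}

/-- The mild form of the moment equation: conditioning on the mode at time `s` splits the increment
of `𝟙(σ t = j) x` into the transition from `s` to `t` and the dynamics at time `s`. -/
lemma moment_mild (hσ : IsMarkovFamily Q P σ) (hgm : ∀ j k, Measurable fun s => g j s k)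
    (hgi : ∀ j k, Integrable fun s => g j s k)
    (hX : IsAdaptedSolution σ A g x0 X)
    (i : M) {t : ℝ} (ht : 0 ≤ t) (y : M × V) :
    moment (P i) σ X t y =
      (exp (t • forwardMatrix V Q) *ᵥ fun z => if z.1 = i then x0 z.2 else 0) y +
      ∫ s in (0 : ℝ)..t, (exp ((t - s) • forwardMatrix V Q) *ᵥ
        (blockMatrix A *ᵥ moment (P i) σ X s + fun z => trans P σ s i z.1 * g z.1 s z.2)) y := by
  obtain ⟨j, k⟩ := y
  have hprob := hσ.isProb i
  have hτ := hσ.measurableSet_clamped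
  let E : ℝ → M → Set Ω := fun s l => {ω | clamped σ s ω = l}
  have hE : ∀ s l, MeasurableSet (E s l) := fun s l => measurable_prodMk_left (hτ l)
  let u : ℝ → Ω → ℝ := fun s ω =>
    (A (clamped σ s ω) *ᵥ X s ω) k + g (clamped σ s ω) s k
  obtain ⟨K, hK, hA⟩ := exists_rowSum_bound A
  obtain ⟨b, hb⟩ := hX.bounded t
  have hb0 : 0 ≤ |b| := abs_nonneg b
  have hAx : ∀ s ≤ t, ∀ ω, |(A (clamped σ s ω) *ᵥ X s ω) k| ≤ K * |b| := fun s hs ω =>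
    abs_mulVec_le (hA _) hb0 (fun l => (hb s hs ω l).trans (le_abs_self b)) k
  have hm1 := measurable_mode_mulVec hτ hX.measurable k (A := A)
  have hm2 : Measurable fun p : ℝ × Ω => g (clamped σ p.1 p.2) p.1 k :=
    measurable_mode_input hgm hτ measurable_fst k
  have hXint : ∀ s l, Integrable (fun ω => X s ω l) (P i) := hX.integrable (P i)
  have hfin : IsFiniteMeasure (volume.restrict (Set.uIoc 0 t)) := by
    rw [Set.uIoc_of_le ht]
    infer_instance
  -- the increment is integrable on `[0, t] × Ω`
  have huint : Integrable (Function.uncurry u)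
      ((volume.restrict (Set.uIoc 0 t)).prod ((P i).restrict (E t j))) := by
    refine Integrable.add ?_ ?_
    · refine Integrable.mono' (integrable_const (K * |b|)) hm1.aestronglyMeasurable ?_
      rw [Measure.prod_restrict]
      refine (ae_restrict_iff' (measurableSet_uIoc.prod (hE t j))).2
        (ae_of_all _ fun p hp => hAx p.1 ?_ p.2)
      have h1 : p.1 ∈ Set.uIoc 0 t := hp.1
      rw [Set.uIoc_of_le ht] at h1
      exact h1.2
    · refine Integrable.mono' (Integrable.comp_fst (f := fun s => ∑ j, |g j s k|)
        (integrable_finsetSum _ fun j _ => (hgi j k).abs.restrict) _) hm2.aestronglyMeasurable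
        (ae_of_all _ fun p => abs_mode_input_le g _ p.1 k)
  -- the integral equation along each path
  have hpath : ∀ ω, X t ω k = x0 k + ∫ s in (0 : ℝ)..t, u s ω := by
    intro ω
    have hpm := measurableSet_path hτ ω
    refine ((hX.path ω t).2 t ⟨ht, le_rfl⟩ k).trans ?_
    rw [forcing, ← intervalIntegral.integral_of_le ht,
      intervalIntegral.integral_add
        (intervalIntegrable_mode_mulVec hpm ((hX.path ω t).intervalIntegrable ⟨ht, le_rfl⟩) k)
        (integrable_mode_input hgm hgi hpm k).intervalIntegrable]
    ring
  have hinner : ∀ s ∈ Set.Icc 0 t, ∫ ω in E t j, u s ω ∂(P i) =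
      ∑ l, trans P σ (t - s) l j *
        ((blockMatrix A *ᵥ moment (P i) σ X s) (l, k) + trans P σ s i l * g l s k) := by
    intro s hs
    have hEs : ∀ l, E s l = {ω | σ s ω = l} := fun l => by simp only [E, clamped_eq hs.1]
    have hEt : E t j = {ω | σ (s + (t - s)) ω = j} := by
      simp only [E, clamped_eq ht, add_sub_cancel]
    have huInt : IntegrableOn (u s) (E t j) (P i) := by
      refine Integrable.integrableOn (Integrable.add ?_ ?_)
      · exact Integrable.of_bound (hm1.comp measurable_prodMk_left).aestronglyMeasurable (K * |b|)
          (ae_of_all _ fun ω => hAx s hs.2 ω)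
      · exact Integrable.of_bound (hm2.comp measurable_prodMk_left).aestronglyMeasurable
          (∑ j, |g j s k|) (ae_of_all _ fun ω => abs_mode_input_le g _ s k)
    rw [setIntegral_eq_sum_fiber (hE s) (hE t j) huInt]
    refine Finset.sum_congr rfl fun l _ => ?_
    have hcongr : ∫ ω in E s l ∩ E t j, u s ω ∂(P i) =
        ∫ ω in E s l ∩ E t j, ((A l *ᵥ X s ω) k + g l s k) ∂(P i) := by
      refine setIntegral_congr_fun ((hE s l).inter (hE t j)) fun ω hω => ?_
      have : clamped σ s ω = l := hω.1
      simp only [u, this]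
    have hZ : StronglyMeasurable[pastSigma σ s] fun ω => (A l *ᵥ X s ω) k + g l s k := by
      refine StronglyMeasurable.add ?_ stronglyMeasurable_const
      simp only [Matrix.mulVec, dotProduct]
      exact Finset.stronglyMeasurable_fun_sum _ fun l' _ =>
        stronglyMeasurable_const.mul (hX.adapted s hs.1 l')
    rw [hcongr, hEs, hEt, hσ.setIntegral_markov i l j hs.1 (sub_nonneg.2 hs.2) hZ]
    congr 1
    have hint1 : Integrable (fun ω => (A l *ᵥ X s ω) k) (P i) :=
      integrable_finsetSum _ fun l' _ => (hXint s l').const_mul _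
    rw [integral_add hint1.integrableOn (integrable_const _), blockMatrix_mulVec]
    congr 1
    · simp only [Matrix.mulVec, dotProduct]
      rw [integral_finsetSum _ fun l' _ => ((hXint s l').const_mul _).integrableOn]
      refine Finset.sum_congr rfl fun l' _ => ?_
      rw [integral_const_mul]
      congr 1
      simp only [moment, clamped_eq hs.1]
    · rw [integral_const, smul_eq_mul, measureReal_restrict_apply_univ]
      rfl
  have hLHS : moment (P i) σ X t (j, k) =
      trans P σ t i j * x0 k + ∫ s in (0 : ℝ)..t, ∫ ω in E t j, u s ω ∂(P i) := by
    simp only [moment]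
    simp_rw [hpath]
    rw [integral_add (integrable_const _), intervalIntegral_integral_swap huint]
    · congr 1
      rw [integral_const, smul_eq_mul, measureReal_restrict_apply_univ, clamped_eq ht]
      rfl
    · have := huint.integral_prod_right
      simp only [Function.uncurry_apply_pair] at this
      simpa only [intervalIntegral.integral_of_le ht, Set.uIoc_of_le ht] using this
  rw [hLHS, hσ.exp_forwardMatrix_mulVec ht]
  congr 1
  · simp
  · refine intervalIntegral.integral_congr fun s hs => ?_
    rw [Set.uIcc_of_le ht] at hs
    rw [hσ.exp_forwardMatrix_mulVec (sub_nonneg.2 hs.2), hinner s hs]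
    rfl

/-- The matrix of the closed linear equation for the moments `E[𝟙(σ t = j) x t]`. -/
def momentMatrix (Q : Matrix M M ℝ) (A : M → Matrix V V ℝ) : Matrix (M × V) (M × V) ℝ :=
  forwardMatrix V Q + blockMatrix A

/-- The moments of a switched linear system solve a linear equation with constant coefficients. -/
lemma moment_eq (hσ : IsMarkovFamily Q P σ) (hgm : ∀ j k, Measurable fun s => g j s k)
    (hgi : ∀ j k, Integrable fun s => g j s k)
    (hX : IsAdaptedSolution σ A g x0 X)
    (i : M) {t : ℝ} (ht : 0 ≤ t) (y : M × V) :
    moment (P i) σ X t y =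
      (exp (t • momentMatrix Q A) *ᵥ fun z => if z.1 = i then x0 z.2 else 0) y +
      ∫ s in (0 : ℝ)..t, (exp ((t - s) • momentMatrix Q A) *ᵥ
        fun z => trans P σ s i z.1 * g z.1 s z.2) y := by
  have hprob := hσ.isProb i
  refine mild_solution_perturb _ _ ht (fun z => ?_) (fun z => ?_)
    (fun s hs z => hσ.moment_mild hgm hgi hX i hs.1 z) y
  · refine ((hgi z.1 z.2).intervalIntegrable (a := 0) (b := t)).continuousOn_mul
      ((hσ.continuousOn_trans i z.1).mono ?_)
    rw [Set.uIcc_of_le ht]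
    exact Set.Icc_subset_Ici_self
  · obtain ⟨b, hb⟩ := hX.bounded t
    have hmeas : Measurable fun s => moment (P i) σ X s z := by
      have h1 : Measurable fun p : ℝ × Ω =>
          if clamped σ p.1 p.2 = z.1 then X p.1 p.2 z.2 else 0 :=
        Measurable.ite (hσ.measurableSet_clamped z.1) (hX.measurable z.2) measurable_const
      have h2 := (h1.stronglyMeasurable.integral_prod_right' (ν := P i)).measurable
      convert h2 using 2 with s
      have hms : MeasurableSet {ω | clamped σ s ω = z.1} :=
        measurable_prodMk_left (hσ.measurableSet_clamped z.1)
      rw [moment, ← integral_indicator hms]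
      exact integral_congr_ae (ae_of_all _ fun ω => by simp [Set.indicator])
    rw [intervalIntegrable_iff]
    refine Measure.integrableOn_of_bounded (f := fun s => moment (P i) σ X s z) (M := b) (by simp)
      hmeas.aestronglyMeasurable ?_
    refine (ae_restrict_iff' measurableSet_uIoc).2 (ae_of_all _ fun s hs => ?_)
    rw [Set.uIoc_of_le ht] at hs
    have hle : ‖∫ ω in {ω | clamped σ s ω = z.1}, X s ω z.2 ∂(P i)‖ ≤
        b * (P i).real {ω | clamped σ s ω = z.1} :=
      norm_setIntegral_le_of_norm_le_const (measure_lt_top _ _) fun ω _ => hb s hs.2 ω z.2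
    refine hle.trans ?_
    have hω : Nonempty Ω := by
      by_contra h
      rw [not_nonempty_iff] at h
      have := hprob.measure_univ
      simp [Set.univ_eq_empty_iff.2 h] at this
    obtain ⟨ω⟩ := hω
    exact mul_le_of_le_one_right ((abs_nonneg _).trans (hb s hs.2 ω z.2)) measureReal_le_one

end IsMarkovFamily

/-! ### The total output of a positive linear system -/

section Convolution

open NormedSpace
open scoped Matrix.Norms.Operator

variable {X : Type*} [Fintype X] [DecidableEq X] {L : Matrix X X ℝ}

lemma setLIntegral_Ioc_eq_lintegral_indicator (K h : ℝ → ℝ≥0∞) (t : ℝ) :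
    ∫⁻ s in Set.Ioc 0 t, K (t - s) * h s =
      ∫⁻ s, (Set.Ici (0 : ℝ)).indicator K (t - s) * (Set.Ioi (0 : ℝ)).indicator h s := by
  rw [← lintegral_indicator measurableSet_Ioc]
  refine lintegral_congr fun s => ?_
  by_cases h1 : 0 < s <;> by_cases h2 : s ≤ t <;> simp [Set.indicator, h1, h2]

lemma measurable_shift_mul {K h : ℝ → ℝ≥0∞} (hK : Measurable K) (hh : Measurable h) :
    Measurable fun p : ℝ × ℝ =>
      (Set.Ici (0 : ℝ)).indicator K (p.1 - p.2) * (Set.Ioi (0 : ℝ)).indicator h p.2 :=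
  ((hK.indicator measurableSet_Ici).comp (measurable_fst.sub measurable_snd)).mul
    ((hh.indicator measurableSet_Ioi).comp measurable_snd)

lemma measurable_convolution {K h : ℝ → ℝ≥0∞} (hK : Measurable K) (hh : Measurable h) :
    Measurable fun t : ℝ => ∫⁻ s in Set.Ioc 0 t, K (t - s) * h s := by
  simp_rw [setLIntegral_Ioc_eq_lintegral_indicator]
  exact (measurable_shift_mul hK hh).lintegral_prod_right'

/-- The integral over `(0, ∞)` of a convolution is the product of the integrals. -/
lemma lintegral_convolution {K h : ℝ → ℝ≥0∞} (hK : Measurable K) (hh : Measurable h) :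
    ∫⁻ t in Set.Ioi (0 : ℝ), ∫⁻ s in Set.Ioc 0 t, K (t - s) * h s =
      (∫⁻ t in Set.Ioi (0 : ℝ), K t) * ∫⁻ s in Set.Ioi (0 : ℝ), h s := by
  have hsupp : (Set.Ioi (0 : ℝ)).indicator (fun t => ∫⁻ s in Set.Ioc 0 t, K (t - s) * h s) =
      fun t => ∫⁻ s in Set.Ioc 0 t, K (t - s) * h s :=
    Set.indicator_eq_self.2 fun t ht => by
      by_contra h'
      have ht0 : ¬ 0 < t := h'
      exact ht (by simp [Set.Ioc_eq_empty ht0])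
  rw [← lintegral_indicator measurableSet_Ioi, hsupp]
  simp_rw [setLIntegral_Ioc_eq_lintegral_indicator]
  rw [lintegral_lintegral_swap (measurable_shift_mul hK hh).aemeasurable,
    setLIntegral_congr Ioi_ae_eq_Ici, ← lintegral_indicator measurableSet_Ici,
    ← lintegral_indicator measurableSet_Ioi,
    ← lintegral_const_mul _ (hh.indicator measurableSet_Ioi)]
  refine lintegral_congr fun s => ?_
  have hKs : Measurable fun t => (Set.Ici (0 : ℝ)).indicator K (t - s) :=
    (hK.indicator measurableSet_Ici).comp (measurable_id.sub_const s)
  rw [lintegral_mul_const _ hKs]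
  congr 1
  exact lintegral_sub_right_eq_self _ s

/-- The total weighted output of `x' = L x + h`, `x 0 = 0` for a Metzler matrix `L` and a
nonnegative input `h`. -/
lemma Matrix.IsMetzler.lintegral_output (hL : L.IsMetzler) {c : X → ℝ} (hc : ∀ x, 0 ≤ c x)
    {h : ℝ → X → ℝ} (hm : ∀ x, Measurable fun s => h s x) (hi : ∀ x, Integrable fun s => h s x)
    (hnn : ∀ s x, 0 ≤ h s x) :
    ∫⁻ t in Set.Ioi (0 : ℝ), ENNReal.ofReal
        (∑ x, c x * ∫ s in (0 : ℝ)..t, (exp ((t - s) • L) *ᵥ h s) x) =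
      ∑ z, (∫⁻ t in Set.Ioi (0 : ℝ), ENNReal.ofReal ((c ᵥ* exp (t • L)) z)) *
        ∫⁻ s in Set.Ioi (0 : ℝ), ENNReal.ofReal (h s z) := by
  have hK : ∀ z, Measurable fun t : ℝ => ENNReal.ofReal ((c ᵥ* exp (t • L)) z) := fun z =>
    (Matrix.continuous_vecMul_exp L c z).measurable.ennreal_ofReal
  have hh : ∀ z, Measurable fun s => ENNReal.ofReal (h s z) := fun z => (hm z).ennreal_ofReal
  have hpt : ∀ t ∈ Set.Ioi (0 : ℝ), ENNReal.ofReal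
      (∑ x, c x * ∫ s in (0 : ℝ)..t, (exp ((t - s) • L) *ᵥ h s) x) =
      ∑ z, ∫⁻ s in Set.Ioc 0 t,
        ENNReal.ofReal ((c ᵥ* exp ((t - s) • L)) z) * ENNReal.ofReal (h s z) := by
    intro t ht
    have ht0 : 0 ≤ t := le_of_lt ht
    have hcont : ∀ x z, Continuous fun s : ℝ => exp ((t - s) • L) x z := fun x z =>
      (Matrix.continuous_exp_smul_entry L x z).comp (continuous_const.sub continuous_id)
    have hint : ∀ z, IntervalIntegrable
        (fun s => (c ᵥ* exp ((t - s) • L)) z * h s z) volume 0 t := fun z =>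
      ((hi z).intervalIntegrable).continuousOn_mul
        ((Matrix.continuous_vecMul_exp L c z).comp
          (continuous_const.sub continuous_id)).continuousOn
    have hswap : ∑ x, c x * ∫ s in (0 : ℝ)..t, (exp ((t - s) • L) *ᵥ h s) x =
        ∫ s in (0 : ℝ)..t, ∑ z, (c ᵥ* exp ((t - s) • L)) z * h s z := by
      simp_rw [← intervalIntegral.integral_const_mul]
      rw [← intervalIntegral.integral_finsetSum fun x _ =>
        (intervalIntegrable_mulVec hcont (fun z => (hi z).intervalIntegrable) x).const_mul _]
      refine intervalIntegral.integral_congr fun s _ => ?_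
      exact Matrix.dotProduct_mulVec c (exp ((t - s) • L)) (h s)
    have hnn' : ∀ z, ∀ s ≤ t, 0 ≤ (c ᵥ* exp ((t - s) • L)) z := fun z s hs =>
      Matrix.vecMul_nonneg_of_nonneg hc (hL.exp_nonneg (sub_nonneg.2 hs)) z
    rw [hswap, intervalIntegral.integral_finsetSum fun z _ => hint z,
      ENNReal.ofReal_sum_of_nonneg fun z _ => intervalIntegral.integral_nonneg ht0
        fun s hs => mul_nonneg (hnn' z s hs.2) (hnn s z)]
    refine Finset.sum_congr rfl fun z _ => ?_
    rw [intervalIntegral.integral_of_le ht0, ofReal_integral_eq_lintegral_ofReal (hint z).1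
      ((ae_restrict_iff' measurableSet_Ioc).2
        (ae_of_all _ fun s hs => mul_nonneg (hnn' z s hs.2) (hnn s z)))]
    exact setLIntegral_congr_fun measurableSet_Ioc fun s hs => ENNReal.ofReal_mul (hnn' z s hs.2)
  rw [setLIntegral_congr_fun measurableSet_Ioi hpt,
    lintegral_finsetSum _ fun z _ => measurable_convolution (hK z) (hh z)]
  exact Finset.sum_congr rfl fun z _ => lintegral_convolution (hK z) (hh z)

/-- A positive `v` with `v L ≤ -c`, `c ≥ 1`, makes `exp (t L)` decay exponentially. -/
lemma Matrix.IsMetzler.exists_exp_le (hL : L.IsMetzler) {v c : X → ℝ} (hv : ∀ x, 0 < v x)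
    (hc : ∀ x, 1 ≤ c x) (h : ∀ x, (v ᵥ* L) x ≤ -c x) :
    ∃ C lam : ℝ, 0 < C ∧ 0 < lam ∧
      ∀ t, 0 ≤ t → ∀ x y, exp (t • L) x y ≤ C * Real.exp (-lam * t) := by
  have hs : 0 ≤ ∑ x, v x := Finset.sum_nonneg fun x _ => (hv x).le
  have hε : 0 < (1 + ∑ x, v x)⁻¹ := by positivity
  have hε' : ∀ x, (v ᵥ* L) x ≤ -((1 + ∑ x, v x)⁻¹ * v x) := fun x => by
    have h1 : v x ≤ ∑ x, v x := Finset.single_le_sum (fun x _ => (hv x).le) (Finset.mem_univ x)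
    have h2 : (1 + ∑ x, v x)⁻¹ * v x ≤ 1 := by
      rw [inv_mul_le_iff₀ (by positivity)]
      linarith
    linarith [h x, hc x]
  have hR : ∀ x y, v y / v x ≤ ∑ x, ∑ y, v y / v x := fun x y =>
    (Finset.single_le_sum (f := fun y => v y / v x) (fun y _ => (div_pos (hv y) (hv x)).le)
      (Finset.mem_univ y)).trans
    (Finset.single_le_sum (f := fun x => ∑ y, v y / v x)
      (fun x _ => Finset.sum_nonneg fun y _ => (div_pos (hv y) (hv x)).le) (Finset.mem_univ x))
  refine ⟨1 + ∑ x, ∑ y, v y / v x, (1 + ∑ x, v x)⁻¹, ?_, hε, fun t ht x y => ?_⟩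
  · exact add_pos_of_pos_of_nonneg one_pos
      (Finset.sum_nonneg fun x _ => Finset.sum_nonneg fun y _ => (div_pos (hv y) (hv x)).le)
  · have h1 : v x * exp (t • L) x y ≤ (v ᵥ* exp (t • L)) y :=
      Finset.single_le_sum (f := fun x => v x * exp (t • L) x y)
        (fun x _ => mul_nonneg (hv x).le (hL.exp_nonneg ht x y)) (Finset.mem_univ x)
    have h2 := h1.trans (hL.vecMul_exp_le hε' ht y)
    have h3 : exp (t • L) x y ≤ v y / v x * Real.exp (-(1 + ∑ x, v x)⁻¹ * t) := by
      rw [div_mul_eq_mul_div, le_div_iff₀ (hv x)]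
      linarith
    refine h3.trans (mul_le_mul_of_nonneg_right ?_ (Real.exp_pos _).le)
    linarith [hR x y]

end Convolution

namespace BufferNetwork

open NormedSpace IsMarkovFamily
open scoped Matrix.Norms.Operator

variable {M V S Ω : Type*} [Fintype M] [DecidableEq M] [Fintype V] [DecidableEq V]
  [Fintype S] [MeasurableSpace Ω] {N : BufferNetwork M V S} {Q : Matrix M M ℝ}
  {P : M → Measure Ω} {σ : ℝ → Ω → M} {β : N.Dest → ℝ} {δ : N.Edge → ℝ}

/-! ### Trajectories of a buffer network -/

lemma isMetzler_Amat (hδ : ∀ e, 0 < δ e) (i : M) : (N.Amat i β δ).IsMetzler := by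
  intro k l hkl
  simp only [Amat, Bmat, Matrix.sub_apply, Matrix.diagonal_apply_ne _ hkl, sub_zero,
    Matrix.hadamard_apply, Dmat, adj, Matrix.of_apply]
  split_ifs with h1 h2 h2
  · exact mul_nonneg (hδ _).le (N.weight_pos i _ h2).le
  all_goals simp

lemma isMetzler_momentMatrix (hQ : ∀ i j, i ≠ j → 0 ≤ Q i j) {A : M → Matrix V V ℝ}
    (hA : ∀ i, (A i).IsMetzler) : (momentMatrix Q A).IsMetzler := by
  rintro ⟨j, k⟩ ⟨i, l⟩ hne
  simp only [momentMatrix, forwardMatrix, blockMatrix, Matrix.add_apply, Matrix.of_apply]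
  by_cases hji : j = i
  · subst hji
    have hkl : k ≠ l := fun h => hne (by rw [h])
    simpa [hkl] using hA j k l hkl
  · simp only [hji, if_false, add_zero]
    split_ifs
    · exact hQ i j (Ne.symm hji)
    · exact le_rfl

lemma vecMul_momentMatrix (A : M → Matrix V V ℝ) (v : M × V → ℝ) (i : M) (l : V) :
    (v ᵥ* momentMatrix Q A) (i, l) =
      ((fun k => v (i, k)) ᵥ* A i) l + ∑ j, Q i j * v (j, l) := by
  rw [momentMatrix, Matrix.vecMul_add, Pi.add_apply, add_comm]
  congr 1
  · simp only [Matrix.vecMul, dotProduct, blockMatrix, Matrix.of_apply, Fintype.sum_prod_type]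
    rw [Finset.sum_eq_single i]
    · simp
    · intro j _ hj
      simp [hj]
    · simp
  · simp [Matrix.vecMul, dotProduct, forwardMatrix, Fintype.sum_prod_type, mul_comm]

/-- An input `f` as a forcing term of the modes. -/
def inputTerm (N : BufferNetwork M V S) (f : ℝ → S → ℝ) (j : M) (s : ℝ) : V → ℝ :=
  N.Gin j *ᵥ f s

lemma measurable_inputTerm {f : ℝ → S → ℝ} (hf : ∀ c, Measurable fun s => f s c) (j : M) (k : V) :
    Measurable fun s => N.inputTerm f j s k :=
  Finset.measurable_sum _ fun c _ => (hf c).const_mul _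

lemma integrable_inputTerm {f : ℝ → S → ℝ} (hf : ∀ c, Integrable fun s => f s c) (j : M) (k : V) :
    Integrable fun s => N.inputTerm f j s k :=
  integrable_finsetSum _ fun c _ => (hf c).const_mul _

section Trajectory

variable {f f' : ℝ → S → ℝ} {x0 : V → ℝ} {x : ℝ → Ω → V → ℝ}

lemma integral_trajectory_eq (hσ : IsMarkovFamily Q P σ) (hf : ∀ c, Measurable fun s => f' s c)
    (hf' : ∀ c, Integrable fun s => f' s c) (hff : f =ᵐ[volume.restrict (Set.Ici 0)] f') {ω : Ω}
    {T : ℝ} (hx : ContinuousOn (fun t => x t ω) (Set.Icc 0 T)) {t : ℝ} (ht : t ∈ Set.Icc 0 T)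
    (k : V) :
    ∫ s in (0 : ℝ)..t, (N.Amat (σ s ω) β δ *ᵥ x s ω + N.Gin (σ s ω) *ᵥ f s) k =
      (∫ s in Set.Ioc 0 t, N.inputTerm f' (clamped σ s ω) s k) +
        ∫ s in (0 : ℝ)..t, (N.Amat (clamped σ s ω) β δ *ᵥ x s ω) k := by
  have hpm := measurableSet_path hσ.measurableSet_clamped ω
  have hxi : ∀ l, IntervalIntegrable (fun s => x s ω l) volume 0 t := fun l => by
    refine ContinuousOn.intervalIntegrable ?_
    rw [Set.uIcc_of_le ht.1]
    exact (continuousOn_pi.1 hx l).mono (Set.Icc_subset_Icc_right ht.2)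
  rw [← intervalIntegral.integral_of_le ht.1, add_comm, ← intervalIntegral.integral_add
    (intervalIntegrable_mode_mulVec (A := fun j => N.Amat j β δ) hpm hxi k)
    (integrable_mode_input (measurable_inputTerm hf) (integrable_inputTerm hf') hpm
      k).intervalIntegrable]
  rw [intervalIntegral.integral_of_le ht.1, intervalIntegral.integral_of_le ht.1]
  refine setIntegral_congr_ae measurableSet_Ioc ?_
  filter_upwards [(ae_restrict_iff' measurableSet_Ici).1 hff] with s hs hst
  rw [clamped_eq hst.1.le, hs hst.1.le]
  rfl

lemma IsTrajectory.isPathSolution (h : N.IsTrajectory σ β δ f x0 x) (hσ : IsMarkovFamily Q P σ)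
    (hf : ∀ c, Measurable fun s => f' s c) (hf' : ∀ c, Integrable fun s => f' s c)
    (hff : f =ᵐ[volume.restrict (Set.Ici 0)] f') (ω : Ω) (T : ℝ) :
    IsPathSolution (fun j => N.Amat j β δ) (fun s => clamped σ s ω)
      (forcing (N.inputTerm f') (fun s => clamped σ s ω) x0) T fun t => x t ω := by
  have hc := (h ω).1.mono (Set.Icc_subset_Ici_self : Set.Icc 0 T ⊆ _)
  refine ⟨hc, fun t ht k => ?_⟩
  refine ((h ω).2 t ht.1 k).trans ?_
  rw [integral_trajectory_eq hσ hf hf' hff hc ht, forcing, add_assoc]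

lemma isTrajectory_of_isPathSolution (hσ : IsMarkovFamily Q P σ)
    (hf : ∀ c, Measurable fun s => f' s c) (hf' : ∀ c, Integrable fun s => f' s c)
    (hff : f =ᵐ[volume.restrict (Set.Ici 0)] f')
    (h : ∀ ω T, IsPathSolution (fun j => N.Amat j β δ) (fun s => clamped σ s ω)
      (forcing (N.inputTerm f') (fun s => clamped σ s ω) x0) T fun t => x t ω) :
    N.IsTrajectory σ β δ f x0 x := by
  intro ω
  refine ⟨fun t ht => ?_, fun t ht k => ?_⟩
  · refine ((h ω (t + 1)).1 t ⟨ht, by linarith⟩).mono_of_mem_nhdsWithin ?_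
    exact inter_mem_nhdsWithin _ (Iic_mem_nhds (by linarith))
  · have hT := h ω t
    rw [integral_trajectory_eq hσ hf hf' hff hT.1 ⟨ht, le_rfl⟩, ← add_assoc]
    exact hT.2 t ⟨ht, le_rfl⟩ k

end Trajectory

/-! ### Expected outputs -/

/-- The weights of the moments in the total expected output. -/
def momentWeight (N : BufferNetwork M V S) (δ : N.Edge → ℝ) (y : M × V) : ℝ :=
  N.outWeight y.1 δ y.2

lemma momentWeight_eq_sum (y : M × V) : N.momentWeight δ y = ∑ r, N.Gout y.1 δ r y.2 := by
  simp [momentWeight, outWeight, Matrix.vecMul, dotProduct]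

lemma integral_output_eq (hσ : IsMarkovFamily Q P σ) {X : ℝ → Ω → V → ℝ} {i : M} {t : ℝ}
    (ht : 0 ≤ t) (hX : ∀ k, Integrable (fun ω => X t ω k) (P i)) (r : V ⊕ N.Edge) :
    ∫ ω, (N.Gout (σ t ω) δ *ᵥ X t ω) r ∂(P i) =
      ∑ y : M × V, N.Gout y.1 δ r y.2 * moment (P i) σ X t y := by
  have hm := fun l => hσ.measurableSet_mode t l ht
  have hint : Integrable (fun ω => (N.Gout (σ t ω) δ *ᵥ X t ω) r) (P i) := by
    simp only [Matrix.mulVec, dotProduct]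
    refine integrable_finsetSum _ fun k _ => ?_
    obtain ⟨c, hc⟩ := (Set.finite_range fun j => ‖N.Gout j δ r k‖).bddAbove
    exact (hX k).bdd_mul (measurable_comp_of_measurableSet_fiber hm
      fun j => N.Gout j δ r k).aestronglyMeasurable (ae_of_all _ fun ω => hc ⟨σ t ω, rfl⟩)
  have h := setIntegral_eq_sum_fiber hm MeasurableSet.univ hint.integrableOn
  simp only [Set.inter_univ, Measure.restrict_univ] at h
  rw [h, Fintype.sum_prod_type]
  refine Finset.sum_congr rfl fun j _ => ?_
  have e : ∫ ω in {ω | σ t ω = j}, (N.Gout (σ t ω) δ *ᵥ X t ω) r ∂(P i) =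
      ∫ ω in {ω | σ t ω = j}, ∑ k, N.Gout j δ r k * X t ω k ∂(P i) := by
    refine setIntegral_congr_fun (hm j) fun ω hω => ?_
    have : σ t ω = j := hω
    simp only [this]
    rfl
  rw [e, integral_finsetSum _ fun k _ => ((hX k).const_mul _).integrableOn]
  refine Finset.sum_congr rfl fun k _ => ?_
  rw [integral_const_mul, moment, clamped_eq ht]

lemma sum_abs_integral_output_le (hσ : IsMarkovFamily Q P σ) (hδ : ∀ e, 0 < δ e)
    {X : ℝ → Ω → V → ℝ} {i : M} {t : ℝ} (ht : 0 ≤ t)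
    (hX : ∀ k, Integrable (fun ω => X t ω k) (P i)) :
    ∑ r, |∫ ω, (N.Gout (σ t ω) δ *ᵥ X t ω) r ∂(P i)| ≤
      ∑ y, N.momentWeight δ y * |moment (P i) σ X t y| := by
  simp_rw [integral_output_eq hσ ht hX, momentWeight_eq_sum, Finset.sum_mul]
  rw [Finset.sum_comm (γ := M × V)]
  refine Finset.sum_le_sum fun r _ => (Finset.abs_sum_le_sum_abs _ _).trans_eq ?_
  refine Finset.sum_congr rfl fun y _ => ?_
  rw [abs_mul, abs_of_nonneg (Gout_nonneg hδ _ _ _)]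

lemma le_sum_abs_integral_output (hσ : IsMarkovFamily Q P σ)
    {X : ℝ → Ω → V → ℝ} {i : M} {t : ℝ} (ht : 0 ≤ t)
    (hX : ∀ k, Integrable (fun ω => X t ω k) (P i)) :
    ∑ y, N.momentWeight δ y * moment (P i) σ X t y ≤
      ∑ r, |∫ ω, (N.Gout (σ t ω) δ *ᵥ X t ω) r ∂(P i)| := by
  simp_rw [integral_output_eq hσ ht hX, momentWeight_eq_sum, Finset.sum_mul]
  rw [Finset.sum_comm (γ := M × V)]
  exact Finset.sum_le_sum fun r _ => le_abs_self _

/-! ### Stability -/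

lemma inputTerm_zero (j : M) (s : ℝ) : N.inputTerm (fun _ => 0) j s = 0 := by
  simp [inputTerm]

lemma forcing_inputTerm_zero (τ : ℝ → M) (x0 : V → ℝ) :
    forcing (N.inputTerm fun _ => 0) τ x0 = fun _ => x0 := by
  ext t k
  simp [forcing, inputTerm_zero]

lemma exists_autonomous_solution (hσ : IsMarkovFamily Q P σ) (x0 : V → ℝ) :
    ∃ X, IsAdaptedSolution σ (fun j => N.Amat j β δ) (N.inputTerm fun _ => 0) x0 X :=
  hσ.exists_solution _ (measurable_inputTerm fun _ => measurable_const)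
    (integrable_inputTerm fun _ => integrable_zero _ _ _) x0

lemma isMetzler_moment (hσ : IsMarkovFamily Q P σ) (hδ : ∀ e, 0 < δ e) :
    (momentMatrix Q fun j => N.Amat j β δ).IsMetzler :=
  isMetzler_momentMatrix hσ.rate_nonneg (isMetzler_Amat hδ)

lemma autonomous_moment_eq (hσ : IsMarkovFamily Q P σ) {x0 : V → ℝ} {X : ℝ → Ω → V → ℝ}
    (hX : IsAdaptedSolution σ (fun j => N.Amat j β δ) (N.inputTerm fun _ => 0) x0 X) (i : M)
    {t : ℝ} (ht : 0 ≤ t) (y : M × V) :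
    moment (P i) σ X t y = (exp (t • momentMatrix Q fun j => N.Amat j β δ) *ᵥ
      fun z => if z.1 = i then x0 z.2 else 0) y := by
  have h0 : (fun _ => 0 : M × V → ℝ) = 0 := rfl
  rw [hσ.moment_eq (measurable_inputTerm (f := fun _ => 0) fun _ => measurable_const)
    (integrable_inputTerm (f := fun _ => 0) fun _ => integrable_zero _ _ _) hX i ht y]
  simp [inputTerm_zero, h0]

/-- A trajectory is dominated by the one that starts in the absolute values of its initial state. -/
lemma IsTrajectory.abs_le (hσ : IsMarkovFamily Q P σ) (hδ : ∀ e, 0 < δ e) {x0 : V → ℝ}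
    {x X : ℝ → Ω → V → ℝ} (hx : N.IsTrajectory σ β δ (fun _ => 0) x0 x)
    (hX : IsAdaptedSolution σ (fun j => N.Amat j β δ) (N.inputTerm fun _ => 0) (fun k => |x0 k|) X)
    {t : ℝ} (ht : 0 ≤ t) (ω : Ω) (k : V) : |x t ω k| ≤ X t ω k := by
  have hpm := measurableSet_path hσ.measurableSet_clamped ω
  have h1 := hx.isPathSolution (f' := fun _ => 0) hσ (fun _ => measurable_const)
    (fun _ => integrable_zero _ _ _) (ae_eq_refl _) ω t
  have h2 := hX.path ω t
  rw [forcing_inputTerm_zero] at h1 h2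
  have h3 := (h2.add hpm h1).nonneg (isMetzler_Amat hδ) hpm
    (fun k => neg_le_iff_add_nonneg.1 (neg_abs_le (x0 k)) |>.trans_eq (add_comm _ _)) ⟨ht, le_rfl⟩ k
  have h4 := (h2.add hpm h1.neg).nonneg (isMetzler_Amat hδ) hpm
    (fun k => (sub_nonneg.2 (le_abs_self (x0 k))).trans_eq (sub_eq_add_neg _ _)) ⟨ht, le_rfl⟩ k
  simp only [Pi.add_apply, Pi.neg_apply] at h3 h4
  exact _root_.abs_le.2 ⟨by linarith, by linarith⟩

lemma integral_sum_eq_sum_moment (hσ : IsMarkovFamily Q P σ) {X : ℝ → Ω → V → ℝ} {i : M} {t : ℝ}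
    (ht : 0 ≤ t) (hX : ∀ k, Integrable (fun ω => X t ω k) (P i)) :
    ∫ ω, ∑ k, X t ω k ∂(P i) = ∑ y, moment (P i) σ X t y := by
  have h := setIntegral_eq_sum_fiber (fun l => hσ.measurableSet_mode t l ht) MeasurableSet.univ
    (integrable_finsetSum Finset.univ fun k _ => hX k).integrableOn
  simp only [Set.inter_univ, Measure.restrict_univ] at h
  rw [h, Fintype.sum_prod_type]
  refine Finset.sum_congr rfl fun j _ => ?_
  rw [integral_finsetSum _ fun k _ => (hX k).integrableOn]
  refine Finset.sum_congr rfl fun k _ => ?_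
  rw [moment, clamped_eq ht]

/-- A strict linear copositive Lyapunov function proves exponential mean stability. -/
lemma expMeanStable_of_lyapunov (hσ : IsMarkovFamily Q P σ) (hδ : ∀ e, 0 < δ e) {v : M → V → ℝ}
    (hv : ∀ i k, 0 < v i k)
    (h : ∀ i k, (v i ᵥ* N.Amat i β δ) k + ∑ j, Q i j * v j k ≤ -N.outWeight i δ k) :
    N.ExpMeanStable P σ β δ := by
  have hL := isMetzler_moment (N := N) (β := β) hσ hδ
  obtain ⟨C, lam, hC, hlam, hexp⟩ := hL.exists_exp_le (v := fun y => v y.1 y.2)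
    (c := N.momentWeight δ) (fun y => hv _ _) (fun y => one_le_outWeight hδ _ _)
    (fun y => by rw [vecMul_momentMatrix]; exact h y.1 y.2)
  refine ⟨(Fintype.card (M × V) + 1) * C, lam, by positivity, hlam, fun i x0 x hx t ht => ?_⟩
  have hprob := hσ.isProb i
  obtain ⟨X, hX⟩ := exists_autonomous_solution (N := N) (β := β) (δ := δ) hσ fun k => |x0 k|
  have hint := fun k => hX.integrable (P i) t k
  have h1 : ∫ ω, ∑ k, |x t ω k| ∂(P i) ≤ ∫ ω, ∑ k, X t ω k ∂(P i) :=
    integral_mono_of_nonneg (ae_of_all _ fun ω => Finset.sum_nonneg fun k _ => abs_nonneg _)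
      (integrable_finsetSum _ fun k _ => hint k)
      (ae_of_all _ fun ω => Finset.sum_le_sum fun k _ => hx.abs_le hσ hδ hX ht ω k)
  have h2 : ∀ y, moment (P i) σ X t y ≤ C * Real.exp (-lam * t) * ∑ k, |x0 k| := by
    intro y
    rw [autonomous_moment_eq hσ hX i ht y, Matrix.mulVec, dotProduct, Fintype.sum_prod_type,
      Finset.sum_eq_single i (fun j _ hj => by simp [hj]) (by simp), Finset.mul_sum]
    simp only [if_true]
    exact Finset.sum_le_sum fun k _ =>
      mul_le_mul_of_nonneg_right (hexp t ht _ _) (abs_nonneg _)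
  have h3 : 0 ≤ C * Real.exp (-lam * t) * ∑ k, |x0 k| :=
    mul_nonneg (by positivity) (Finset.sum_nonneg fun k _ => abs_nonneg _)
  have h4 := Finset.sum_le_sum fun y (_ : y ∈ Finset.univ) => h2 y
  rw [Finset.sum_const, Finset.card_univ, nsmul_eq_mul,
    ← integral_sum_eq_sum_moment hσ ht hint] at h4
  refine (h1.trans h4).trans ?_
  linarith

/-- The moment equation of a stable network is exponentially stable. -/
lemma ExpMeanStable.exists_exp_le (h : N.ExpMeanStable P σ β δ) (hσ : IsMarkovFamily Q P σ) :
    ∃ C lam : ℝ, 0 < lam ∧ ∀ t, 0 ≤ t → ∀ y z,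
      exp (t • momentMatrix Q fun j => N.Amat j β δ) y z ≤ C * Real.exp (-lam * t) := by
  obtain ⟨C, lam, -, hlam, h⟩ := h
  refine ⟨C, lam, hlam, fun t ht y z => ?_⟩
  obtain ⟨i, l⟩ := z
  have hprob := hσ.isProb i
  obtain ⟨X, hX⟩ := exists_autonomous_solution (N := N) (β := β) (δ := δ) hσ (Pi.single l 1)
  have hint := fun k => hX.integrable (P i) t k
  have htraj : N.IsTrajectory σ β δ (fun _ => 0) (Pi.single l 1) X :=
    isTrajectory_of_isPathSolution hσ (fun _ => measurable_const)
      (fun _ => integrable_zero _ _ _) (ae_eq_refl _) hX.path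
  have h1 := h i _ X htraj t ht
  have h2 : ∑ k, |(Pi.single l 1 : V → ℝ) k| = 1 := by
    rw [Finset.sum_eq_single l (fun k _ hk => by simp [hk]) (by simp)]
    simp
  have h3 : (fun z : M × V => if z.1 = i then (Pi.single l 1 : V → ℝ) z.2 else 0) =
      Pi.single (i, l) 1 := by
    ext ⟨j, k⟩
    simp only [Pi.single_apply, Prod.mk.injEq]
    split_ifs <;> simp_all
  have h4 := autonomous_moment_eq hσ hX i ht y
  rw [h3, Matrix.mulVec_single_one, Matrix.col_apply] at h4
  have hsum : Integrable (fun ω => ∑ k, |X t ω k|) (P i) :=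
    integrable_finsetSum _ fun k _ => (hint k).abs
  have h5 : moment (P i) σ X t y ≤ ∫ ω, ∑ k, |X t ω k| ∂(P i) := by
    refine (setIntegral_mono (hint y.2).integrableOn hsum.integrableOn fun ω =>
      (le_abs_self _).trans (Finset.single_le_sum (f := fun k => |X t ω k|)
        (fun _ _ => abs_nonneg _) (Finset.mem_univ y.2))).trans ?_
    exact setIntegral_le_integral hsum
      (ae_of_all _ fun ω => Finset.sum_nonneg fun k _ => abs_nonneg _)
  rw [← h4]
  rw [h2, mul_one] at h1
  exact h5.trans h1

/-! ### The gain -/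

/-- The input of the moment equation, for the initial mode `i` and the forcing terms `g`. Negative
times play no role; `max s 0` makes the coefficients continuous. -/
def momentInput (P : M → Measure Ω) (σ : ℝ → Ω → M) (i : M) (g : M → ℝ → V → ℝ) (s : ℝ)
    (z : M × V) : ℝ :=
  trans P σ (max s 0) i z.1 * g z.1 s z.2

section MomentInput

variable {g : M → ℝ → V → ℝ}

lemma continuous_trans_max (hσ : IsMarkovFamily Q P σ) (i j : M) :
    Continuous fun s => trans P σ (max s 0) i j :=
  (hσ.continuousOn_trans i j).comp_continuous (continuous_id.max continuous_const)
    fun s => Set.mem_Ici.2 (le_max_right s 0)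

lemma measurable_momentInput (hσ : IsMarkovFamily Q P σ) (hg : ∀ j k, Measurable fun s => g j s k)
    (i : M) (z : M × V) : Measurable fun s => momentInput P σ i g s z :=
  (continuous_trans_max hσ i z.1).measurable.mul (hg _ _)

lemma integrable_momentInput (hσ : IsMarkovFamily Q P σ)
    (hg : ∀ j k, Integrable fun s => g j s k) (i : M) (z : M × V) :
    Integrable fun s => momentInput P σ i g s z :=
  (hg z.1 z.2).bdd_mul (c := 1) (continuous_trans_max hσ i z.1).aestronglyMeasurable
    (ae_of_all _ fun s => by
      rw [Real.norm_eq_abs, abs_of_nonneg (trans_nonneg _ _ _)]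
      exact hσ.trans_le_one _ _ _)

lemma momentInput_nonneg (hg : ∀ j s k, 0 ≤ g j s k) (i : M) (s : ℝ) (z : M × V) :
    0 ≤ momentInput P σ i g s z :=
  mul_nonneg (trans_nonneg _ _ _) (hg _ _ _)

/-- Without an initial state, the moments are the response to the input of the moment equation. -/
lemma moment_eq_integral_momentInput (hσ : IsMarkovFamily Q P σ) {A : M → Matrix V V ℝ}
    (hgm : ∀ j k, Measurable fun s => g j s k) (hgi : ∀ j k, Integrable fun s => g j s k)
    {X : ℝ → Ω → V → ℝ} (hX : IsAdaptedSolution σ A g 0 X) (i : M) {t : ℝ} (ht : 0 ≤ t)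
    (y : M × V) :
    moment (P i) σ X t y = ∫ s in (0 : ℝ)..t,
      (exp ((t - s) • momentMatrix Q A) *ᵥ momentInput P σ i g s) y := by
  rw [hσ.moment_eq hgm hgi hX i ht y]
  have h0 : (fun z : M × V => if z.1 = i then (0 : V → ℝ) z.2 else 0) = 0 := by
    ext z
    simp
  rw [h0, Matrix.mulVec_zero, Pi.zero_apply, zero_add]
  refine intervalIntegral.integral_congr fun s hs => ?_
  rw [Set.uIcc_of_le ht] at hs
  congr 2
  ext z
  rw [momentInput, max_eq_left hs.1]

end MomentInput

lemma inputTerm_origin (f : ℝ → S → ℝ) (i : M) (s : ℝ) (c : S) :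
    N.inputTerm f i s (N.origin i c) = f s c := by
  classical
  simp [inputTerm, Gin, Matrix.mulVec, dotProduct]

lemma sum_mul_abs_inputTerm_le {γ : ℝ} {v : V → ℝ} (hv : ∀ k, 0 ≤ v k) {i : M}
    (h : ∀ c, v (N.origin i c) ≤ γ) (f : ℝ → S → ℝ) (s : ℝ) :
    ∑ k, v k * |N.inputTerm f i s k| ≤ γ * ∑ c, |f s c| := by
  have h1 : ∀ k, |N.inputTerm f i s k| ≤ ∑ c, N.Gin i k c * |f s c| := fun k => by
    refine (Finset.abs_sum_le_sum_abs _ _).trans_eq (Finset.sum_congr rfl fun c _ => ?_)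
    rw [abs_mul, abs_of_nonneg]
    simp only [Gin, Matrix.of_apply]
    split_ifs <;> norm_num
  refine (Finset.sum_le_sum fun k _ => mul_le_mul_of_nonneg_left (h1 k) (hv k)).trans ?_
  have h2 : ∑ k, v k * ∑ c, N.Gin i k c * |f s c| = ∑ c, v (N.origin i c) * |f s c| := by
    simp_rw [Finset.mul_sum]
    rw [Finset.sum_comm]
    refine Finset.sum_congr rfl fun c _ => ?_
    rw [← vecMul_Gin v i c, Matrix.vecMul, dotProduct, Finset.sum_mul]
    exact Finset.sum_congr rfl fun k _ => by ring
  rw [h2, Finset.mul_sum]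
  exact Finset.sum_le_sum fun c _ => mul_le_mul_of_nonneg_right (h c) (abs_nonneg _)

lemma sum_mul_momentInput_le (hσ : IsMarkovFamily Q P σ) {γ : ℝ} {v : M → V → ℝ}
    (hv : ∀ i k, 0 ≤ v i k) (h : ∀ i c, v i (N.origin i c) ≤ γ) (i : M) (f : ℝ → S → ℝ) (s : ℝ) :
    ∑ z : M × V, v z.1 z.2 * momentInput P σ i (fun j s k => |N.inputTerm f j s k|) s z ≤
      γ * ∑ c, |f s c| := by
  have h1 : ∑ z : M × V, v z.1 z.2 * momentInput P σ i (fun j s k => |N.inputTerm f j s k|) s z =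
      ∑ j, trans P σ (max s 0) i j * ∑ k, v j k * |N.inputTerm f j s k| := by
    rw [Fintype.sum_prod_type]
    refine Finset.sum_congr rfl fun j _ => ?_
    rw [Finset.mul_sum]
    exact Finset.sum_congr rfl fun k _ => by rw [momentInput]; ring
  rw [h1]
  refine (Finset.sum_le_sum fun j _ => mul_le_mul_of_nonneg_left
    (sum_mul_abs_inputTerm_le (hv j) (h j) f s) (trans_nonneg _ _ _)).trans_eq ?_
  rw [← Finset.sum_mul, hσ.sum_trans (le_max_right _ _), one_mul]

/-- A linear copositive Lyapunov function bounds the gain. -/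
lemma l1Gain_le_of_lyapunov (hσ : IsMarkovFamily Q P σ) (hδ : ∀ e, 0 < δ e) {v : M → V → ℝ}
    (hv : ∀ i k, 0 < v i k)
    (h : ∀ i k, (v i ᵥ* N.Amat i β δ) k + ∑ j, Q i j * v j k ≤ -N.outWeight i δ k)
    {γ : ℝ} (hγ : 0 ≤ γ) (hvγ : ∀ i c, v i (N.origin i c) ≤ γ) :
    N.l1Gain P σ β δ ≤ ENNReal.ofReal γ := by
  refine iSup_le fun i => iSup_le fun f => iSup_le fun x => iSup_le fun hf => iSup_le fun hx =>
    ENNReal.div_le_of_le_mul ?_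
  have hprob := hσ.isProb i
  -- a measurable representative of the input that vanishes at negative times
  let f' : ℝ → S → ℝ := (Set.Ici (0 : ℝ)).indicator (hf.1.mk f)
  have hff : f =ᵐ[volume.restrict (Set.Ici 0)] f' := by
    filter_upwards [hf.1.ae_eq_mk, self_mem_ae_restrict (measurableSet_Ici (a := (0 : ℝ)))]
      with s h1 h2
    simp only [f', Set.indicator_of_mem h2]
    exact h1
  have hm : ∀ c, Measurable fun s => f' s c := fun c =>
    (measurable_pi_apply c).comp
      (hf.1.stronglyMeasurable_mk.measurable.indicator measurableSet_Ici)
  have hi' : Integrable f' := (integrable_indicator_iff measurableSet_Ici).2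
    (hf.congr hf.1.ae_eq_mk)
  have hi : ∀ c, Integrable fun s => f' s c := fun c => hi'.eval c
  obtain ⟨X, hX⟩ := hσ.exists_solution (fun j => N.Amat j β δ) (measurable_inputTerm (N := N) hm)
    (integrable_inputTerm hi) 0
  have hxX : ∀ t, 0 ≤ t → ∀ ω, x t ω = X t ω := fun t ht ω =>
    (hx.isPathSolution hσ hm hi hff ω t).unique (measurableSet_path hσ.measurableSet_clamped ω)
      (hX.path ω t) ⟨ht, le_rfl⟩
  let g : M → ℝ → V → ℝ := fun j s k => |N.inputTerm f' j s k|
  have hgm : ∀ j k, Measurable fun s => g j s k := fun j k => (measurable_inputTerm hm j k).abs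
  have hgi : ∀ j k, Integrable fun s => g j s k := fun j k => (integrable_inputTerm hi j k).abs
  have hgn : ∀ j s k, 0 ≤ g j s k := fun _ _ _ => abs_nonneg _
  let L := momentMatrix Q fun j => N.Amat j β δ
  have hL : L.IsMetzler := isMetzler_moment hσ hδ
  have hc : ∀ y, 0 ≤ N.momentWeight δ y := fun y =>
    zero_le_one.trans (one_le_outWeight hδ _ _)
  have hmom : ∀ t, 0 ≤ t → ∀ y, |moment (P i) σ X t y| ≤
      ∫ s in (0 : ℝ)..t, (exp ((t - s) • L) *ᵥ momentInput P σ i g s) y := by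
    intro t ht y
    rw [moment_eq_integral_momentInput hσ (measurable_inputTerm hm) (integrable_inputTerm hi) hX i
      ht y, ← Real.norm_eq_abs]
    have hcont : ∀ x z, Continuous fun s : ℝ => exp ((t - s) • L) x z := fun x z =>
      (Matrix.continuous_exp_smul_entry L x z).comp (continuous_const.sub continuous_id)
    refine intervalIntegral.norm_integral_le_of_norm_le ht (ae_of_all _ fun s hs => ?_)
      (intervalIntegrable_mulVec hcont
        (fun z => (integrable_momentInput hσ hgi i z).intervalIntegrable) y)
    refine (Finset.abs_sum_le_sum_abs _ _).trans (Finset.sum_le_sum fun z _ => ?_)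
    rw [abs_mul, abs_of_nonneg (hL.exp_nonneg (sub_nonneg.2 hs.2) y z)]
    refine mul_le_mul_of_nonneg_left ?_ (hL.exp_nonneg (sub_nonneg.2 hs.2) y z)
    rw [momentInput, abs_mul, abs_of_nonneg (trans_nonneg _ _ _)]
    rfl
  have hnum : ∀ t ∈ Set.Ioi (0 : ℝ),
      ENNReal.ofReal (∑ r, |∫ ω, (N.Gout (σ t ω) δ *ᵥ x t ω) r ∂(P i)|) ≤
      ENNReal.ofReal (∑ y, N.momentWeight δ y *
        ∫ s in (0 : ℝ)..t, (exp ((t - s) • L) *ᵥ momentInput P σ i g s) y) := by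
    intro t ht
    have ht0 : 0 ≤ t := le_of_lt ht
    refine ENNReal.ofReal_le_ofReal ?_
    simp_rw [hxX t ht0]
    exact (sum_abs_integral_output_le hσ hδ ht0 fun k => hX.integrable (P i) t k).trans
      (Finset.sum_le_sum fun y _ => mul_le_mul_of_nonneg_left (hmom t ht0 y) (hc y))
  have hden : ∫⁻ t in Set.Ici (0 : ℝ), ENNReal.ofReal (∑ c, |f t c|) =
      ∫⁻ t in Set.Ioi (0 : ℝ), ENNReal.ofReal (∑ c, |f' t c|) := by
    rw [setLIntegral_congr Ioi_ae_eq_Ici]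
    refine lintegral_congr_ae ?_
    filter_upwards [hff] with t ht
    rw [ht]
  rw [hden, ← setLIntegral_congr Ioi_ae_eq_Ici]
  refine (setLIntegral_mono' measurableSet_Ioi hnum).trans ?_
  rw [hL.lintegral_output hc (measurable_momentInput hσ hgm i) (integrable_momentInput hσ hgi i)
    (momentInput_nonneg hgn i)]
  have hK : ∀ z : M × V, ∫⁻ t in Set.Ioi (0 : ℝ),
      ENNReal.ofReal ((N.momentWeight δ ᵥ* exp (t • L)) z) ≤ ENNReal.ofReal (v z.1 z.2) :=
    hL.lintegral_vecMul_exp_le (v := fun z => v z.1 z.2) (fun z => (hv _ _).le) hc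
      (fun z => by rw [vecMul_momentMatrix]; exact h z.1 z.2)
  refine (Finset.sum_le_sum fun z _ => mul_le_mul_left (hK z) _).trans ?_
  simp_rw [← lintegral_const_mul _ (measurable_momentInput hσ hgm i _).ennreal_ofReal]
  rw [← lintegral_finsetSum _ fun z _ =>
    (measurable_momentInput hσ hgm i z).ennreal_ofReal.const_mul _,
    ← lintegral_const_mul _ (Finset.measurable_sum _ fun c _ => (hm c).abs).ennreal_ofReal]
  refine lintegral_mono fun s => ?_
  simp_rw [← ENNReal.ofReal_mul (hv _ _).le]
  rw [← ENNReal.ofReal_mul hγ, ← ENNReal.ofReal_sum_of_nonneg fun z _ =>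
    mul_nonneg (hv _ _).le (momentInput_nonneg hgn i s z)]
  exact ENNReal.ofReal_le_ofReal
    (sum_mul_momentInput_le hσ (fun i k => (hv i k).le) hvγ i f' s)

/-- A short pulse at an origin is amplified almost by the Lyapunov weight of that origin. -/
lemma mul_one_sub_le_l1Gain (hσ : IsMarkovFamily Q P σ) (hδ : ∀ e, 0 < δ e) {i : M} {c : S}
    {w η : ℝ} (hη : 0 < η) (hη1 : η < 1) (hw : 0 ≤ w)
    (h : ENNReal.ofReal w = ∫⁻ t in Set.Ioi (0 : ℝ), ENNReal.ofReal ((N.momentWeight δ ᵥ*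
      exp (t • momentMatrix Q fun j => N.Amat j β δ)) (i, N.origin i c))) :
    ENNReal.ofReal (w * (1 - η)) ≤ N.l1Gain P σ β δ := by
  classical
  have hprob := hσ.isProb i
  -- the mode is unlikely to change during the pulse
  obtain ⟨ε, hε, hstay⟩ : ∃ ε > 0, ∀ s ∈ Set.Ioc 0 ε, 1 - η ≤ trans P σ s i i := by
    have h1 := (continuous_trans_max hσ i i).tendsto 0
    simp only [max_self, hσ.trans_zero, if_true] at h1
    obtain ⟨ε, hε, h2⟩ := Metric.eventually_nhds_iff.1
      (h1.eventually (lt_mem_nhds (by linarith : 1 - η < 1)))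
    refine ⟨ε / 2, by positivity, fun s hs => ?_⟩
    have h3 := h2 (y := s) (by
      rw [Real.dist_eq, sub_zero, abs_of_pos hs.1]
      linarith [hs.2])
    rw [max_eq_left hs.1.le] at h3
    exact h3.le
  let f : ℝ → S → ℝ := (Set.Ioc 0 ε).indicator fun _ => Pi.single c 1
  have hfc : ∀ c', (fun s => f s c') =
      (Set.Ioc 0 ε).indicator fun _ => (Pi.single c 1 : S → ℝ) c' := fun c' => by
    ext s
    by_cases hs : s ∈ Set.Ioc 0 ε <;> simp [f, hs]
  have hm : ∀ c', Measurable fun s => f s c' := fun c' => by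
    rw [hfc]
    exact measurable_const.indicator measurableSet_Ioc
  have hi : ∀ c', Integrable fun s => f s c' := fun c' => by
    rw [hfc]
    exact (integrable_indicator_iff measurableSet_Ioc).2 (integrableOn_const (by simp))
  have hf : IntegrableOn f (Set.Ici 0) := (Integrable.of_eval hi).integrableOn
  have hfn : ∀ s c', 0 ≤ f s c' := fun s c' => by
    rw [congrFun (hfc c') s]
    refine Set.indicator_nonneg (fun _ _ => ?_) s
    exact (Pi.single_nonneg (i := c).2 zero_le_one : (0 : S → ℝ) ≤ Pi.single c 1) c'
  obtain ⟨X, hX⟩ := hσ.exists_solution (fun j => N.Amat j β δ) (measurable_inputTerm (N := N) hm)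
    (integrable_inputTerm hi) 0
  have htraj : N.IsTrajectory σ β δ f 0 X :=
    isTrajectory_of_isPathSolution hσ hm hi (ae_eq_refl _) hX.path
  have hden : ∫⁻ t in Set.Ici (0 : ℝ), ENNReal.ofReal (∑ c, |f t c|) = ENNReal.ofReal ε := by
    have h1 : ∀ t, ENNReal.ofReal (∑ c, |f t c|) =
        (Set.Ioc (0 : ℝ) ε).indicator (fun _ => 1) t := fun t => by
      have h2 : ∑ c', |(Pi.single c 1 : S → ℝ) c'| = 1 := by
        rw [Finset.sum_eq_single c (fun k _ hk => by simp [hk]) (by simp)]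
        simp
      by_cases ht : t ∈ Set.Ioc 0 ε <;> simp [f, ht, h2]
    simp_rw [h1]
    rw [lintegral_indicator measurableSet_Ioc, Measure.restrict_restrict measurableSet_Ioc,
      Set.inter_eq_left.2 fun s (hs : s ∈ Set.Ioc 0 ε) => Set.mem_Ici.2 hs.1.le]
    simp
  let L := momentMatrix Q fun j => N.Amat j β δ
  have hL : L.IsMetzler := isMetzler_moment hσ hδ
  have hc : ∀ y, 0 ≤ N.momentWeight δ y := fun y =>
    zero_le_one.trans (one_le_outWeight hδ _ _)
  have hgn : ∀ j s k, 0 ≤ N.inputTerm f j s k := fun j s k =>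
    Finset.sum_nonneg fun c' _ => mul_nonneg (by
      simp only [Gin, Matrix.of_apply]
      split_ifs <;> norm_num) (hfn s c')
  have hnum : ENNReal.ofReal w * ENNReal.ofReal ((1 - η) * ε) ≤ ∫⁻ t in Set.Ici (0 : ℝ),
      ENNReal.ofReal (∑ r, |∫ ω, (N.Gout (σ t ω) δ *ᵥ X t ω) r ∂(P i)|) := by
    rw [← setLIntegral_congr Ioi_ae_eq_Ici]
    have h1 : ∀ t ∈ Set.Ioi (0 : ℝ), ENNReal.ofReal (∑ y, N.momentWeight δ y *
        ∫ s in (0 : ℝ)..t, (exp ((t - s) • L) *ᵥ momentInput P σ i (N.inputTerm f) s) y) ≤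
        ENNReal.ofReal (∑ r, |∫ ω, (N.Gout (σ t ω) δ *ᵥ X t ω) r ∂(P i)|) := by
      intro t ht
      have ht0 : 0 ≤ t := le_of_lt ht
      refine ENNReal.ofReal_le_ofReal ?_
      refine le_trans (le_of_eq ?_)
        (le_sum_abs_integral_output hσ ht0 fun k => hX.integrable (P i) t k)
      refine Finset.sum_congr rfl fun y _ => ?_
      rw [moment_eq_integral_momentInput hσ (measurable_inputTerm hm) (integrable_inputTerm hi) hX
        i ht0 y]
    refine le_trans ?_ (setLIntegral_mono' measurableSet_Ioi h1)
    rw [hL.lintegral_output hc (measurable_momentInput hσ (measurable_inputTerm hm) i)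
      (integrable_momentInput hσ (integrable_inputTerm hi) i) (momentInput_nonneg hgn i)]
    refine le_trans ?_ (Finset.single_le_sum (fun _ _ => zero_le)
      (Finset.mem_univ (i, N.origin i c)))
    rw [h]
    refine mul_le_mul_right ?_ _
    have h2 : ∫⁻ _ in Set.Ioc (0 : ℝ) ε, ENNReal.ofReal (1 - η) =
        ENNReal.ofReal ((1 - η) * ε) := by
      rw [setLIntegral_const, Real.volume_Ioc, sub_zero, ENNReal.ofReal_mul (by linarith)]
    rw [← h2]
    refine le_trans (setLIntegral_mono' measurableSet_Ioc fun s hs => ?_)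
      (lintegral_mono_set (Set.Ioc_subset_Ioi_self : Set.Ioc 0 ε ⊆ _))
    refine ENNReal.ofReal_le_ofReal ?_
    simp only [momentInput, inputTerm_origin, max_eq_left hs.1.le]
    simpa [f, hs] using hstay s hs
  refine le_trans ?_ (le_iSup_of_le i <| le_iSup_of_le f <| le_iSup_of_le X <|
    le_iSup_of_le hf <| le_iSup_of_le htraj le_rfl)
  rw [hden, ENNReal.le_div_iff_mul_le (Or.inl (by simpa using hε)) (Or.inl (by simp))]
  refine le_trans (le_of_eq ?_) hnum
  rw [← ENNReal.ofReal_mul (mul_nonneg hw (by linarith)), ← ENNReal.ofReal_mul hw, mul_assoc]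

/-- A stable network has a linear copositive Lyapunov function whose values at the origins are at
most the gain: the expected total future output for each initial mode and unit initial state. -/
lemma ExpMeanStable.exists_lyapunov (h : N.ExpMeanStable P σ β δ) (hσ : IsMarkovFamily Q P σ)
    (hδ : ∀ e, 0 < δ e) :
    ∃ v : M → V → ℝ, (∀ i k, 0 < v i k) ∧
      (∀ i k, (v i ᵥ* N.Amat i β δ) k + ∑ j, Q i j * v j k = -N.outWeight i δ k) ∧
      ∀ i c, ENNReal.ofReal (v i (N.origin i c)) ≤ N.l1Gain P σ β δ := by
  obtain ⟨C, lam, hlam, hexp⟩ := h.exists_exp_le hσ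
  obtain ⟨v, hv, hvL, hvK⟩ := (isMetzler_moment (N := N) (β := β) hσ hδ).exists_vecMul_eq_neg hlam
    hexp (c := N.momentWeight δ) fun y => zero_lt_one.trans_le (one_le_outWeight hδ _ _)
  refine ⟨fun i k => v (i, k), fun i k => hv _, fun i k => ?_, fun i c => ?_⟩
  · rw [← vecMul_momentMatrix (fun j => N.Amat j β δ) v i k]
    exact hvL (i, k)
  · have hlim : Tendsto (fun η : ℝ => ENNReal.ofReal (v (i, N.origin i c) * (1 - η))) (𝓝[>] 0)
        (𝓝 (ENNReal.ofReal (v (i, N.origin i c)))) := by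
      have : Continuous fun η : ℝ => ENNReal.ofReal (v (i, N.origin i c) * (1 - η)) :=
        ENNReal.continuous_ofReal.comp (by fun_prop)
      simpa using (this.tendsto 0).mono_left nhdsWithin_le_nhds
    refine le_of_tendsto hlim ?_
    filter_upwards [Ioo_mem_nhdsGT (zero_lt_one : (0 : ℝ) < 1)] with η hη
    exact mul_one_sub_le_l1Gain hσ hδ hη.1 hη.2 (hv _).le (hvK _)

end BufferNetwork

namespace BufferNetwork

variable {M V S Ω : Type*} [Fintype M] [DecidableEq M] [Fintype V] [DecidableEq V]
  [Fintype S] [MeasurableSpace Ω] {N : BufferNetwork M V S} {Q : Matrix M M ℝ}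
  {P : M → Measure Ω} {σ : ℝ → Ω → M} {β : N.Dest → ℝ} {δ : N.Edge → ℝ}
  {T : N.Tuning} {Ao : M → (N.Edge → ℝ) → Matrix V V ℝ}
  {Ad : M → (N.Dest → ℝ) → (N.Edge → ℝ) → Matrix V V ℝ}

/-! ### Feasibility and the tuning problem -/

/-- A network without edges and destinations has no Lyapunov function: at a mode where `v` is
smallest, the left-hand side of the inequality is nonnegative. -/
lemma nonempty_of_lyapunov [Nonempty M] [Nonempty V] (hQ : ∀ i j, i ≠ j → 0 ≤ Q i j)
    (hQs : ∀ i, ∑ j, Q i j = 0) (hδ : ∀ e, 0 < δ e) {v : M → V → ℝ}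
    (h : ∀ i k, (v i ᵥ* N.Amat i β δ) k + ∑ j, Q i j * v j k ≤ -N.outWeight i δ k) :
    Nonempty (N.Dest ⊕ N.Edge) := by
  by_contra hne
  rw [not_nonempty_iff, isEmpty_sum] at hne
  obtain ⟨h1, h2⟩ := hne
  have hA : ∀ i, N.Amat i β δ = 0 := by
    intro i
    have hadj : N.adj i = 0 := by
      ext k l
      have : (l, k) ∉ N.edges i := fun he => h2.false ⟨(l, k), i, he⟩
      simp [adj, this]
    have hB : N.Bmat i β = 0 := by
      have : ∀ k, k ∉ N.dests i := fun k hk => h1.false ⟨k, i, hk⟩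
      simp [Bmat, this]
    simp [Amat, hadj, hB]
  obtain ⟨k⟩ := ‹Nonempty V›
  obtain ⟨i, hi⟩ := Finite.exists_min fun i => v i k
  have h3 := h i k
  rw [hA, Matrix.vecMul_zero, Pi.zero_apply, zero_add] at h3
  have h4 : 0 ≤ ∑ j, Q i j * (v j k - v i k) := Finset.sum_nonneg fun j _ => by
    by_cases hij : i = j
    · simp [hij]
    · exact mul_nonneg (hQ i j hij) (sub_nonneg.2 (hi j))
  simp_rw [mul_sub, Finset.sum_sub_distrib, ← Finset.sum_mul, hQs, zero_mul, sub_zero] at h4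
  linarith [one_le_outWeight hδ i k]

lemma argL_sub_argR_lyap (hA : N.PosynomialAssumption T Ao Ad) (x : N.Vars) (i : M) (k : V) :
    N.argL T Q Ao (.lyap i k) x - N.argR T Q Ad (.lyap i k) x =
      (x.2.1 i ᵥ* N.Amat i (fun d => Real.exp (x.2.2.1 d)) (fun e => Real.exp (x.2.2.2 e))) k +
        ∑ j, Q i j * x.2.1 j k + N.outWeight i (fun e => Real.exp (x.2.2.2 e)) k := by
  rw [hA.split i _ _ (fun _ => Real.exp_pos _) (fun _ => Real.exp_pos _), Matrix.vecMul_sub,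
    ← Finset.add_sum_erase _ _ (Finset.mem_univ i)]
  simp only [argL, argR, Pi.sub_apply, outWeight]
  ring

/-- The logarithms removed: feasibility consists of linear copositive Lyapunov inequalities and the
bounds on the gain, the cost and the parameters. -/
lemma feasible_iff [Nonempty M] [Nonempty V] (hQ : ∀ i j, i ≠ j → 0 ≤ Q i j)
    (hQs : ∀ i, ∑ j, Q i j = 0) (hA : N.PosynomialAssumption T Ao Ad) {γ : ℝ} {v : M → V → ℝ}
    {φ : N.Dest → ℝ} {η : N.Edge → ℝ} (hβ : β = fun k => Real.exp (φ k))
    (hδ : δ = fun e => Real.exp (η e)) :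
    (N.logProgram T Q Ao Ad).Feasible (γ, v, φ, η) ↔
      0 < γ ∧ (∀ i k, 0 < v i k) ∧
      (∀ i k, (v i ᵥ* N.Amat i β δ) k + ∑ j, Q i j * v j k ≤ -N.outWeight i δ k) ∧
      (∀ i c, v i (N.origin i c) ≤ γ) ∧ T.cost β δ ≤ T.budget ∧
      (∀ k, β k ≤ T.betaMax k) ∧ ∀ e, δ e ≤ T.deltaMax e := by
  subst hβ hδ
  have hlyap := argL_sub_argR_lyap (Q := Q) hA (γ, v, φ, η)
  have hlog : ∀ j, 0 < N.argL T Q Ao j (γ, v, φ, η) → 0 < N.argR T Q Ad j (γ, v, φ, η) →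
      (Real.log (N.argL T Q Ao j (γ, v, φ, η)) - Real.log (N.argR T Q Ad j (γ, v, φ, η)) ≤ 0 ↔
        N.argL T Q Ao j (γ, v, φ, η) ≤ N.argR T Q Ad j (γ, v, φ, η)) := fun j h1 h2 => by
    rw [sub_nonpos, Real.log_le_log_iff h1 h2]
  constructor
  · rintro ⟨⟨hγ, hv, hpos⟩, hcon⟩
    have hle : ∀ j, N.argL T Q Ao j (γ, v, φ, η) ≤ N.argR T Q Ad j (γ, v, φ, η) := fun j =>
      (hlog j (hpos j).1 (hpos j).2).1 (hcon j)
    refine ⟨hγ, hv, fun i k => ?_, fun i c => ?_, hle .cost, fun k => ?_, fun e => ?_⟩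
    · have h1 := hlyap i k
      have h2 := hle (.lyap i k)
      simp only at h1
      linarith
    · have h1 := hle (.gain i c)
      simp only [argL, argR, vecMul_Gin] at h1
      exact h1
    · exact (hle (.beta k)).trans_eq (Real.exp_log (T.betaMax_pos k))
    · exact (hle (.delta e)).trans_eq (Real.exp_log (T.deltaMax_pos e))
  · rintro ⟨hγ, hv, hL, hg, hc, hb, hd⟩
    have hne := nonempty_of_lyapunov hQ hQs (fun _ => Real.exp_pos _) hL
    have hle : ∀ j, 0 < N.argL T Q Ao j (γ, v, φ, η) ∧
        N.argL T Q Ao j (γ, v, φ, η) ≤ N.argR T Q Ad j (γ, v, φ, η) := by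
      rintro (⟨i, k⟩ | ⟨i, c⟩ | _ | k | e)
      · refine ⟨argL_lyap_pos hQ hA ⟨hγ, hv⟩ i k, ?_⟩
        have h1 := hlyap i k
        have h2 := hL i k
        simp only at h1
        linarith
      · simp only [argL, argR, vecMul_Gin]
        exact ⟨hv _ _, hg i c⟩
      · exact ⟨cost_pos hA hne (fun _ => Real.exp_pos _) fun _ => Real.exp_pos _, hc⟩
      · exact ⟨Real.exp_pos _, (hb k).trans_eq (Real.exp_log (T.betaMax_pos k)).symm⟩
      · exact ⟨Real.exp_pos _, (hd e).trans_eq (Real.exp_log (T.deltaMax_pos e)).symm⟩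
    exact ⟨⟨hγ, hv, fun j => ⟨(hle j).1, (hle j).1.trans_le (hle j).2⟩⟩,
      fun j => (hlog j (hle j).1 ((hle j).1.trans_le (hle j).2)).2 (hle j).2⟩

lemma exists_feasible_iff [Nonempty M] [Nonempty V] (hσ : IsMarkovFamily Q P σ)
    (hA : N.PosynomialAssumption T Ao Ad) {γ : ℝ} (hγ : 0 < γ) (φ : N.Dest → ℝ)
    (η : N.Edge → ℝ) :
    (∃ v, (N.logProgram T Q Ao Ad).Feasible (γ, v, φ, η)) ↔
      T.Admissible P σ (fun k => Real.exp (φ k)) (fun e => Real.exp (η e)) ∧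
      N.l1Gain P σ (fun k => Real.exp (φ k)) (fun e => Real.exp (η e)) ≤ ENNReal.ofReal γ := by
  have hδ : ∀ e, 0 < Real.exp (η e) := fun _ => Real.exp_pos _
  constructor
  · rintro ⟨v, hv⟩
    obtain ⟨-, hv, hL, hg, hc, hb, hd⟩ :=
      (feasible_iff hσ.rate_nonneg hσ.rate_sum hA rfl rfl).1 hv
    exact ⟨⟨fun _ => Real.exp_pos _, hb, hδ, hd, hc, expMeanStable_of_lyapunov hσ hδ hv hL⟩,
      l1Gain_le_of_lyapunov hσ hδ hv hL hγ.le hg⟩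
  · rintro ⟨h, hgain⟩
    obtain ⟨v, hv, hL, hg⟩ := h.stable.exists_lyapunov hσ hδ
    refine ⟨v, (feasible_iff hσ.rate_nonneg hσ.rate_sum hA rfl rfl).2 ⟨hγ, hv,
      fun i k => (hL i k).le, fun i c => ?_, h.cost_le, h.beta_le, h.delta_le⟩⟩
    exact (ENNReal.ofReal_le_ofReal_iff hγ.le).1 ((hg i c).trans hgain)

/-- The gain of a stable network is positive and finite. -/
lemma ExpMeanStable.exists_l1Gain_eq [Nonempty M] [Nonempty S] (h : N.ExpMeanStable P σ β δ)
    (hσ : IsMarkovFamily Q P σ) (hδ : ∀ e, 0 < δ e) :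
    ∃ γ, 0 < γ ∧ N.l1Gain P σ β δ = ENNReal.ofReal γ := by
  obtain ⟨v, hv, hL, hg⟩ := h.exists_lyapunov hσ hδ
  obtain ⟨p, hp⟩ := Finite.exists_max fun p : M × S => v p.1 (N.origin p.1 p.2)
  have hle := l1Gain_le_of_lyapunov hσ hδ hv (fun i k => (hL i k).le)
    (hv p.1 (N.origin p.1 p.2)).le fun i c => hp (i, c)
  exact ⟨_, hv p.1 (N.origin p.1 p.2), le_antisymm hle (hg p.1 p.2)⟩

lemma Tuning.Admissible.exists_feasible [Nonempty M] [Nonempty V] [Nonempty S]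
    (h : T.Admissible P σ β δ) (hσ : IsMarkovFamily Q P σ)
    (hA : N.PosynomialAssumption T Ao Ad) :
    ∃ γ v, 0 < γ ∧ N.l1Gain P σ β δ = ENNReal.ofReal γ ∧ (N.logProgram T Q Ao Ad).Feasible
      (γ, v, fun k => Real.log (β k), fun e => Real.log (δ e)) := by
  obtain ⟨γ, hγ, hgain⟩ := h.stable.exists_l1Gain_eq hσ h.delta_pos
  have hβ : (fun k => Real.exp (Real.log (β k))) = β := funext fun k => Real.exp_log (h.beta_pos k)
  have hδ : (fun e => Real.exp (Real.log (δ e))) = δ := funext fun e => Real.exp_log (h.delta_pos e)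
  obtain ⟨v, hv⟩ := (exists_feasible_iff hσ hA hγ (fun k => Real.log (β k))
    (fun e => Real.log (δ e))).2 (by rw [hβ, hδ]; exact ⟨h, hgain.le⟩)
  exact ⟨γ, v, hγ, hgain, hv⟩

end BufferNetwork

end

theorem theorem1 {M V S Ω : Type*} [Fintype M] [DecidableEq M] [Nonempty M]
    [Fintype V] [DecidableEq V] [Fintype S] [Nonempty S] [MeasurableSpace Ω]
    (N : BufferNetwork M V S) (Q : Matrix M M ℝ) (P : M → Measure Ω) (σ : ℝ → Ω → M)
    (hσ : IsMarkovFamily Q P σ) (T : N.Tuning)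
    (Ao : M → (N.Edge → ℝ) → Matrix V V ℝ)
    (Ad : M → (N.Dest → ℝ) → (N.Edge → ℝ) → Matrix V V ℝ)
    (hA : N.PosynomialAssumption T Ao Ad) :
    -- the program consists of DC functions, and it is a DC program in logarithmic variables
    (N.logProgram T Q Ao Ad).HasDCFunctions ∧
    ((N.logProgram T Q Ao Ad).substitute N.expVars).IsDCProgram ∧
    -- sublevel sets of the two problems correspond
    (∀ (γ : ℝ) (φ : N.Dest → ℝ) (η : N.Edge → ℝ), 0 < γ →
      ((∃ v, (N.logProgram T Q Ao Ad).Feasible (γ, v, φ, η)) ↔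
        T.Admissible P σ (fun k => Real.exp (φ k)) (fun e => Real.exp (η e)) ∧
        N.l1Gain P σ (fun k => Real.exp (φ k)) (fun e => Real.exp (η e)) ≤ ENNReal.ofReal γ)) ∧
    -- the optimal values agree
    (⨅ (β : N.Dest → ℝ) (δ : N.Edge → ℝ) (_ : T.Admissible P σ β δ), N.l1Gain P σ β δ) =
      (⨅ (x : N.Vars) (_ : (N.logProgram T Q Ao Ad).Feasible x), ENNReal.ofReal x.1) ∧
    -- solutions of the program give solutions of the tuning problem
    (∀ (γ : ℝ) (v : M → V → ℝ) (φ : N.Dest → ℝ) (η : N.Edge → ℝ),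
      (N.logProgram T Q Ao Ad).IsSolution (γ, v, φ, η) →
        T.IsOptimal P σ (fun k => Real.exp (φ k)) (fun e => Real.exp (η e)) ∧
        N.l1Gain P σ (fun k => Real.exp (φ k)) (fun e => Real.exp (η e)) = ENNReal.ofReal γ) ∧
    -- and all of them arise in this way
    (∀ (β : N.Dest → ℝ) (δ : N.Edge → ℝ), T.IsOptimal P σ β δ →
      ∃ (γ : ℝ) (v : M → V → ℝ) (φ : N.Dest → ℝ) (η : N.Edge → ℝ),
        (N.logProgram T Q Ao Ad).IsSolution (γ, v, φ, η) ∧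
        β = (fun k => Real.exp (φ k)) ∧ δ = (fun e => Real.exp (η e)) ∧
        N.l1Gain P σ β δ = ENNReal.ofReal γ) := by
  have : Nonempty V := ⟨N.origin (Classical.arbitrary M) (Classical.arbitrary S)⟩
  have hsub : ∀ x : N.Vars, (N.logProgram T Q Ao Ad).Feasible x →
      T.Admissible P σ (fun k => Real.exp (x.2.2.1 k)) (fun e => Real.exp (x.2.2.2 e)) ∧
      N.l1Gain P σ (fun k => Real.exp (x.2.2.1 k)) (fun e => Real.exp (x.2.2.2 e)) ≤
        ENNReal.ofReal x.1 := fun x hx =>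
    (BufferNetwork.exists_feasible_iff hσ hA hx.1.1 x.2.2.1 x.2.2.2).1 ⟨x.2.1, hx⟩
  refine ⟨BufferNetwork.logProgram_hasDCFunctions hσ.rate_nonneg hσ.rate_sum hA,
    BufferNetwork.logProgram_substitute_isDCProgram hσ.rate_nonneg hσ.rate_sum hA,
    fun γ φ η hγ => BufferNetwork.exists_feasible_iff hσ hA hγ φ η, ?_, ?_, ?_⟩
  · refine le_antisymm (le_iInf₂ fun x hx => ?_)
      (le_iInf fun β => le_iInf fun δ => le_iInf fun h => ?_)
    · exact iInf_le_of_le _ (iInf_le_of_le _ (iInf_le_of_le (hsub x hx).1 (hsub x hx).2))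
    · obtain ⟨γ, v, -, hgain, hf⟩ := h.exists_feasible hσ hA
      exact iInf₂_le_of_le _ hf hgain.ge
  · rintro γ v φ η ⟨hf, hmin⟩
    obtain ⟨hadm, hle⟩ := hsub _ hf
    have hge : ∀ β' δ', T.Admissible P σ β' δ' → ENNReal.ofReal γ ≤ N.l1Gain P σ β' δ' := by
      intro β' δ' h'
      obtain ⟨γ', v', -, hgain, hf'⟩ := h'.exists_feasible hσ hA
      have h := hmin _ hf'
      simp only [BufferNetwork.logProgram, sub_zero] at h
      rw [hgain]
      exact ENNReal.ofReal_le_ofReal h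
    exact ⟨⟨hadm, fun β' δ' h' => hle.trans (hge β' δ' h')⟩, le_antisymm hle (hge _ _ hadm)⟩
  · rintro β δ ⟨hadm, hmin⟩
    obtain ⟨γ, v, -, hgain, hf⟩ := hadm.exists_feasible hσ hA
    refine ⟨γ, v, _, _, ⟨hf, fun y hy => ?_⟩, funext fun k => (Real.exp_log (hadm.beta_pos k)).symm,
      funext fun e => (Real.exp_log (hadm.delta_pos e)).symm, hgain⟩
    have h := (hmin _ _ (hsub y hy).1).trans (hsub y hy).2
    rw [hgain, ENNReal.ofReal_le_ofReal_iff hy.1.1.le] at h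
    simpa only [BufferNetwork.logProgram, sub_zero] using h
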